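/- Let $U\subset\mathbb R$ be an open neighborhood of $0$ and let $c:U\to\mathbb R$ satisfy $c(0)=1$. Let $\varphi\in C_b^2(\mathbb R)$ and $\psi\in C_b^1(\mathbb R)$ (that is, $\varphi$ and $\psi$ are of class $C^2$ and $C^1$ and are bounded together with all their derivatives up to order $2$ and $1$, respectively), suppose that $\varphi_x(x)\to0$ and $\psi(x)\to0$ as $|x|\to\infty$, and suppose that there is a point $x_0\in\mathbb R$ with $$\psi_x(x_0)+\varphi_{xx}(x_0)>0\qquad\text{or}\qquad \psi_x(x_0)-\varphi_{xx}(x_0)>0 .$$ For $\varepsilon>0$ consider the classical ($C^2$) solution $u$ of the Cauchy problem $$u_{tt}-c(u_x)^2u_{xx}=0,\qquad u(0,x)=\varepsilon\varphi(x),\quad u_t(0,x)=\varepsilon\psi(x),\qquad x\in\mathbb R,$$ with $u_x$ taking values in $U$, and let its lifespan $T^*$ be the supremum of all $T>0$ such that a classical solution exists on $[0,T)\times\mathbb R$ and $$\sup_{t\in[0,T)}\Bigl(\|u\|_{L^\infty}+\|u_t\|_{L^\infty}+\|u_x\|_{L^\infty}+\|u_{tt}\|_{L^\infty}+\|u_{tx}\|_{L^\infty}+\|u_{xx}\|_{L^\infty}+\|c(u_x)^{-1}\|_{L^\infty}\Bigr)(t)<\infty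 .$$ (a) Let $p>2$ and put $m=\lceil p-2\rceil$ and $\alpha=p-\lceil p-1\rceil\in(0,1]$. Suppose that $c\in C^{m,\alpha}(U)$ (that is, $c$ is $m$ times continuously differentiable on $U$ and $c^{(m)}$ is Hölder continuous with exponent $\alpha$ on $U$), that $c'(0)=\dots=c^{(m)}(0)=0$, and that there are constants $C_1,C_2>0$ with $|c^{(m)}(\theta)|\le C_1|\theta|^{\alpha}$ and $c'(\theta)\ge C_2|\theta|^{p-2}$ for all $\theta\in U$. Then there exist constants $\varepsilon_0>0$ and $C'>0$, with $C'$ independent of $\varepsilon$, such that for all $0<\varepsilon\le\varepsilon_0$ the solution has a positive lifespan $T^*$ with $$T^*\le C'\varepsilon^{-(p-1)} .$$ (b) Suppose instead that $c\in C^1(U)$ and $c'(0)>0$. Then there exist constants $\varepsilon_0>0$ and $C'>0$, with $C'$ independent of $\varepsilon$, such that for all $0<\varepsilon\le\varepsilon_0$ the solution has a positive lifespan $T^*$ with $$T^*\le C'\varepsilon^{-1} .$$ Moreover, in both cases, for all $0<\varepsilon\le\varepsilon_0$, the solution $u$ exists on $[0,T^*)\times\mathbb R$ and $$\limsup_{t\to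 T^*}\bigl\{\|u_{tx}(t)\|_{L^\infty}+\|u_{xx}(t)\|_{L^\infty}\bigr\}=\infty .$$ -/

import Mathlib

open Set Filter Topology
open scoped ENNReal

namespace QuasilinearWave

/-- `C_b^m(ℝ)`: the functions of class `C^m` that are bounded together with all their derivatives
up to order `m`. -/
def BoundedContDiff (m : ℕ) (f : ℝ → ℝ) : Prop :=
  ContDiff ℝ m f ∧ ∀ k ≤ m, ∃ M : ℝ, ∀ x, |iteratedDeriv k f x| ≤ M

/-- `C^{m,α}(Ω)` for an open set `Ω ⊆ ℝ`: the functions of class `C^m` on `Ω` whose `m`-th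
derivative is Hölder continuous with exponent `α` on `Ω` (used for `0 < α ≤ 1`). -/
def HolderClass (m : ℕ) (α : ℝ) (Ω : Set ℝ) (f : ℝ → ℝ) : Prop :=
  ContDiffOn ℝ m f Ω ∧ ∃ K : ℝ, ∀ x ∈ Ω, ∀ y ∈ Ω,
    |iteratedDeriv m f x - iteratedDeriv m f y| ≤ K * |x - y| ^ α

/-- The degeneracy condition on the wave speed with exponent `p > 2`. With `m = ⌈p - 2⌉ ≥ 1` and
`α = p - ⌈p - 1⌉ ∈ (0, 1]`: `c ∈ C^{m,α}(U)`, `c'(0) = ⋯ = c^{(m)}(0) = 0` and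
`|c^{(m)}(θ)| ≤ C |θ|^α` on `U`. -/
def DegenerateSpeed (p : ℝ) (U : Set ℝ) (c : ℝ → ℝ) : Prop :=
  HolderClass ⌈p - 2⌉₊ (p - (⌈p - 1⌉ : ℤ)) U c ∧
  (∀ k : ℕ, 1 ≤ k → k ≤ ⌈p - 2⌉₊ → iteratedDeriv k c 0 = 0) ∧
  ∃ C > 0, ∀ θ ∈ U, |iteratedDeriv ⌈p - 2⌉₊ c θ| ≤ C * |θ| ^ (p - (⌈p - 1⌉ : ℤ))

/-- Time derivative on `[0, ∞)` (one-sided at `t = 0`) of a function `u t x`. -/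
noncomputable def dt (u : ℝ → ℝ → ℝ) (t x : ℝ) : ℝ :=
  derivWithin (fun s => u s x) (Ici 0) t

/-- Space derivative of a function `u t x`. -/
noncomputable def dx (u : ℝ → ℝ → ℝ) (t x : ℝ) : ℝ :=
  deriv (fun y => u t y) x

/-- `u` is a classical (that is, `C^2`) solution on `[0, T) × ℝ` of `u_tt - c(u_x)^2 u_xx = 0`
with `u(0, ·) = f` and `u_t(0, ·) = g`. The speed `c` is only meaningful on `U`, so `u_x` is
required to take its values in `U`. -/
structure IsClassicalSolution (c : ℝ → ℝ) (U : Set ℝ) (f g : ℝ → ℝ) (T : ℝ)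
    (u : ℝ → ℝ → ℝ) : Prop where
  contDiffOn : ContDiffOn ℝ 2 (fun z : ℝ × ℝ => u z.1 z.2) (Ico 0 T ×ˢ univ)
  dx_mem : ∀ t ∈ Ico 0 T, ∀ x, dx u t x ∈ U
  equation : ∀ t ∈ Ico 0 T, ∀ x, dt (dt u) t x - c (dx u t x) ^ 2 * dx (dx u) t x = 0
  initial : ∀ x, u 0 x = f x
  initial_dt : ∀ x, dt u 0 x = g x

/-- The sup norm with values in `[0, ∞]`; for continuous functions it is the `L^∞` norm. -/
noncomputable def supNorm (f : ℝ → ℝ) : ℝ≥0∞ := ⨆ x, ‖f x‖ₑ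

/-- The sum of the `L^∞` norms at time `t` of `u`, `u_t`, `u_x`, `u_tt`, `u_tx`, `u_xx` and
`c(u_x)⁻¹`. The last inverse is taken in `[0, ∞]`, so that it is `∞` where `c(u_x) = 0`. -/
noncomputable def totalNorm (c : ℝ → ℝ) (u : ℝ → ℝ → ℝ) (t : ℝ) : ℝ≥0∞ :=
  supNorm (u t) + supNorm (dt u t) + supNorm (dx u t) + supNorm (dt (dt u) t)
    + supNorm (dx (dt u) t) + supNorm (dx (dx u) t) + ⨆ x, ‖c (dx u t x)‖ₑ⁻¹

/-- `u` is a classical solution on `[0, T) × ℝ` with `sup_{t ∈ [0, T)} totalNorm < ∞`. -/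
def IsBoundedSolution (c : ℝ → ℝ) (U : Set ℝ) (f g : ℝ → ℝ) (T : ℝ) (u : ℝ → ℝ → ℝ) : Prop :=
  IsClassicalSolution c U f g T u ∧ ⨆ t ∈ Ico 0 T, totalNorm c u t < ∞

/-- `T` is the lifespan of the Cauchy problem with data `f`, `g`: the supremum (in particular,
positive and finite) of all `T' > 0` up to which there is a solution with bounded norms. -/
def IsLifespan (c : ℝ → ℝ) (U : Set ℝ) (f g : ℝ → ℝ) (T : ℝ) : Prop :=
  IsLUB {T' : ℝ | 0 < T' ∧ ∃ u, IsBoundedSolution c U f g T' u} T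

/-- `u` is the solution on `[0, T) × ℝ`, with norms bounded on `[0, T')` for all `T' < T`. -/
def IsSolutionUpTo (c : ℝ → ℝ) (U : Set ℝ) (f g : ℝ → ℝ) (T : ℝ) (u : ℝ → ℝ → ℝ) : Prop :=
  IsClassicalSolution c U f g T u ∧ ∀ T' < T, ⨆ t ∈ Ico 0 T', totalNorm c u t < ∞

/-- `limsup_{t ↑ T} (‖u_tx(t)‖ + ‖u_xx(t)‖) = ∞`. -/
def SecondDerivativesBlowUp (T : ℝ) (u : ℝ → ℝ → ℝ) : Prop :=
  limsup (fun t => supNorm (dx (dt u) t) + supNorm (dx (dx u) t)) (𝓝[<] T) = ∞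

/-- The blowup assertion with rate `ε^{-q}` for the data `(ε φ, ε ψ)`, for all small `ε`: the
lifespan `T` is finite with `T ≤ C' ε^{-q}`, the solution exists on `[0, T)`, and its second
derivatives `u_tx`, `u_xx` become unbounded as `t ↑ T`. -/
def BlowsUpWithRate (c : ℝ → ℝ) (U : Set ℝ) (φ ψ : ℝ → ℝ) (q : ℝ) : Prop :=
  ∃ ε₀ > 0, ∃ C' > 0, ∀ ε : ℝ, 0 < ε → ε ≤ ε₀ →
    ∃ T : ℝ, IsLifespan c U (fun x => ε * φ x) (fun x => ε * ψ x) T ∧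
      T ≤ C' * ε ^ (-q) ∧
      (∃ u, IsSolutionUpTo c U (fun x => ε * φ x) (fun x => ε * ψ x) T u) ∧
      ∀ u, IsSolutionUpTo c U (fun x => ε * φ x) (fun x => ε * ψ x) T u →
        SecondDerivativesBlowUp T u

end QuasilinearWave

/-! Let `L` be the primitive of the speed with `L 0 = 0`. The Riemann invariants r = u_t + L(u_x)
and s = u_t - L(u_x) turn the wave equation into the diagonal system r_t = k(q) r_x, s_t = -k(q) s_x
with q = (r - s)/2 = L(u_x) and k = c ∘ L⁻¹. Hence r is constant along left-moving characteristics
and s along right-moving ones. Both keep the size of the data, so only their gradients, that is u_tx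
and u_xx, can become unbounded.

Blow-up: along a left-moving characteristic the weighted gradient y = √k r_x satisfies y' =
k'(q)/(2√k) y², an equation free of s_x (`hasDerivWithinAt_weighted`). Since k'(q) is bounded below
by a multiple of |q|^(p-2), it remains to keep q away from 0. The characteristic starts at a point
x₁ near x₀ where (ψ + φ_x)' > 0 and also ψ + φ_x ≠ 0, so that |r| ≥ 2mε and r_x ≥ mε there. The
value of r is preserved; after a waiting time independent of ε, the right-moving characteristics it
meets come from so far to the left that |s| ≤ mε. Then |q| ≥ mε/2, the coefficient is at least of
order ε^(p-2), and 1/y, which starts at order 1/ε, would become negative after a time of order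
ε^(-(p-1)) (`time_le`, `time_le_rpow`). Part (b) is the case p = 2, and the second sign condition
follows by reflecting space.

Lifespan: the speed is replaced by a global extension close to 1 (`exists_speedExtension`); small
data keep u_x in the region where both speeds agree (`IsClassicalSolution.abs_dx_le`). The diagonal
system has C¹ solutions on a time interval depending only on the gradient of the data
(`exists_local_diagSol`): with the labels of the two characteristics as coordinates, the speed is a
known function and the problem becomes linear. Together with uniqueness this gives continuation as
long as gradients are bounded, so the supremum of the existence times is positive, carries a
solution, and forces the second derivatives to blow up (`SmallData.exists_lifespan`). -/

namespace QuasilinearWave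

/-! ### Diagonal systems -/

/-- The space-time slab `[0, T) × ℝ`. -/
def slab (T : ℝ) : Set (ℝ × ℝ) := Ico 0 T ×ˢ univ

/-- The linear form `(τ, ξ) ↦ a τ + b ξ`. -/
noncomputable def form (a b : ℝ) : ℝ × ℝ →L[ℝ] ℝ :=
  a • ContinuousLinearMap.fst ℝ ℝ ℝ + b • ContinuousLinearMap.snd ℝ ℝ ℝ

@[simp] theorem form_apply (a b : ℝ) (z : ℝ × ℝ) : form a b z = a * z.1 + b * z.2 := by
  simp [form]

/-- Speeds of class `C^1` close to `1` with derivative bounded by `K`. -/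
structure IsSpeed (k : ℝ → ℝ) (K : ℝ) : Prop where
  contDiff : ContDiff ℝ 1 k
  near_one : ∀ q, |k q - 1| ≤ 1 / 100
  deriv_le : ∀ q, |deriv k q| ≤ K

/-- The diagonal system `r_t = k(q) r_x`, `s_t = -k(q) s_x` with `q = (r - s) / 2`, for functions
of class `C^1` on `[0, T) × ℝ`. -/
structure DiagSol (k : ℝ → ℝ) (T : ℝ) (r s : ℝ → ℝ → ℝ) : Prop where
  left : ∀ t ∈ Ico 0 T, ∀ x, HasFDerivWithinAt (fun z : ℝ × ℝ => r z.1 z.2)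
    (form (k ((r t x - s t x) / 2) * dx r t x) (dx r t x)) (slab T) (t, x)
  right : ∀ t ∈ Ico 0 T, ∀ x, HasFDerivWithinAt (fun z : ℝ × ℝ => s z.1 z.2)
    (form (-(k ((r t x - s t x) / 2) * dx s t x)) (dx s t x)) (slab T) (t, x)
  continuous_left : ContinuousOn (fun z : ℝ × ℝ => dx r z.1 z.2) (slab T)
  continuous_right : ContinuousOn (fun z : ℝ × ℝ => dx s z.1 z.2) (slab T)

/-- The space derivatives of `r` and `s` are bounded by `M` on `[0, T) × ℝ`. -/
def GradientBound (T : ℝ) (r s : ℝ → ℝ → ℝ) (M : ℝ) : Prop :=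
  ∀ t ∈ Ico 0 T, ∀ x, |dx r t x| ≤ M ∧ |dx s t x| ≤ M

theorem mem_slab {T t x : ℝ} : (t, x) ∈ slab T ↔ t ∈ Ico 0 T := by simp [slab]

theorem slab_mono {T T' : ℝ} (h : T ≤ T') : slab T ⊆ slab T' :=
  prod_mono (Ico_subset_Ico_right h) Subset.rfl

theorem slab_mem_nhdsWithin {T T' t x : ℝ} (h : t < T') : slab T' ∈ 𝓝[slab T] (t, x) := by
  have h1 : {z : ℝ × ℝ | z.1 < T'} ∈ 𝓝 (t, x) :=
    (isOpen_lt continuous_fst continuous_const).mem_nhds h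
  filter_upwards [mem_nhdsWithin_of_mem_nhds h1, self_mem_nhdsWithin] with z hz hz'
  exact ⟨⟨hz'.1.1, hz⟩, mem_univ _⟩

namespace IsSpeed

variable {k : ℝ → ℝ} {K : ℝ}

theorem hasDerivAt (hk : IsSpeed k K) (q : ℝ) : HasDerivAt k (deriv k q) q :=
  (hk.contDiff.differentiable one_ne_zero q).hasDerivAt

theorem continuous (hk : IsSpeed k K) : Continuous k := hk.contDiff.continuous

theorem continuous_deriv (hk : IsSpeed k K) : Continuous (deriv k) :=
  hk.contDiff.continuous_deriv le_rfl

theorem nonneg (hk : IsSpeed k K) : 0 ≤ K := (abs_nonneg _).trans (hk.deriv_le 0)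

theorem lower (hk : IsSpeed k K) (q : ℝ) : 99 / 100 ≤ k q := by
  have := abs_le.1 (hk.near_one q); linarith

theorem upper (hk : IsSpeed k K) (q : ℝ) : k q ≤ 101 / 100 := by
  have := abs_le.1 (hk.near_one q); linarith

theorem pos (hk : IsSpeed k K) (q : ℝ) : 0 < k q := by linarith [hk.lower q]

theorem abs_sub_le (hk : IsSpeed k K) (p q : ℝ) : |k p - k q| ≤ K * |p - q| :=
  convex_univ.norm_image_sub_le_of_norm_hasDerivWithin_le (f' := deriv k) (C := K)
    (fun x _ => (hk.hasDerivAt x).hasDerivWithinAt) (fun x _ => hk.deriv_le x)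
    (mem_univ q) (mem_univ p)

end IsSpeed

/-! ### Restriction of slab derivatives to time slices and to curves -/

theorem hasDerivAt_of_hasFDerivWithinAt_slab {R : ℝ → ℝ → ℝ} {T t x a d : ℝ} (ht : t ∈ Ico 0 T)
    (h : HasFDerivWithinAt (fun z : ℝ × ℝ => R z.1 z.2) (form a d) (slab T) (t, x)) :
    HasDerivAt (R t) d x := by
  have h1 : HasDerivWithinAt (fun y : ℝ => (t, y)) ((0 : ℝ), (1 : ℝ)) univ x :=
    ((hasDerivAt_const x t).prodMk (hasDerivAt_id x)).hasDerivWithinAt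
  have h2 := HasFDerivWithinAt.comp_hasDerivWithinAt x h h1
    (fun y _ => mem_slab.2 ht)
  simpa [Function.comp_def] using h2

theorem hasDerivWithinAt_along {R : ℝ → ℝ → ℝ} {T t t₁ a d b : ℝ} {γ : ℝ → ℝ} (ht₁ : t₁ < T)
    (h : HasFDerivWithinAt (fun z : ℝ × ℝ => R z.1 z.2) (form a d) (slab T) (t, γ t))
    (hγ : HasDerivWithinAt γ b (Icc 0 t₁) t) :
    HasDerivWithinAt (fun t => R t (γ t)) (a + d * b) (Icc 0 t₁) t := by
  have h1 : HasDerivWithinAt (fun t => (t, γ t)) ((1 : ℝ), b) (Icc 0 t₁) t :=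
    (hasDerivWithinAt_id t _).prodMk hγ
  have h2 := HasFDerivWithinAt.comp_hasDerivWithinAt t h h1
    (fun y hy => mem_slab.2 ⟨hy.1, hy.2.trans_lt ht₁⟩)
  simpa [Function.comp_def] using h2

/-! ### Characteristics, transport and reflection -/

namespace DiagSol

variable {k : ℝ → ℝ} {K T M : ℝ} {r s : ℝ → ℝ → ℝ}

theorem hasDerivAt_left (h : DiagSol k T r s) {t : ℝ} (ht : t ∈ Ico 0 T) (x : ℝ) :
    HasDerivAt (r t) (dx r t x) x :=
  hasDerivAt_of_hasFDerivWithinAt_slab ht (h.left t ht x)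

theorem hasDerivAt_right (h : DiagSol k T r s) {t : ℝ} (ht : t ∈ Ico 0 T) (x : ℝ) :
    HasDerivAt (s t) (dx s t x) x :=
  hasDerivAt_of_hasFDerivWithinAt_slab ht (h.right t ht x)

theorem continuousOn_r (h : DiagSol k T r s) :
    ContinuousOn (fun z : ℝ × ℝ => r z.1 z.2) (slab T) :=
  fun z hz => (h.left z.1 hz.1 z.2).continuousWithinAt

theorem continuousOn_s (h : DiagSol k T r s) :
    ContinuousOn (fun z : ℝ × ℝ => s z.1 z.2) (slab T) :=
  fun z hz => (h.right z.1 hz.1 z.2).continuousWithinAt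

theorem continuousOn_speed (h : DiagSol k T r s) (hk : IsSpeed k K) :
    ContinuousOn (fun z : ℝ × ℝ => k ((r z.1 z.2 - s z.1 z.2) / 2)) (slab T) :=
  hk.continuous.comp_continuousOn ((h.continuousOn_r.sub h.continuousOn_s).div_const 2)

theorem mono (h : DiagSol k T r s) {T' : ℝ} (hT : T' ≤ T) : DiagSol k T' r s where
  left t ht x := (h.left t ⟨ht.1, ht.2.trans_le hT⟩ x).mono (slab_mono hT)
  right t ht x := (h.right t ⟨ht.1, ht.2.trans_le hT⟩ x).mono (slab_mono hT)
  continuous_left := h.continuous_left.mono (slab_mono hT)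
  continuous_right := h.continuous_right.mono (slab_mono hT)

theorem lipschitz_left (h : DiagSol k T r s) (hM : GradientBound T r s M) {t : ℝ}
    (ht : t ∈ Ico 0 T) (x y : ℝ) : |r t x - r t y| ≤ M * |x - y| :=
  convex_univ.norm_image_sub_le_of_norm_hasDerivWithin_le (f' := dx r t) (C := M)
    (fun x _ => (h.hasDerivAt_left ht x).hasDerivWithinAt) (fun x _ => (hM t ht x).1)
    (mem_univ y) (mem_univ x)

theorem lipschitz_right (h : DiagSol k T r s) (hM : GradientBound T r s M) {t : ℝ}
    (ht : t ∈ Ico 0 T) (x y : ℝ) : |s t x - s t y| ≤ M * |x - y| :=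
  convex_univ.norm_image_sub_le_of_norm_hasDerivWithin_le (f' := dx s t) (C := M)
    (fun x _ => (h.hasDerivAt_right ht x).hasDerivWithinAt) (fun x _ => (hM t ht x).2)
    (mem_univ y) (mem_univ x)

theorem lipschitz_speed (h : DiagSol k T r s) (hk : IsSpeed k K) (hM : GradientBound T r s M)
    {t : ℝ} (ht : t ∈ Ico 0 T) (x y : ℝ) :
    |k ((r t x - s t x) / 2) - k ((r t y - s t y) / 2)| ≤ K * M * |x - y| := by
  have h1 := hk.abs_sub_le ((r t x - s t x) / 2) ((r t y - s t y) / 2)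
  have h2 : |(r t x - s t x) / 2 - (r t y - s t y) / 2| ≤ M * |x - y| := by
    have e1 := abs_le.1 (h.lipschitz_left hM ht x y)
    have e2 := abs_le.1 (h.lipschitz_right hM ht x y)
    rw [abs_le]; constructor <;> linarith [e1.1, e1.2, e2.1, e2.2]
  have := mul_le_mul_of_nonneg_left h2 hk.nonneg
  linarith

/-- Existence of characteristics through any point, with velocity `σ k(q)`. -/
theorem exists_characteristic (h : DiagSol k T r s) (hk : IsSpeed k K)
    (hM : GradientBound T r s M) {σ : ℝ} (hσ : |σ| = 1) {t₀ t₁ : ℝ} (ht₁ : t₁ < T)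
    (ht₀ : t₀ ∈ Icc 0 t₁) (x : ℝ) :
    ∃ γ : ℝ → ℝ, γ t₀ = x ∧ ∀ t ∈ Icc 0 t₁,
      HasDerivWithinAt γ (σ * k ((r t (γ t) - s t (γ t)) / 2)) (Icc 0 t₁) t := by
  have ht₁0 : 0 ≤ t₁ := ht₀.1.trans ht₀.2
  have hmem : ∀ t ∈ Icc 0 t₁, t ∈ Ico 0 T := fun t ht => ⟨ht.1, ht.2.trans_lt ht₁⟩
  have hM0 : 0 ≤ M := (abs_nonneg _).trans (hM 0 (hmem 0 ⟨le_rfl, ht₁0⟩) 0).1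
  -- The velocity is below 2 in absolute value, so the ball of radius 2 t₁ cannot be left before t₁;
  -- the gradient bound makes it Lipschitz in x with constant K M.
  have key : IsPicardLindelof (fun t x => σ * k ((r t x - s t x) / 2)) (⟨t₀, ht₀⟩ : Icc 0 t₁) x
      (2 * ⟨t₁, ht₁0⟩) 0 2 ⟨K * M, mul_nonneg hk.nonneg hM0⟩ := by
    refine ⟨fun t ht => ?_, fun y _ => ?_, fun t ht y _ => ?_, ?_⟩
    · refine LipschitzOnWith.of_dist_le_mul fun y _ z _ => ?_
      rw [Real.dist_eq, Real.dist_eq, ← mul_sub, abs_mul, hσ, one_mul]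
      exact h.lipschitz_speed hk hM (hmem t ht) y z
    · refine continuousOn_const.mul ?_
      exact (h.continuousOn_speed hk).comp (f := fun t => (t, y)) (by fun_prop)
        (fun t ht => mem_slab.2 (hmem t ht))
    · rw [Real.norm_eq_abs, abs_mul, hσ, one_mul, abs_of_pos (hk.pos _)]
      have := hk.upper ((r t y - s t y) / 2)
      norm_num; linarith
    · have : max (t₁ - t₀) (t₀ - 0) ≤ t₁ := max_le (by linarith [ht₀.1]) (by linarith [ht₀.2])
      change 2 * max (t₁ - t₀) (t₀ - 0) ≤ 2 * t₁ - 0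
      linarith
  exact key.exists_eq_forall_mem_Icc_hasDerivWithinAt₀

/-- With velocity -k the total derivative is k r_x - k r_x = 0. -/
theorem eq_along_left (h : DiagSol k T r s) {t₁ : ℝ} (ht₁ : t₁ < T) {γ : ℝ → ℝ}
    (hγ : ∀ t ∈ Icc 0 t₁,
      HasDerivWithinAt γ (-1 * k ((r t (γ t) - s t (γ t)) / 2)) (Icc 0 t₁) t)
    {t : ℝ} (ht : t ∈ Icc 0 t₁) : r t (γ t) = r 0 (γ 0) := by
  have hd : ∀ t ∈ Icc 0 t₁, HasDerivWithinAt (fun t => r t (γ t)) 0 (Icc 0 t₁) t := by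
    intro t ht
    have := hasDerivWithinAt_along ht₁ (h.left t ⟨ht.1, ht.2.trans_lt ht₁⟩ (γ t)) (hγ t ht)
    convert this using 1; ring
  refine constant_of_derivWithin_zero (f := fun t => r t (γ t))
    (fun t ht => (hd t ht).differentiableWithinAt) (fun t hτ => ?_) t ht
  have h01 : (0 : ℝ) < t₁ := hτ.1.trans_lt hτ.2
  exact (hd t (Ico_subset_Icc_self hτ)).derivWithin
    (uniqueDiffOn_Icc h01 t (Ico_subset_Icc_self hτ))

/-- Reflection of space exchanges the two components. -/
theorem dx_reflect (f : ℝ → ℝ → ℝ) (t x : ℝ) : dx (fun t x => -f t (-x)) t x = dx f t (-x) := by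
  simp only [dx]
  have : (fun y => -f t (-y)) = -(fun y => f t (-y)) := rfl
  rw [this, deriv.neg, deriv_comp_neg (f t), neg_neg]

/-- The substitution x ↦ -x swaps the directions of propagation, and the two signs leave q unchanged
at the reflected point. Every statement about r thereby yields one about s. -/
theorem reflect (h : DiagSol k T r s) :
    DiagSol k T (fun t x => -s t (-x)) (fun t x => -r t (-x)) := by
  have hm : MapsTo (fun z : ℝ × ℝ => (z.1, -z.2)) (slab T) (slab T) := fun z hz => ⟨hz.1, mem_univ _⟩
  have hq : ∀ t x, (-s t (-x) - -r t (-x)) / 2 = (r t (-x) - s t (-x)) / 2 := fun t x => by ring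
  have hd : ∀ z : ℝ × ℝ, HasFDerivWithinAt (fun z : ℝ × ℝ => (z.1, -z.2))
      ((ContinuousLinearMap.fst ℝ ℝ ℝ).prod (-ContinuousLinearMap.snd ℝ ℝ ℝ)) (slab T) z :=
    fun z => (hasFDerivWithinAt_fst).prodMk (hasFDerivWithinAt_snd.neg)
  refine ⟨fun t ht x => ?_, fun t ht x => ?_, ?_, ?_⟩
  · rw [dx_reflect, hq]
    have h1 := ((h.right t ht (-x)).comp (t, x) (hd (t, x)) hm).neg
    refine HasFDerivWithinAt.congr_fderiv h1 ?_
    ext <;> simp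
  · rw [dx_reflect, hq]
    have h1 := ((h.left t ht (-x)).comp (t, x) (hd (t, x)) hm).neg
    refine HasFDerivWithinAt.congr_fderiv h1 ?_
    ext <;> simp
  · simp only [dx_reflect]
    exact h.continuous_right.comp (f := fun z : ℝ × ℝ => (z.1, -z.2)) (by fun_prop) hm
  · simp only [dx_reflect]
    exact h.continuous_left.comp (f := fun z : ℝ × ℝ => (z.1, -z.2)) (by fun_prop) hm

theorem reflect_gradientBound (hM : GradientBound T r s M) :
    GradientBound T (fun t x => -s t (-x)) (fun t x => -r t (-x)) M := by
  intro t ht x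
  rw [dx_reflect, dx_reflect]
  exact (hM t ht (-x)).symm

/-- Each value of `r` is a value of the initial data, at a point to the right. -/
theorem exists_foot_left (h : DiagSol k T r s) (hk : IsSpeed k K) (hM : GradientBound T r s M)
    {t : ℝ} (ht : t ∈ Ico 0 T) (x : ℝ) :
    ∃ y, x + 99 / 100 * t ≤ y ∧ r t x = r 0 y := by
  obtain ⟨γ, hγt, hγ⟩ := h.exists_characteristic hk hM (σ := -1) (by simp) ht.2
    (right_mem_Icc.2 ht.1) x
  refine ⟨γ 0, ?_, ?_⟩
  -- Since k ≥ 99/100, the characteristic moves left at least at this rate, so its foot lies at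
  -- least 99t/100 to the right of x.
  · have hanti : AntitoneOn (fun τ => γ τ + 99 / 100 * τ) (Icc 0 t) := by
      refine antitoneOn_of_hasDerivWithinAt_nonpos (convex_Icc 0 t) (f' := fun τ =>
        -1 * k ((r τ (γ τ) - s τ (γ τ)) / 2) + 99 / 100 * 1) ?_ ?_ ?_
      · exact fun τ hτ => ((hγ τ hτ).continuousWithinAt).add (by fun_prop)
      · intro τ hτ
        exact ((hγ τ (interior_subset hτ)).mono interior_subset).add
          ((hasDerivWithinAt_id τ _).const_mul _)
      · intro τ _
        linarith [hk.lower ((r τ (γ τ) - s τ (γ τ)) / 2)]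
    have := hanti (left_mem_Icc.2 ht.1) (right_mem_Icc.2 ht.1) ht.1
    simp only [hγt, mul_zero, add_zero] at this
    exact this
  · have := h.eq_along_left ht.2 hγ (right_mem_Icc.2 ht.1)
    rwa [hγt] at this

theorem exists_foot_right (h : DiagSol k T r s) (hk : IsSpeed k K) (hM : GradientBound T r s M)
    {t : ℝ} (ht : t ∈ Ico 0 T) (x : ℝ) :
    ∃ y, y ≤ x - 99 / 100 * t ∧ s t x = s 0 y := by
  obtain ⟨y, hy, e⟩ := h.reflect.exists_foot_left hk (reflect_gradientBound hM) ht (-x)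
  refine ⟨-y, by linarith, ?_⟩
  simpa using e

theorem abs_le_left (h : DiagSol k T r s) (hk : IsSpeed k K) (hM : GradientBound T r s M) {N : ℝ}
    (hN : ∀ x, |r 0 x| ≤ N) {t : ℝ} (ht : t ∈ Ico 0 T) (x : ℝ) : |r t x| ≤ N := by
  obtain ⟨y, -, e⟩ := h.exists_foot_left hk hM ht x
  rw [e]; exact hN y

theorem abs_le_right (h : DiagSol k T r s) (hk : IsSpeed k K) (hM : GradientBound T r s M) {N : ℝ}
    (hN : ∀ x, |s 0 x| ≤ N) {t : ℝ} (ht : t ∈ Ico 0 T) (x : ℝ) : |s t x| ≤ N := by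
  obtain ⟨y, -, e⟩ := h.exists_foot_right hk hM ht x
  rw [e]; exact hN y

/-! ### Uniqueness -/

/-- One Picard step, taken along a characteristic of the first solution: there r is constant, while
r' changes at a rate (k(q') - k(q)) r'_x, of size at most K |q - q'| M. Integrating the bound with
index n in time gives the one with index n + 1. -/
theorem sub_left_le_of_le {r' s' : ℝ → ℝ → ℝ} (h : DiagSol k T r s) (h' : DiagSol k T r' s')
    (hk : IsSpeed k K) (hM : GradientBound T r s M) (hM' : GradientBound T r' s' M)
    (hr : ∀ x, r 0 x = r' 0 x) {N : ℝ} {n : ℕ}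
    (hn : ∀ t ∈ Ico 0 T, ∀ x, |r t x - r' t x| ≤ N * (K * M * t) ^ n / n.factorial ∧
      |s t x - s' t x| ≤ N * (K * M * t) ^ n / n.factorial) {t : ℝ} (ht : t ∈ Ico 0 T) (x : ℝ) :
    |r t x - r' t x| ≤ N * (K * M * t) ^ (n + 1) / (n + 1).factorial := by
  obtain ⟨γ, hγt, hγ⟩ := h.exists_characteristic hk hM (σ := -1) (by simp) ht.2
    (right_mem_Icc.2 ht.1) x
  have hmem : ∀ τ ∈ Icc 0 t, τ ∈ Ico 0 T := fun τ hτ => ⟨hτ.1, hτ.2.trans_lt ht.2⟩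
  have hd : ∀ τ ∈ Icc 0 t, HasDerivWithinAt (fun τ => r τ (γ τ) - r' τ (γ τ))
      ((k ((r τ (γ τ) - s τ (γ τ)) / 2) - k ((r' τ (γ τ) - s' τ (γ τ)) / 2)) * dx r' τ (γ τ))
      (Icc 0 t) τ := by
    intro τ hτ
    have e1 := hasDerivWithinAt_along ht.2 (h.left τ (hmem τ hτ) (γ τ)) (hγ τ hτ)
    have e2 := hasDerivWithinAt_along ht.2 (h'.left τ (hmem τ hτ) (γ τ)) (hγ τ hτ)
    exact (e1.sub e2).congr_deriv (by ring)
  have hB : ∀ τ : ℝ, HasDerivAt (fun τ => N * (K * M * τ) ^ (n + 1) / (n + 1).factorial)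
      (K * M * (N * (K * M * τ) ^ n / n.factorial)) τ := by
    intro τ
    have e := ((((hasDerivAt_id τ).const_mul (K * M)).pow (n + 1)).const_mul N).div_const
      ((n + 1).factorial : ℝ)
    refine e.congr_deriv ?_
    have : ((n + 1).factorial : ℝ) = (n + 1) * n.factorial := by
      push_cast [Nat.factorial_succ]; ring
    rw [this]
    have h1 : (n.factorial : ℝ) ≠ 0 := by positivity
    have h2 : (n + 1 : ℝ) ≠ 0 := by positivity
    simp only [id, Nat.add_sub_cancel]
    field_simp
    push_cast; ring
  have key := image_norm_le_of_norm_deriv_right_le_deriv_boundary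
    (f := fun τ => r τ (γ τ) - r' τ (γ τ)) (a := 0) (b := t)
    (f' := fun τ => (k ((r τ (γ τ) - s τ (γ τ)) / 2) - k ((r' τ (γ τ) - s' τ (γ τ)) / 2)) *
      dx r' τ (γ τ))
    (fun τ hτ => (hd τ hτ).continuousWithinAt)
    (fun τ hτ => (hd τ (Ico_subset_Icc_self hτ)).mono_of_mem_nhdsWithin
      (Icc_mem_nhdsGE_of_mem hτ))
    (B := fun τ => N * (K * M * τ) ^ (n + 1) / (n + 1).factorial)
    (B' := fun τ => K * M * (N * (K * M * τ) ^ n / n.factorial))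
    (by simp [hr]) hB (fun τ hτ => ?_) (right_mem_Icc.2 ht.1)
  · simpa [hγt] using key
  · have hτ' := hmem τ (Ico_subset_Icc_self hτ)
    rw [Real.norm_eq_abs, abs_mul]
    have e1 := hk.abs_sub_le ((r τ (γ τ) - s τ (γ τ)) / 2) ((r' τ (γ τ) - s' τ (γ τ)) / 2)
    have e2 := (hM' τ hτ' (γ τ)).1
    have e3 := hn τ hτ' (γ τ)
    have e4 : |(r τ (γ τ) - s τ (γ τ)) / 2 - (r' τ (γ τ) - s' τ (γ τ)) / 2| ≤
        N * (K * M * τ) ^ n / n.factorial := by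
      have a1 := abs_le.1 e3.1
      have a2 := abs_le.1 e3.2
      rw [abs_le]; constructor <;> linarith [a1.1, a1.2, a2.1, a2.2]
    have hM0 : 0 ≤ M := (abs_nonneg _).trans e2
    calc _ ≤ (K * (N * (K * M * τ) ^ n / n.factorial)) * M :=
          mul_le_mul (e1.trans (mul_le_mul_of_nonneg_left e4 hk.nonneg)) e2 (abs_nonneg _)
            (mul_nonneg hk.nonneg ((abs_nonneg _).trans e4))
      _ = _ := by ring

/-- The maximum principle gives the crude bound 2N for the differences. Iterating the Picard step
improves it to 2N (KMt)^n / n! for every n, which tends to 0; the s-component is treated by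
reflection. -/
theorem unique {r' s' : ℝ → ℝ → ℝ} (h : DiagSol k T r s) (h' : DiagSol k T r' s')
    (hk : IsSpeed k K) (hM : GradientBound T r s M) (hM' : GradientBound T r' s' M)
    (hr : ∀ x, r 0 x = r' 0 x) (hs : ∀ x, s 0 x = s' 0 x)
    {N : ℝ} (hrN : ∀ x, |r 0 x| ≤ N) (hsN : ∀ x, |s 0 x| ≤ N)
    {t : ℝ} (ht : t ∈ Ico 0 T) (x : ℝ) : r t x = r' t x ∧ s t x = s' t x := by
  have key : ∀ n : ℕ, ∀ t ∈ Ico 0 T, ∀ x,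
      |r t x - r' t x| ≤ (2 * N) * (K * M * t) ^ n / n.factorial ∧
      |s t x - s' t x| ≤ (2 * N) * (K * M * t) ^ n / n.factorial := by
    intro n
    induction n with
    | zero =>
      intro t ht x
      have a1 := abs_le.1 (h.abs_le_left hk hM hrN ht x)
      have a2 := abs_le.1 (h'.abs_le_left hk hM' (fun x => hr x ▸ hrN x) ht x)
      have a3 := abs_le.1 (h.abs_le_right hk hM hsN ht x)
      have a4 := abs_le.1 (h'.abs_le_right hk hM' (fun x => hs x ▸ hsN x) ht x)
      simp only [pow_zero, mul_one, Nat.factorial_zero, Nat.cast_one, div_one]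
      constructor <;> rw [abs_le] <;> constructor <;> linarith [a1.1, a1.2, a2.1, a2.2, a3.1, a3.2, a4.1, a4.2]
    | succ n ih =>
      intro t ht x
      refine ⟨sub_left_le_of_le h h' hk hM hM' hr ih ht x, ?_⟩
      have := sub_left_le_of_le h.reflect h'.reflect hk (reflect_gradientBound hM)
        (reflect_gradientBound hM') (fun x => by rw [hs]) (N := 2 * N) (n := n)
        (fun t ht x => ?_) ht (-x)
      · rw [neg_neg, neg_sub_neg, abs_sub_comm] at this
        exact this
      · have := ih t ht (-x)
        rw [neg_sub_neg, neg_sub_neg, abs_sub_comm, abs_sub_comm (r' t (-x))]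
        exact this.symm
  have hlim : Tendsto (fun n : ℕ => (2 * N) * (K * M * t) ^ n / n.factorial) atTop (𝓝 0) := by
    have := (FloorSemiring.tendsto_pow_div_factorial_atTop (K * M * t)).const_mul (2 * N)
    simpa [mul_div_assoc] using this
  have h1 : |r t x - r' t x| ≤ 0 := ge_of_tendsto' hlim fun n => (key n t ht x).1
  have h2 : |s t x - s' t x| ≤ 0 := ge_of_tendsto' hlim fun n => (key n t ht x).2
  exact ⟨sub_eq_zero.1 (abs_nonpos_iff.1 h1), sub_eq_zero.1 (abs_nonpos_iff.1 h2)⟩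

end DiagSol

end QuasilinearWave

namespace QuasilinearWave

/-! ### The gradient along characteristics -/

namespace DiagSol

variable {k : ℝ → ℝ} {K T M : ℝ} {r s : ℝ → ℝ → ℝ}

/-- As r is only C¹, its equation cannot be differentiated in x. Instead the difference quotient of
r between γ and γ + η is differentiated in time, the result is integrated, and η tends to 0 by
dominated convergence with the bound (K M) M. -/
theorem gradient_along (h : DiagSol k T r s) (hk : IsSpeed k K) (hM : GradientBound T r s M)
    {t₁ : ℝ} (ht₁ : t₁ < T) {γ : ℝ → ℝ}
    (hγ : ∀ t ∈ Icc 0 t₁,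
      HasDerivWithinAt γ (-1 * k ((r t (γ t) - s t (γ t)) / 2)) (Icc 0 t₁) t)
    {t : ℝ} (ht : t ∈ Icc 0 t₁) :
    dx r t (γ t) - dx r 0 (γ 0) = ∫ τ in (0 : ℝ)..t,
      deriv k ((r τ (γ τ) - s τ (γ τ)) / 2) * ((dx r τ (γ τ) - dx s τ (γ τ)) / 2) *
        dx r τ (γ τ) := by
  have hmem : ∀ τ ∈ Icc 0 t₁, τ ∈ Ico 0 T := fun τ hτ => ⟨hτ.1, hτ.2.trans_lt ht₁⟩
  have hsub : Icc 0 t ⊆ Icc 0 t₁ := Icc_subset_Icc_right ht.2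
  have hγc : ContinuousOn γ (Icc 0 t) :=
    fun τ hτ => (hγ τ (hsub hτ)).continuousWithinAt.mono hsub
  -- The time derivative of the quotient `D`: the translated curve moves with the speed at γ instead
  -- of its own, and only this mismatch of speeds contributes.
  set f : ℝ → ℝ → ℝ := fun η τ =>
    (k ((r τ (γ τ + η) - s τ (γ τ + η)) / 2) - k ((r τ (γ τ) - s τ (γ τ)) / 2)) / η *
      dx r τ (γ τ + η) with hf
  set D : ℝ → ℝ → ℝ := fun η τ => (r τ (γ τ + η) - r τ (γ τ)) / η with hD
  have hd : ∀ η ≠ 0, ∀ τ ∈ Icc 0 t₁, HasDerivWithinAt (D η) (f η τ) (Icc 0 t₁) τ := by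
    intro η _ τ hτ
    have e1 := hasDerivWithinAt_along ht₁ (γ := fun τ => γ τ + η)
      (h.left τ (hmem τ hτ) (γ τ + η)) ((hγ τ hτ).add_const η)
    have e2 := hasDerivWithinAt_along ht₁ (h.left τ (hmem τ hτ) (γ τ)) (hγ τ hτ)
    exact ((e1.sub e2).div_const η).congr_deriv (by simp only [hf]; ring)
  have hfc : ∀ η, ContinuousOn (f η) (Icc 0 t) := by
    intro η
    have hm0 : MapsTo (fun τ => (τ, γ τ)) (Icc 0 t) (slab T) :=
      fun τ hτ => mem_slab.2 (hmem τ (hsub hτ))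
    have hm : MapsTo (fun τ => (τ, γ τ + η)) (Icc 0 t) (slab T) :=
      fun τ hτ => mem_slab.2 (hmem τ (hsub hτ))
    have c1 := (h.continuousOn_speed hk).comp (continuousOn_id.prodMk hγc) hm0
    have c2 := (h.continuousOn_speed hk).comp
      (continuousOn_id.prodMk (hγc.add continuousOn_const)) hm
    have c3 := h.continuous_left.comp (continuousOn_id.prodMk (hγc.add continuousOn_const)) hm
    exact ((c2.sub c1).div_const η).mul c3
  have hFTC : ∀ η ≠ 0, ∫ τ in (0 : ℝ)..t, f η τ = D η t - D η 0 := by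
    intro η hη
    refine intervalIntegral.integral_eq_sub_of_hasDerivAt_of_le ht.1
      (fun τ hτ => ((hd η hη τ (hsub hτ)).mono hsub).continuousWithinAt)
      (fun τ hτ => ?_) ((hfc η).intervalIntegrable_of_Icc ht.1)
    exact (hd η hη τ (hsub (Ioo_subset_Icc_self hτ))).hasDerivAt
      (Icc_mem_nhds hτ.1 (hτ.2.trans_le ht.2))
  have hDlim : ∀ τ ∈ Icc 0 t₁, Tendsto (fun η => D η τ) (𝓝[≠] 0) (𝓝 (dx r τ (γ τ))) := by
    intro τ hτ
    have := (hasDerivAt_iff_tendsto_slope_zero).1 (h.hasDerivAt_left (hmem τ hτ) (γ τ))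
    refine this.congr fun η => ?_
    simp only [hD, smul_eq_mul]; ring
  have hM0 : 0 ≤ M := (abs_nonneg _).trans (hM t (hmem t ht) 0).1
  have hint : Tendsto (fun η => ∫ τ in (0 : ℝ)..t, f η τ) (𝓝[≠] 0)
      (𝓝 (∫ τ in (0 : ℝ)..t, deriv k ((r τ (γ τ) - s τ (γ τ)) / 2) *
        ((dx r τ (γ τ) - dx s τ (γ τ)) / 2) * dx r τ (γ τ))) := by
    have hIoc : Set.uIoc 0 t = Ioc 0 t := uIoc_of_le ht.1
    refine intervalIntegral.tendsto_integral_filter_of_dominated_convergence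
      (fun _ => K * M * M) ?_ ?_ intervalIntegrable_const ?_
    · refine Eventually.of_forall fun η => ?_
      rw [hIoc]
      exact ((hfc η).mono Ioc_subset_Icc_self).aestronglyMeasurable measurableSet_Ioc
    · filter_upwards [self_mem_nhdsWithin] with η hη
      refine Eventually.of_forall fun τ hτ => ?_
      rw [hIoc] at hτ
      have hτ' := hmem τ (hsub (Ioc_subset_Icc_self hτ))
      have e1 := h.lipschitz_speed hk hM hτ' (γ τ + η) (γ τ)
      have hη' : 0 < |η| := abs_pos.2 hη
      rw [Real.norm_eq_abs, abs_mul, abs_div]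
      refine mul_le_mul ?_ (hM τ hτ' _).1 (abs_nonneg _) (mul_nonneg hk.nonneg hM0)
      rw [div_le_iff₀ hη']
      simpa using e1
    · refine Eventually.of_forall fun τ hτ => ?_
      rw [hIoc] at hτ
      have hτ' := hmem τ (hsub (Ioc_subset_Icc_self hτ))
      have e1 : HasDerivAt (fun x => k ((r τ x - s τ x) / 2))
          (deriv k ((r τ (γ τ) - s τ (γ τ)) / 2) * ((dx r τ (γ τ) - dx s τ (γ τ)) / 2)) (γ τ) :=
        (hk.hasDerivAt _).comp (γ τ)
          (((h.hasDerivAt_left hτ' (γ τ)).sub (h.hasDerivAt_right hτ' (γ τ))).div_const 2)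
      have e2 := (hasDerivAt_iff_tendsto_slope_zero).1 e1
      have e3 : Tendsto (fun η => dx r τ (γ τ + η)) (𝓝[≠] 0) (𝓝 (dx r τ (γ τ))) := by
        have c : Continuous fun x => dx r τ x := by
          rw [← continuousOn_univ]
          exact h.continuous_left.comp (f := fun x => (τ, x)) (by fun_prop)
            (fun x _ => mem_slab.2 hτ')
        have : Tendsto (fun η => dx r τ (γ τ + η)) (𝓝 0) (𝓝 (dx r τ (γ τ + 0))) :=
          (c.comp (continuous_const.add continuous_id)).tendsto 0
        rw [add_zero] at this
        exact this.mono_left nhdsWithin_le_nhds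
      refine (e2.mul e3).congr fun η => ?_
      simp only [hf, smul_eq_mul]; ring
  refine tendsto_nhds_unique ((hDlim t ht).sub (hDlim 0 ⟨le_rfl, ht.1.trans ht.2⟩)) ?_
  refine hint.congr' ?_
  filter_upwards [self_mem_nhdsWithin] with η hη
  exact hFTC η hη

/-- The integrand in the integral identity is continuous along γ. Extending it by constants beyond
[0, t₁] makes the fundamental theorem of calculus available up to both endpoints. -/
theorem hasDerivWithinAt_gradient (h : DiagSol k T r s) (hk : IsSpeed k K)
    (hM : GradientBound T r s M) {t₁ : ℝ} (ht₁ : t₁ < T) {γ : ℝ → ℝ}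
    (hγ : ∀ t ∈ Icc 0 t₁,
      HasDerivWithinAt γ (-1 * k ((r t (γ t) - s t (γ t)) / 2)) (Icc 0 t₁) t)
    {t : ℝ} (ht : t ∈ Icc 0 t₁) :
    HasDerivWithinAt (fun t => dx r t (γ t))
      (deriv k ((r t (γ t) - s t (γ t)) / 2) * ((dx r t (γ t) - dx s t (γ t)) / 2) *
        dx r t (γ t)) (Icc 0 t₁) t := by
  have h01 : 0 ≤ t₁ := ht.1.trans ht.2
  set g : ℝ → ℝ := fun τ => deriv k ((r τ (γ τ) - s τ (γ τ)) / 2) *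
    ((dx r τ (γ τ) - dx s τ (γ τ)) / 2) * dx r τ (γ τ) with hg
  have hγc : ContinuousOn γ (Icc 0 t₁) := fun τ hτ => (hγ τ hτ).continuousWithinAt
  have hm : MapsTo (fun τ => (τ, γ τ)) (Icc 0 t₁) (slab T) :=
    fun τ hτ => mem_slab.2 ⟨hτ.1, hτ.2.trans_lt ht₁⟩
  have hgc : ContinuousOn g (Icc 0 t₁) := by
    have hp := continuousOn_id.prodMk hγc
    have c1 := h.continuousOn_r.comp hp hm
    have c2 := h.continuousOn_s.comp hp hm
    have c3 := h.continuous_left.comp hp hm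
    have c4 := h.continuous_right.comp hp hm
    exact ((hk.continuous_deriv.comp_continuousOn ((c1.sub c2).div_const 2)).mul
      ((c3.sub c4).div_const 2)).mul c3
  have hext : Continuous (IccExtend h01 ((Icc 0 t₁).domRestrict g)) :=
    (continuousOn_iff_continuous_domRestrict.1 hgc).Icc_extend'
  have hval : ∀ τ ∈ Icc 0 t₁, IccExtend h01 ((Icc 0 t₁).domRestrict g) τ = g τ :=
    fun τ hτ => IccExtend_of_mem h01 _ hτ
  have e1 : HasDerivWithinAt (fun t => dx r 0 (γ 0) +
      ∫ τ in (0 : ℝ)..t, IccExtend h01 ((Icc 0 t₁).domRestrict g) τ) (g t) (Icc 0 t₁) t := by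
    have := ((hext.integral_hasStrictDerivAt 0 t).hasDerivAt.const_add
      (dx r 0 (γ 0))).hasDerivWithinAt (s := Icc 0 t₁)
    rwa [hval t ht] at this
  have e2 : ∀ τ ∈ Icc 0 t₁, dx r τ (γ τ) = dx r 0 (γ 0) +
      ∫ τ in (0 : ℝ)..τ, IccExtend h01 ((Icc 0 t₁).domRestrict g) τ := by
    intro τ hτ
    have := h.gradient_along hk hM ht₁ hγ hτ
    rw [← sub_eq_iff_eq_add', this]
    refine intervalIntegral.integral_congr fun σ hσ => ?_
    rw [uIcc_of_le hτ.1] at hσ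
    exact (hval σ ⟨hσ.1, hσ.2.trans hτ.2⟩).symm
  exact e1.congr e2 (e2 t ht)

/-- The Riccati equation for the weighted gradient `√k r_x` along a characteristic. -/
theorem hasDerivWithinAt_weighted (h : DiagSol k T r s) (hk : IsSpeed k K)
    (hM : GradientBound T r s M) {t₁ : ℝ} (ht₁ : t₁ < T) {γ : ℝ → ℝ}
    (hγ : ∀ t ∈ Icc 0 t₁,
      HasDerivWithinAt γ (-1 * k ((r t (γ t) - s t (γ t)) / 2)) (Icc 0 t₁) t)
    {t : ℝ} (ht : t ∈ Icc 0 t₁) :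
    HasDerivWithinAt (fun t => √(k ((r t (γ t) - s t (γ t)) / 2)) * dx r t (γ t))
      (deriv k ((r t (γ t) - s t (γ t)) / 2) / (2 * √(k ((r t (γ t) - s t (γ t)) / 2))) *
        (√(k ((r t (γ t) - s t (γ t)) / 2)) * dx r t (γ t)) ^ 2) (Icc 0 t₁) t := by
  have ht' : t ∈ Ico 0 T := ⟨ht.1, ht.2.trans_lt ht₁⟩
  have e1 := h.hasDerivWithinAt_gradient hk hM ht₁ hγ ht
  have e2 := hasDerivWithinAt_along ht₁ (h.left t ht' (γ t)) (hγ t ht)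
  have e3 := hasDerivWithinAt_along ht₁ (h.right t ht' (γ t)) (hγ t ht)
  have e4 : HasDerivWithinAt (fun t => k ((r t (γ t) - s t (γ t)) / 2)) _ (Icc 0 t₁) t :=
    (hk.hasDerivAt _).comp_hasDerivWithinAt t ((e2.sub e3).div_const 2)
  have hpos := hk.pos ((r t (γ t) - s t (γ t)) / 2)
  have e5 := e4.sqrt hpos.ne'
  -- Along γ the quantity q changes at the rate k s_x. Differentiating the factor √k therefore gives
  -- k' √k s_x r_x / 2, which cancels the s_x term in the derivative of r_x.
  refine (e5.mul e1).congr_deriv ?_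
  have hs : √(k ((r t (γ t) - s t (γ t)) / 2)) ^ 2 = k ((r t (γ t) - s t (γ t)) / 2) :=
    Real.sq_sqrt hpos.le
  have hsp : 0 < √(k ((r t (γ t) - s t (γ t)) / 2)) := Real.sqrt_pos.2 hpos
  rw [← hs]
  simp only [hs]
  generalize √(k ((r t (γ t) - s t (γ t)) / 2)) = σ at *
  rw [← hs]
  field_simp
  ring

/-- Upper bound for the time of existence when `k'` is bounded below along a characteristic of
expansion rate `r_x > 0`. -/
theorem time_le (h : DiagSol k T r s) (hk : IsSpeed k K) (hM : GradientBound T r s M)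
    (hk0 : ∀ t ∈ Ico 0 T, ∀ x, 0 ≤ deriv k ((r t x - s t x) / 2)) {x₁ a₀ t₀ : ℝ}
    (hx₁ : 0 < dx r 0 x₁) (ha₀ : 0 < a₀) (ht₀ : 0 ≤ t₀)
    (hk1 : ∀ t ∈ Ico t₀ T, ∀ x ≤ x₁ - 99 / 100 * t, r t x = r 0 x₁ →
      a₀ ≤ deriv k ((r t x - s t x) / 2)) :
    T ≤ t₀ + 4 / (a₀ * dx r 0 x₁) := by
  -- If T exceeded t₁, the characteristic from x₁ would exist up to t₁, and 1/y would be pushed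
  -- below zero there although y stays positive.
  by_contra! hT
  set t₁ := t₀ + 4 / (a₀ * dx r 0 x₁) with ht₁
  have h01 : t₀ ≤ t₁ := by rw [ht₁]; have : 0 < 4 / (a₀ * dx r 0 x₁) := by positivity
                           linarith
  have h1 : 0 ≤ t₁ := ht₀.trans h01
  obtain ⟨γ, hγ0, hγ⟩ := h.exists_characteristic hk hM (σ := -1) (by simp) hT
    (left_mem_Icc.2 h1) x₁
  have hmem : ∀ τ ∈ Icc 0 t₁, τ ∈ Ico 0 T := fun τ hτ => ⟨hτ.1, hτ.2.trans_lt hT⟩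
  set y : ℝ → ℝ := fun t => √(k ((r t (γ t) - s t (γ t)) / 2)) * dx r t (γ t) with hy
  set m : ℝ → ℝ := fun t =>
    deriv k ((r t (γ t) - s t (γ t)) / 2) / (2 * √(k ((r t (γ t) - s t (γ t)) / 2))) with hm
  have hyd : ∀ t ∈ Icc 0 t₁, HasDerivWithinAt y (m t * y t ^ 2) (Icc 0 t₁) t :=
    fun t ht => h.hasDerivWithinAt_weighted hk hM hT hγ ht
  have hm0 : ∀ t ∈ Icc 0 t₁, 0 ≤ m t := fun t ht =>
    div_nonneg (hk0 t (hmem t ht) _) (by positivity)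
  have hmono : MonotoneOn y (Icc 0 t₁) :=
    monotoneOn_of_hasDerivWithinAt_nonneg (convex_Icc 0 t₁) (f' := fun t => m t * y t ^ 2)
      (fun t ht => (hyd t ht).continuousWithinAt)
      (fun t ht => (hyd t (interior_subset ht)).mono interior_subset)
      (fun t ht => mul_nonneg (hm0 t (interior_subset ht)) (sq_nonneg _))
  have hsq : ∀ q, 99 / 100 ≤ √(k q) ∧ √(k q) ≤ 101 / 100 := fun q =>
    ⟨Real.le_sqrt_of_sq_le (by linarith [hk.lower q]),
      Real.sqrt_le_iff.2 ⟨by norm_num, by linarith [hk.upper q]⟩⟩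
  have hy0 : 99 / 100 * dx r 0 x₁ ≤ y 0 := by
    simp only [hy, hγ0]
    exact mul_le_mul_of_nonneg_right (hsq _).1 hx₁.le
  have hypos : ∀ t ∈ Icc 0 t₁, 0 < y t := fun t ht =>
    lt_of_lt_of_le (by positivity) (hy0.trans (hmono (left_mem_Icc.2 h1) ht ht.1))
  -- The Riccati equation y' = m y² becomes (1/y)' = -m, so 1/y + a₀t/3 decreases wherever m ≥ a₀/3.
  have hzd : ∀ t ∈ Icc 0 t₁, HasDerivWithinAt (fun t => (y t)⁻¹ + a₀ / 3 * t)
      (-m t + a₀ / 3) (Icc 0 t₁) t := by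
    intro t ht
    have hne := (hypos t ht).ne'
    refine (((hyd t ht).inv hne).add ((hasDerivWithinAt_id t _).const_mul (a₀ / 3))).congr_deriv ?_
    field_simp
  have hγle : ∀ t ∈ Icc 0 t₁, γ t ≤ x₁ - 99 / 100 * t := by
    intro t ht
    have hanti : AntitoneOn (fun τ => γ τ + 99 / 100 * τ) (Icc 0 t₁) := by
      refine antitoneOn_of_hasDerivWithinAt_nonpos (convex_Icc 0 t₁) (f' := fun τ =>
        -1 * k ((r τ (γ τ) - s τ (γ τ)) / 2) + 99 / 100 * 1) ?_ ?_ ?_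
      · exact fun τ hτ => ((hγ τ hτ).continuousWithinAt).add (by fun_prop)
      · intro τ hτ
        exact ((hγ τ (interior_subset hτ)).mono interior_subset).add
          ((hasDerivWithinAt_id τ _).const_mul _)
      · intro τ _
        linarith [hk.lower ((r τ (γ τ) - s τ (γ τ)) / 2)]
    have := hanti (left_mem_Icc.2 h1) ht ht.1
    simp only [hγ0, mul_zero, add_zero] at this
    linarith
  -- The constant 3 absorbs 2√k ≤ 202/100.
  have hmlow : ∀ t ∈ Icc t₀ t₁, a₀ / 3 ≤ m t := by
    intro t ht
    have ht' : t ∈ Icc 0 t₁ := ⟨ht₀.trans ht.1, ht.2⟩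
    have e1 := hk1 t ⟨ht.1, (hmem t ht').2⟩ (γ t) (hγle t ht')
      (by rw [h.eq_along_left hT hγ ht', hγ0])
    have e2 := (hsq ((r t (γ t) - s t (γ t)) / 2))
    have e3 : 0 < 2 * √(k ((r t (γ t) - s t (γ t)) / 2)) := by linarith [e2.1]
    simp only [hm]
    rw [le_div_iff₀ e3]
    nlinarith [e2.2]
  have hanti : AntitoneOn (fun t => (y t)⁻¹ + a₀ / 3 * t) (Icc t₀ t₁) := by
    have hsub : Icc t₀ t₁ ⊆ Icc 0 t₁ := Icc_subset_Icc_left ht₀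
    exact antitoneOn_of_hasDerivWithinAt_nonpos (convex_Icc t₀ t₁) (f' := fun t => -m t + a₀ / 3)
      (fun t ht => ((hzd t (hsub ht)).mono hsub).continuousWithinAt)
      (fun t ht => (hzd t (hsub (interior_subset ht))).mono (interior_subset.trans hsub))
      (fun t ht => by linarith [hmlow t (interior_subset ht)])
  -- Over [t₀, t₁] the linear term gains (4/3)/r_x, whereas 1/y is at most (100/99)/r_x at t₀.
  have e1 := hanti (left_mem_Icc.2 h01) (right_mem_Icc.2 h01) h01
  have e2 : 0 < (y t₁)⁻¹ := inv_pos.2 (hypos t₁ (right_mem_Icc.2 h1))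
  have e3 : (y t₀)⁻¹ ≤ (99 / 100 * dx r 0 x₁)⁻¹ :=
    inv_anti₀ (by positivity) (hy0.trans (hmono (left_mem_Icc.2 h1) ⟨ht₀, h01⟩ ht₀))
  have e4 : a₀ / 3 * t₁ - a₀ / 3 * t₀ = 4 / 3 * (dx r 0 x₁)⁻¹ := by
    rw [ht₁]; field_simp; ring
  have e5 : (99 / 100 * dx r 0 x₁)⁻¹ = 100 / 99 * (dx r 0 x₁)⁻¹ := by
    rw [mul_inv]; norm_num
  have e6 : 0 < (dx r 0 x₁)⁻¹ := inv_pos.2 hx₁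
  simp only at e1
  linarith

end DiagSol

end QuasilinearWave

namespace QuasilinearWave

/-! ### Characteristic coordinates -/

section Goursat

/-- Truncation of a real number to `[-h, h]`. -/
noncomputable def clip (h x : ℝ) : ℝ := max (-h) (min x h)

theorem continuous_clip (h : ℝ) : Continuous (clip h) := by
  unfold clip; fun_prop

theorem abs_clip_le {h : ℝ} (hh : 0 ≤ h) (x : ℝ) : |clip h x| ≤ h :=
  abs_le.2 ⟨le_max_left _ _, max_le (by linarith) (min_le_right _ _)⟩

theorem clip_of_abs_le {h x : ℝ} (hx : |x| ≤ h) : clip h x = x := by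
  rw [clip, min_eq_left (abs_le.1 hx).2, max_eq_right (abs_le.1 hx).1]

/-- Integral of `N` over the segment from `(z₁, z₁)` to `(z₁, z₂)`, truncated at length `h`. -/
noncomputable def segInt (h : ℝ) (N : ℝ × ℝ → ℝ) (z : ℝ × ℝ) : ℝ :=
  ∫ b in (0 : ℝ)..clip h (z.2 - z.1), N (z.1, z.1 + b)

theorem continuous_segInt (h : ℝ) {N : ℝ × ℝ → ℝ} (hN : Continuous N) :
    Continuous (segInt h N) := by
  unfold segInt
  refine intervalIntegral.continuous_parametric_intervalIntegral_of_continuous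
    (f := fun (z : ℝ × ℝ) b => N (z.1, z.1 + b)) ?_ ?_
  · exact hN.comp (by fun_prop)
  · exact (continuous_clip h).comp (by fun_prop)

theorem abs_segInt_le {h : ℝ} (hh : 0 ≤ h) {N : ℝ × ℝ → ℝ} {B : ℝ} (hB : ∀ z, |N z| ≤ B)
    (z : ℝ × ℝ) : |segInt h N z| ≤ h * B := by
  have h1 := intervalIntegral.norm_integral_le_of_norm_le_const (a := 0)
    (b := clip h (z.2 - z.1)) (f := fun b => N (z.1, z.1 + b)) (C := B) (fun b _ => hB _)
  have hB0 : 0 ≤ B := (abs_nonneg _).trans (hB 0)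
  rw [sub_zero] at h1
  refine h1.trans ?_
  rw [mul_comm]
  exact mul_le_mul_of_nonneg_right (abs_clip_le hh _) hB0

theorem segInt_sub (h : ℝ) {N N' : ℝ × ℝ → ℝ} (hN : Continuous N) (hN' : Continuous N')
    (z : ℝ × ℝ) : segInt h N z - segInt h N' z = segInt h (fun w => N w - N' w) z := by
  unfold segInt
  rw [intervalIntegral.integral_sub]
  · exact (hN.comp (by fun_prop : Continuous fun b => (z.1, z.1 + b))).intervalIntegrable _ _
  · exact (hN'.comp (by fun_prop : Continuous fun b => (z.1, z.1 + b))).intervalIntegrable _ _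

/-- In the strip |z₂ - z₁| < h the truncation is inactive, so this is the fundamental theorem of
calculus. -/
theorem hasDerivAt_segInt {h : ℝ} {N : ℝ × ℝ → ℝ} (hN : Continuous N) {z : ℝ × ℝ}
    (hz : |z.2 - z.1| < h) : HasDerivAt (fun b => segInt h N (z.1, b)) (N z) z.2 := by
  have hc : Continuous fun b => N (z.1, z.1 + b) := hN.comp (by fun_prop)
  have e1 : HasDerivAt (fun y => ∫ b in (0 : ℝ)..y, N (z.1, z.1 + b))
      (N (z.1, z.1 + (z.2 - z.1))) (z.2 - z.1) :=
    (hc.integral_hasStrictDerivAt 0 _).hasDerivAt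
  have e2 := e1.comp z.2 ((hasDerivAt_id z.2).sub_const z.1)
  rw [add_sub_cancel, mul_one] at e2
  refine e2.congr_of_eventuallyEq ?_
  have : ∀ᶠ b in 𝓝 z.2, |b - z.1| < h :=
    (by fun_prop : Continuous fun b => |b - z.1|).continuousAt.eventually_lt_const hz
  filter_upwards [this] with b hb
  simp only [segInt, clip_of_abs_le hb.le, Function.comp, id]

theorem segInt_diag {h : ℝ} (hh : 0 ≤ h) (N : ℝ × ℝ → ℝ) (a : ℝ) : segInt h N (a, a) = 0 := by
  simp [segInt, clip_of_abs_le (show |(0 : ℝ)| ≤ h by simpa using hh)]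

variable {C Cα Cβ : ℝ × ℝ → ℝ} {B h : ℝ}

/-- First derivative of the time coordinate in terms of its mixed derivative `N`. -/
noncomputable def timeLeft (C : ℝ × ℝ → ℝ) (h : ℝ) (N : ℝ × ℝ → ℝ) (z : ℝ × ℝ) : ℝ :=
  1 / (2 * C (z.1, z.1)) + segInt h N z

/-- Second derivative of the time coordinate in terms of its mixed derivative `N`. -/
noncomputable def timeRight (C : ℝ × ℝ → ℝ) (h : ℝ) (N : ℝ × ℝ → ℝ) (z : ℝ × ℝ) : ℝ :=
  -(1 / (2 * C (z.2, z.2))) + segInt h (N ∘ Prod.swap) z.swap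

theorem pos_of_near_one (hC : ∀ z, |C z - 1| ≤ 1 / 100) (z : ℝ × ℝ) : 0 < C z := by
  have := abs_le.1 (hC z); linarith

theorem continuous_timeLeft (hCc : Continuous C) (hC : ∀ z, |C z - 1| ≤ 1 / 100)
    {N : ℝ × ℝ → ℝ} (hN : Continuous N) : Continuous (timeLeft C h N) := by
  unfold timeLeft
  refine (continuous_const.div ?_ fun z => ?_).add (continuous_segInt h hN)
  · exact continuous_const.mul (hCc.comp (by fun_prop))
  · have := pos_of_near_one hC (z.1, z.1); positivity

theorem continuous_timeRight (hCc : Continuous C) (hC : ∀ z, |C z - 1| ≤ 1 / 100)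
    {N : ℝ × ℝ → ℝ} (hN : Continuous N) : Continuous (timeRight C h N) := by
  unfold timeRight
  refine (continuous_const.div ?_ fun z => ?_).neg.add
    ((continuous_segInt h (hN.comp continuous_swap)).comp continuous_swap)
  · exact continuous_const.mul (hCc.comp (by fun_prop))
  · have := pos_of_near_one hC (z.2, z.2); positivity

theorem abs_inv_two_mul_sub_half_le (hC : ∀ z, |C z - 1| ≤ 1 / 100) (z : ℝ × ℝ) :
    |1 / (2 * C z) - 1 / 2| ≤ 1 / 100 := by
  have h1 := abs_le.1 (hC z)
  have h2 := pos_of_near_one hC z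
  have e : 1 / (2 * C z) - 1 / 2 = (1 - C z) / (2 * C z) := by field_simp
  rw [e, abs_div, abs_of_pos (by positivity : 0 < 2 * C z), div_le_iff₀ (by positivity), abs_le]
  constructor <;> linarith

theorem abs_timeLeft_sub_half_le (hC : ∀ z, |C z - 1| ≤ 1 / 100) (hh : 0 ≤ h) {N : ℝ × ℝ → ℝ}
    {D : ℝ} (hD : ∀ z, |N z| ≤ D) (z : ℝ × ℝ) :
    |timeLeft C h N z - 1 / 2| ≤ 1 / 100 + h * D := by
  have e1 := abs_inv_two_mul_sub_half_le hC (z.1, z.1)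
  have e2 := abs_segInt_le hh hD z
  rw [abs_le] at *
  unfold timeLeft
  constructor <;> linarith [e1.1, e1.2, e2.1, e2.2]

theorem abs_timeRight_add_half_le (hC : ∀ z, |C z - 1| ≤ 1 / 100) (hh : 0 ≤ h) {N : ℝ × ℝ → ℝ}
    {D : ℝ} (hD : ∀ z, |N z| ≤ D) (z : ℝ × ℝ) :
    |timeRight C h N z + 1 / 2| ≤ 1 / 100 + h * D := by
  have e1 := abs_inv_two_mul_sub_half_le hC (z.2, z.2)
  have e2 := abs_segInt_le hh (N := N ∘ Prod.swap) (fun w => hD w.swap) z.swap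
  rw [abs_le] at *
  unfold timeRight
  constructor <;> linarith [e1.1, e1.2, e2.1, e2.2]

/-- Used twice: it keeps the fixed-point map for the mixed derivative among bounded functions, and,
applied to differences, it shows that the map contracts. -/
theorem abs_combination_le (hC : ∀ z, |C z - 1| ≤ 1 / 100) (hα : ∀ z, |Cα z| ≤ B)
    (hβ : ∀ z, |Cβ z| ≤ B) {p q D : ℝ} (hp : |p| ≤ D) (hq : |q| ≤ D) (z : ℝ × ℝ) :
    |-(Cβ z * p + Cα z * q) / (2 * C z)| ≤ 2 * (B * D) := by
  have h1 := abs_le.1 (hC z)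
  have h2 := pos_of_near_one hC z
  have hB0 : 0 ≤ B := (abs_nonneg _).trans (hα z)
  have hD0 : 0 ≤ D := (abs_nonneg _).trans hp
  have e1 : |Cβ z * p| ≤ B * D := by
    rw [abs_mul]; exact mul_le_mul (hβ z) hp (abs_nonneg _) hB0
  have e2 : |Cα z * q| ≤ B * D := by
    rw [abs_mul]; exact mul_le_mul (hα z) hq (abs_nonneg _) hB0
  rw [abs_div, abs_neg, abs_of_pos (by positivity : 0 < 2 * C z), div_le_iff₀ (by positivity)]
  have e3 := (abs_add_le (Cβ z * p) (Cα z * q)).trans (add_le_add e1 e2)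
  have e4 : 0 ≤ B * D := mul_nonneg hB0 hD0
  nlinarith

open BoundedContinuousFunction in
/-- Solution of the characteristic problem for the mixed derivative of the time coordinate. -/
theorem exists_mixed_derivative (hCc : Continuous C) (hαc : Continuous Cα) (hβc : Continuous Cβ)
    (hC : ∀ z, |C z - 1| ≤ 1 / 100) (hα : ∀ z, |Cα z| ≤ B) (hβ : ∀ z, |Cβ z| ≤ B)
    (hh : 0 < h) (hB : B * h ≤ 1 / 200) :
    ∃ N : ℝ × ℝ → ℝ, Continuous N ∧ (∀ z, |N z| * h ≤ 1 / 100) ∧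
      ∀ z, N z = -(Cβ z * timeLeft C h N z + Cα z * timeRight C h N z) / (2 * C z) := by
  -- With time τ and position ξ as functions of the labels α and β, ξ_α = C τ_α and ξ_β = -C τ_β.
  -- Equality of the mixed derivatives of ξ reads 2C τ_αβ + C_β τ_α + C_α τ_β = 0, an equation for N
  -- = τ_αβ. Truncating the segments at length h makes its right side a bounded affine map of N on
  -- the whole plane, with Lipschitz constant at most 2Bh ≤ 1/100.
  have hB0 : 0 ≤ B := (abs_nonneg _).trans (hα 0)
  have hbd : ∀ N : (ℝ × ℝ) →ᵇ ℝ, ∀ z,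
      |-(Cβ z * timeLeft C h N z + Cα z * timeRight C h N z) / (2 * C z)| ≤
        2 * (B * (51 / 100 + h * ‖N‖)) := by
    intro N z
    have e1 := abs_le.1 (abs_timeLeft_sub_half_le hC hh.le (fun z => N.norm_coe_le_norm z) z)
    have e2 := abs_le.1 (abs_timeRight_add_half_le hC hh.le (fun z => N.norm_coe_le_norm z) z)
    have hn : 0 ≤ h * ‖N‖ := by positivity
    refine abs_combination_le hC hα hβ (abs_le.2 ⟨?_, ?_⟩) (abs_le.2 ⟨?_, ?_⟩) z <;>
      linarith [e1.1, e1.2, e2.1, e2.2]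
  let Φ : ((ℝ × ℝ) →ᵇ ℝ) → ((ℝ × ℝ) →ᵇ ℝ) := fun N =>
    BoundedContinuousFunction.ofNormedAddCommGroup
      (fun z => -(Cβ z * timeLeft C h N z + Cα z * timeRight C h N z) / (2 * C z))
      (by
        refine Continuous.div ?_ (by fun_prop) fun z => ?_
        · exact ((hβc.mul (continuous_timeLeft hCc hC N.continuous)).add
            (hαc.mul (continuous_timeRight hCc hC N.continuous))).neg
        · have := pos_of_near_one hC z; positivity)
      (2 * (B * (51 / 100 + h * ‖N‖))) (hbd N)
  have hΦ : ∀ N z, Φ N z =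
      -(Cβ z * timeLeft C h N z + Cα z * timeRight C h N z) / (2 * C z) := fun _ _ => rfl
  have hcontr : ContractingWith (1 / 2) Φ := by
    refine ⟨by rw [← NNReal.coe_lt_coe]; norm_num, LipschitzWith.of_dist_le_mul fun N N' => ?_⟩
    rw [BoundedContinuousFunction.dist_le (by positivity)]
    intro z
    have hsub : ∀ w, |N w - N' w| ≤ dist N N' := fun w => by
      rw [← Real.dist_eq]; exact BoundedContinuousFunction.dist_coe_le_dist w
    have e1 : |timeLeft C h N z - timeLeft C h N' z| ≤ h * dist N N' := by
      have : timeLeft C h N z - timeLeft C h N' z = segInt h (fun w => N w - N' w) z := by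
        rw [← segInt_sub h N.continuous N'.continuous]; unfold timeLeft; ring
      rw [this]
      exact abs_segInt_le hh.le hsub z
    have e2 : |timeRight C h N z - timeRight C h N' z| ≤ h * dist N N' := by
      have : timeRight C h N z - timeRight C h N' z =
          segInt h (fun w => (N ∘ Prod.swap) w - (N' ∘ Prod.swap) w) z.swap := by
        rw [← segInt_sub h (N.continuous.comp continuous_swap) (N'.continuous.comp continuous_swap)]
        unfold timeRight; ring
      rw [this]
      exact abs_segInt_le hh.le (fun w => hsub w.swap) z.swap
    have e3 := abs_combination_le hC hα hβ e1 e2 z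
    rw [Real.dist_eq, hΦ, hΦ]
    have e4 : -(Cβ z * timeLeft C h N z + Cα z * timeRight C h N z) / (2 * C z) -
        -(Cβ z * timeLeft C h N' z + Cα z * timeRight C h N' z) / (2 * C z) =
        -(Cβ z * (timeLeft C h N z - timeLeft C h N' z) +
          Cα z * (timeRight C h N z - timeRight C h N' z)) / (2 * C z) := by ring
    rw [e4]
    refine e3.trans ?_
    have : 0 ≤ dist N N' := dist_nonneg
    push_cast
    nlinarith
  have hfix : Φ (ContractingWith.fixedPoint Φ hcontr) = ContractingWith.fixedPoint Φ hcontr :=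
    hcontr.fixedPoint_isFixedPt
  set N := ContractingWith.fixedPoint Φ hcontr
  have hNeq : ∀ z, N z =
      -(Cβ z * timeLeft C h N z + Cα z * timeRight C h N z) / (2 * C z) := fun z => by
    rw [← hΦ, hfix]
  -- The norm appears on both sides; after multiplication by h the right-hand occurrence has
  -- coefficient at most 1/100 and is absorbed.
  have hN1 : ‖N‖ ≤ 2 * (B * (51 / 100 + h * ‖N‖)) := by
    rw [BoundedContinuousFunction.norm_le (by positivity)]
    intro z
    rw [Real.norm_eq_abs, hNeq]; exact hbd N z
  have hN2 : ‖N‖ * h ≤ 1 / 100 := by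
    have h1 := mul_le_mul_of_nonneg_right hN1 hh.le
    have h2 : 0 ≤ h * ‖N‖ := by positivity
    nlinarith
  exact ⟨N, N.continuous, fun z =>
    (mul_le_mul_of_nonneg_right (N.norm_coe_le_norm z) hh.le).trans hN2, hNeq⟩

end Goursat

/-! ### Potentials of closed forms near the diagonal -/

/-- Continuity of P suffices: at b₀ the interval of integration is degenerate, so the dependence of
the integrand on b contributes only o(b - b₀). -/
theorem hasDerivAt_integral_diag {P : ℝ × ℝ → ℝ} (hP : Continuous P) (b₀ : ℝ) :
    HasDerivAt (fun b => ∫ a in b₀..b, P (a, b)) (P (b₀, b₀)) b₀ := by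
  rw [hasDerivAt_iff_isLittleO, Asymptotics.isLittleO_iff]
  intro ε hε
  have h1 := Metric.continuousAt_iff.1 (hP.continuousAt (x := (b₀, b₀))) ε hε
  obtain ⟨δ, hδ, hP'⟩ := h1
  filter_upwards [Metric.ball_mem_nhds b₀ hδ] with b hb
  have e : (∫ a in b₀..b, P (a, b)) - (∫ a in b₀..b₀, P (a, b₀)) - (b - b₀) • P (b₀, b₀) =
      ∫ a in b₀..b, (P (a, b) - P (b₀, b₀)) := by
    have hI : IntervalIntegrable (fun a => P (a, b)) MeasureTheory.volume b₀ b :=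
      (hP.comp (by fun_prop : Continuous fun a => (a, b))).intervalIntegrable _ _
    rw [intervalIntegral.integral_sub hI intervalIntegrable_const, intervalIntegral.integral_same, intervalIntegral.integral_const]
    ring
  rw [e]
  refine intervalIntegral.norm_integral_le_of_norm_le_const fun a ha => ?_
  rw [← dist_eq_norm]
  refine (hP' ?_).le
  rw [Metric.mem_ball, Real.dist_eq] at hb
  rw [Prod.dist_eq, max_lt_iff, Real.dist_eq, Real.dist_eq]
  refine ⟨lt_of_le_of_lt ?_ hb, hb⟩
  exact abs_sub_left_of_mem_uIcc (uIoc_subset_uIcc ha)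

/-- The form P da + Q db is closed, N being the common cross derivative. Its potential is integrated
from the diagonal at fixed b; the b-derivative f₀' + ∫ N - P(b, b) telescopes to Q. Continuity of
both partial derivatives then gives strict differentiability. -/
theorem hasStrictFDerivAt_potential {P Q N : ℝ × ℝ → ℝ} {f₀ : ℝ → ℝ} {h : ℝ} (hP : Continuous P)
    (hQ : Continuous Q) (hN : Continuous N)
    (hPN : ∀ z : ℝ × ℝ, |z.2 - z.1| < h → HasDerivAt (fun b => P (z.1, b)) (N z) z.2)
    (hQN : ∀ z : ℝ × ℝ, |z.2 - z.1| < h → HasDerivAt (fun a => Q (a, z.2)) (N z) z.1)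
    (hf₀ : ∀ b, HasDerivAt f₀ (P (b, b) + Q (b, b)) b) {z : ℝ × ℝ} (hz : |z.2 - z.1| < h) :
    HasStrictFDerivAt (fun z : ℝ × ℝ => f₀ z.2 + ∫ a in z.2..z.1, P (a, z.2))
      (form (P z) (Q z)) z := by
  have hI : ∀ b a₁ a₂, IntervalIntegrable (fun a => P (a, b)) MeasureTheory.volume a₁ a₂ :=
    fun b a₁ a₂ => (hP.comp (by fun_prop : Continuous fun a => (a, b))).intervalIntegrable _ _
  have hopen : ∀ᶠ w : ℝ × ℝ in 𝓝 z, |w.2 - w.1| < h :=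
    (by fun_prop : Continuous fun w : ℝ × ℝ => |w.2 - w.1|).continuousAt.eventually_lt_const hz
  have d1 : ∀ w : ℝ × ℝ, HasDerivAt (fun a' => f₀ w.2 + ∫ a in w.2..a', P (a, w.2)) (P w) w.1 := by
    intro w
    exact ((hP.comp (by fun_prop : Continuous fun a => (a, w.2))).integral_hasStrictDerivAt
      w.2 w.1).hasDerivAt.const_add _
  have d2 : ∀ w : ℝ × ℝ, |w.2 - w.1| < h →
      HasDerivAt (fun b => f₀ b + ∫ a in b..w.1, P (a, b)) (Q w) w.2 := by
    intro w hw
    have hsplit : ∀ b, f₀ b + ∫ a in b..w.1, P (a, b) =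
        f₀ b + ((∫ a in w.2..w.1, P (a, b)) - ∫ a in w.2..b, P (a, b)) := fun b => by
      rw [intervalIntegral.integral_interval_sub_left (hI _ _ _) (hI _ _ _)]
    have hseg : ∀ a ∈ uIcc w.2 w.1, |w.2 - a| ≤ |w.2 - w.1| := fun a ha => by
      rw [abs_sub_comm w.2 a, abs_sub_comm w.2 w.1]
      exact abs_sub_left_of_mem_uIcc ha
    -- This radius keeps the segment in the strip when b moves by less than η, so N may be used
    -- under the integral sign.
    set η := (h - |w.2 - w.1|) / 2 with hη
    have hη0 : 0 < η := by rw [hη]; linarith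
    obtain ⟨D, hD⟩ := ((isCompact_uIcc (a := w.2) (b := w.1)).prod
      (isCompact_closedBall w.2 η)).exists_bound_of_continuousOn hN.continuousOn
    have e1 : HasDerivAt (fun b => ∫ a in w.2..w.1, P (a, b))
        (∫ a in w.2..w.1, N (a, w.2)) w.2 := by
      refine (intervalIntegral.hasDerivAt_integral_of_dominated_loc_of_deriv_le
        (F := fun b a => P (a, b)) (F' := fun b a => N (a, b)) (bound := fun _ => D)
        (Metric.ball_mem_nhds w.2 hη0) (Eventually.of_forall fun b => ?_) (hI _ _ _) ?_
        (Eventually.of_forall fun a ha b hb => ?_) intervalIntegrable_const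
        (Eventually.of_forall fun a ha b hb => ?_)).2
      · exact (hP.comp (by fun_prop : Continuous fun a => (a, b))).aestronglyMeasurable
      · exact (hN.comp (by fun_prop : Continuous fun a => (a, w.2))).aestronglyMeasurable
      · exact hD (a, b) ⟨uIoc_subset_uIcc ha, Metric.ball_subset_closedBall hb⟩
      · refine hPN (a, b) ?_
        have h1 := hseg a (uIoc_subset_uIcc ha)
        rw [Metric.mem_ball, Real.dist_eq] at hb
        calc |b - a| = |(b - w.2) + (w.2 - a)| := by ring_nf
          _ ≤ |b - w.2| + |w.2 - a| := abs_add_le _ _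
          _ < h := by rw [hη] at hb; linarith
    have e2 : ∫ a in w.2..w.1, N (a, w.2) = Q w - Q (w.2, w.2) := by
      refine intervalIntegral.integral_eq_sub_of_hasDerivAt (f := fun a => Q (a, w.2))
        (fun a ha => hQN (a, w.2) ((hseg a ha).trans_lt hw))
        ((hN.comp (by fun_prop : Continuous fun a => (a, w.2))).intervalIntegrable _ _)
    refine (((hf₀ w.2).add (e1.sub (hasDerivAt_integral_diag hP w.2))).congr_deriv ?_
      ).congr_of_eventuallyEq (Eventually.of_forall hsplit)
    rw [e2]; ring
  have key := hasStrictFDerivAt_uncurry_coprod (𝕜 := ℝ) (u := z)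
    (f := fun a' b => f₀ b + ∫ a in b..a', P (a, b))
    (f₁ := fun a b => ContinuousLinearMap.toSpanSingleton ℝ (P (a, b)))
    (f₂ := fun a b => ContinuousLinearMap.toSpanSingleton ℝ (Q (a, b)))
    (Eventually.of_forall fun w => (d1 w).hasFDerivAt)
    (hopen.mono fun w hw => (d2 w hw).hasFDerivAt) ?_ ?_
  · refine key.congr_fderiv ?_
    ext <;> simp [Function.HasUncurry.uncurry]
  · exact (((ContinuousLinearMap.toSpanSingletonCLE (𝕜 := ℝ) (E := ℝ)).continuous).comp hP).continuousAt
  · exact (((ContinuousLinearMap.toSpanSingletonCLE (𝕜 := ℝ) (E := ℝ)).continuous).comp hQ).continuousAt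

/-- The linear change of variables `(α, β) ↦ ((α - β) / 2, (α + β) / 2)`. -/
noncomputable def charEquiv : (ℝ × ℝ) ≃L[ℝ] (ℝ × ℝ) :=
  ContinuousLinearEquiv.equivOfInverse ((form (1 / 2) (-(1 / 2))).prod (form (1 / 2) (1 / 2)))
    ((form 1 1).prod (form (-1) 1))
    (fun z => by ext <;> simp <;> ring) (fun z => by ext <;> simp <;> ring)

theorem norm_charEquiv_symm_le : ‖(charEquiv.symm : ℝ × ℝ →L[ℝ] ℝ × ℝ)‖ ≤ 2 := by
  refine ContinuousLinearMap.opNorm_le_bound _ (by norm_num) fun z => ?_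
  change ‖((form 1 1).prod (form (-1) 1)) z‖ ≤ 2 * ‖z‖
  have h1 := norm_fst_le z
  have h2 := norm_snd_le z
  rw [Real.norm_eq_abs] at h1 h2
  rw [Prod.norm_def, max_le_iff, Real.norm_eq_abs, Real.norm_eq_abs]
  simp only [ContinuousLinearMap.prod_apply, form_apply]
  have a1 := abs_le.1 h1
  have a2 := abs_le.1 h2
  constructor <;> rw [abs_le] <;> constructor <;> linarith [a1.1, a1.2, a2.1, a2.2]

theorem norm_form_le {a b D : ℝ} (h : |a| + |b| ≤ D) : ‖form a b‖ ≤ D := by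
  refine ContinuousLinearMap.opNorm_le_bound _ ((add_nonneg (abs_nonneg a) (abs_nonneg b)).trans h)
    fun z => ?_
  rw [form_apply, Real.norm_eq_abs]
  calc |a * z.1 + b * z.2| ≤ |a| * |z.1| + |b| * |z.2| := by
        rw [← abs_mul, ← abs_mul]; exact abs_add_le _ _
    _ ≤ |a| * ‖z‖ + |b| * ‖z‖ := add_le_add
        (mul_le_mul_of_nonneg_left (norm_fst_le z) (abs_nonneg _))
        (mul_le_mul_of_nonneg_left (norm_snd_le z) (abs_nonneg _))
    _ ≤ D * ‖z‖ := by rw [← add_mul]; exact mul_le_mul_of_nonneg_right h (norm_nonneg _)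

/-- Near `t = 0`, the plane is parametrized by the labels `a`, `b` of the two characteristics
through a point, for a speed `C` which is a given function of the labels. -/
theorem exists_char_labels {C Cα Cβ : ℝ × ℝ → ℝ} {B h : ℝ} (hCc : Continuous C)
    (hαc : Continuous Cα) (hβc : Continuous Cβ) (hC : ∀ z, |C z - 1| ≤ 1 / 100)
    (hα : ∀ z, |Cα z| ≤ B) (hβ : ∀ z, |Cβ z| ≤ B) (hh : 0 < h) (hB : B * h ≤ 1 / 200)
    (hCα : ∀ z, HasDerivAt (fun a => C (a, z.2)) (Cα z) z.1)
    (hCβ : ∀ z, HasDerivAt (fun b => C (z.1, b)) (Cβ z) z.2) :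
    ∃ (w : ℝ × ℝ → ℝ × ℝ) (p q : ℝ × ℝ → ℝ), Continuous p ∧ Continuous q ∧
      (∀ z, |p z - 1 / 2| ≤ 1 / 50) ∧ (∀ z, |q z + 1 / 2| ≤ 1 / 50) ∧
      (∀ x, w (0, x) = (x, x)) ∧
      ∀ z : ℝ × ℝ, |z.1| ≤ h / 16 →
        HasFDerivAt w ((form (1 / (2 * p (w z))) (1 / (2 * (C (w z) * p (w z))))).prod
          (form (1 / (2 * q (w z))) (-(1 / (2 * (C (w z) * q (w z))))))) z := by
  obtain ⟨N, hNc, hNh, hN⟩ := exists_mixed_derivative hCc hαc hβc hC hα hβ hh hB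
  have hD : ∀ z, |N z| ≤ 1 / 100 / h := fun z => by rw [le_div_iff₀ hh]; exact hNh z
  have hDh : h * (1 / 100 / h) = 1 / 100 := by field_simp
  set p := timeLeft C h N with hp
  set q := timeRight C h N with hq
  have hpc : Continuous p := continuous_timeLeft hCc hC hNc
  have hqc : Continuous q := continuous_timeRight hCc hC hNc
  have hpb : ∀ z, |p z - 1 / 2| ≤ 1 / 50 := fun z => by
    have := abs_timeLeft_sub_half_le hC hh.le hD z
    rw [hDh] at this; linarith
  have hqb : ∀ z, |q z + 1 / 2| ≤ 1 / 50 := fun z => by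
    have := abs_timeRight_add_half_le hC hh.le hD z
    rw [hDh] at this; linarith
  have hpN : ∀ z : ℝ × ℝ, |z.2 - z.1| < h → HasDerivAt (fun b => p (z.1, b)) (N z) z.2 :=
    fun z hz => (hasDerivAt_segInt hNc hz).const_add (1 / (2 * C (z.1, z.1)))
  have hqN : ∀ z : ℝ × ℝ, |z.2 - z.1| < h → HasDerivAt (fun a => q (a, z.2)) (N z) z.1 := by
    intro z hz
    have := hasDerivAt_segInt (hNc.comp continuous_swap) (z := z.swap) (h := h)
      (by rw [abs_sub_comm]; exact hz)
    exact this.const_add (-(1 / (2 * C (z.2, z.2))))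
  have hpd : ∀ b, p (b, b) = 1 / (2 * C (b, b)) := fun b => by
    simp [hp, timeLeft, segInt_diag hh.le]
  have hqd : ∀ b, q (b, b) = -(1 / (2 * C (b, b))) := fun b => by
    simp [hq, timeRight, segInt_diag hh.le]
  -- Time and position in terms of the labels, with differentials (p, q) and (C p, -C q). On the
  -- diagonal both characteristics start at the same point, so τ = 0 and ξ is the common label.
  set τ : ℝ × ℝ → ℝ := fun z => 0 + ∫ a in z.2..z.1, p (a, z.2) with hτ
  set ξ : ℝ × ℝ → ℝ := fun z => z.2 + ∫ a in z.2..z.1, C (a, z.2) * p (a, z.2) with hξ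
  have dτ : ∀ z : ℝ × ℝ, |z.2 - z.1| < h → HasStrictFDerivAt τ (form (p z) (q z)) z :=
    fun z hz => hasStrictFDerivAt_potential hpc hqc hNc hpN hqN
      (f₀ := fun _ => 0) (fun b => by
        rw [hpd, hqd, add_neg_cancel]; exact hasDerivAt_const b (0 : ℝ)) hz
  have dξ : ∀ z : ℝ × ℝ, |z.2 - z.1| < h →
      HasStrictFDerivAt ξ (form (C z * p z) (-(C z * q z))) z := by
    intro z hz
    refine hasStrictFDerivAt_potential (P := fun z => C z * p z) (Q := fun z => -(C z * q z))
      (N := fun z => Cβ z * p z + C z * N z) (f₀ := fun b => b)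
      (hCc.mul hpc) (hCc.mul hqc).neg ((hβc.mul hpc).add (hCc.mul hNc))
      (fun z hz => (hCβ z).mul (hpN z hz)) (fun z hz => ?_) (fun b => ?_) hz
    · refine ((hCα z).mul (hqN z hz)).neg.congr_deriv ?_
      have h1 := hN z
      have h2 := pos_of_near_one hC z
      rw [eq_div_iff (by positivity)] at h1
      -- Closedness of the form defining ξ is exactly the equation solved by N.
      linear_combination -h1
    · refine (hasDerivAt_id b).congr_deriv ?_
      rw [hpd, hqd]
      have h2 := pos_of_near_one hC (b, b)
      field_simp; norm_num
  set S : Set (ℝ × ℝ) := {z | |z.2 - z.1| < h} with hS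
  have hSo : IsOpen S := isOpen_lt (by fun_prop) continuous_const
  have hSc : Convex ℝ S := by
    have : S = (fun z : ℝ × ℝ => form (-1) 1 z) ⁻¹' (Metric.ball 0 h) := by
      ext z
      simp only [hS, mem_ofPred_eq, mem_preimage, form_apply, Metric.mem_ball, Real.dist_eq]
      ring_nf
    rw [this]
    exact (convex_ball _ _).linear_preimage (form (-1) 1).toLinearMap
  set Ψ : ℝ × ℝ → ℝ × ℝ := fun z => (τ z, ξ z) with hΨ
  have dΨ : ∀ z ∈ S, HasFDerivAt Ψ ((form (p z) (q z)).prod (form (C z * p z) (-(C z * q z)))) z :=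
    fun z hz => ((dτ z hz).prodMk (dξ z hz)).hasFDerivAt
  have hb : ∀ z, |p z - 1 / 2| + |q z + 1 / 2| ≤ 1 / 4 ∧
      |C z * p z - 1 / 2| + |C z * q z + 1 / 2| ≤ 1 / 4 := by
    intro z
    have h1 := abs_le.1 (hpb z)
    have h2 := abs_le.1 (hqb z)
    have h3 := abs_le.1 (hC z)
    refine ⟨by linarith [hpb z, hqb z], ?_⟩
    have e1 : |C z * p z - 1 / 2| ≤ 1 / 8 := by
      rw [abs_le]; constructor <;> nlinarith
    have e2 : |C z * q z + 1 / 2| ≤ 1 / 8 := by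
      rw [abs_le]; constructor <;> nlinarith
    linarith
  -- For C = 1 the map is `charEquiv`. On the convex strip the derivative stays within 1/4 of it, so
  -- the quantitative inverse function theorem applies.
  have happ : ApproximatesLinearOn Ψ (charEquiv : ℝ × ℝ →L[ℝ] ℝ × ℝ) S (1 / 4) := by
    intro x hx y hy
    refine hSc.norm_image_sub_le_of_norm_hasFDerivWithin_le' (𝕜 := ℝ) (C := 1 / 4)
      (fun z hz => (dΨ z hz).hasFDerivWithinAt) (fun z hz => ?_) hy hx
    have e : (form (p z) (q z)).prod (form (C z * p z) (-(C z * q z))) -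
        (charEquiv : ℝ × ℝ →L[ℝ] ℝ × ℝ) = (form (p z - 1 / 2) (q z + 1 / 2)).prod
          (form (C z * p z - 1 / 2) (-(C z * q z + 1 / 2))) := by
      change _ - (form (1 / 2) (-(1 / 2))).prod (form (1 / 2) (1 / 2)) = _
      ext <;> simp
      ring
    rw [e, ContinuousLinearMap.opNorm_prod, Prod.norm_def, max_le_iff]
    exact ⟨norm_form_le (hb z).1, norm_form_le (by rw [abs_neg]; exact (hb z).2)⟩
  have hinv : (2 : NNReal)⁻¹ ≤ ‖(charEquiv.symm : ℝ × ℝ →L[ℝ] ℝ × ℝ)‖₊⁻¹ := by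
    refine inv_anti₀ ?_ ?_
    · exact charEquiv.nnnorm_symm_pos
    · rw [← NNReal.coe_le_coe]; exact norm_charEquiv_symm_le
  have hlt : (1 / 4 : NNReal) < ‖(charEquiv.symm : ℝ × ℝ →L[ℝ] ℝ × ℝ)‖₊⁻¹ :=
    lt_of_lt_of_le (by rw [← NNReal.coe_lt_coe]; norm_num) hinv
  set e := happ.toOpenPartialHomeomorph Ψ S (Or.inr hlt) hSo with he
  have hcoe : ∀ z, e z = Ψ z := fun z => rfl
  have hΨd : ∀ x, Ψ (x, x) = (0, x) := fun x => by simp [hΨ, hτ, hξ]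
  -- The inverse linear map has norm at most 2, so the image of a ball of radius h/4 about a
  -- diagonal point contains a ball of radius (1/2 - 1/4) h/4 = h/16.
  have htarget : ∀ z : ℝ × ℝ, |z.1| ≤ h / 16 → z ∈ e.target := by
    intro z hz
    have hball : Metric.closedBall (z.2, z.2) (h / 4) ⊆ S := by
      intro y hy
      rw [Metric.mem_closedBall, Prod.dist_eq, max_le_iff, Real.dist_eq, Real.dist_eq] at hy
      have h1 := abs_le.1 hy.1
      have h2 := abs_le.1 hy.2
      simp only [hS, mem_ofPred_eq]
      rw [abs_lt]; constructor <;> linarith [h1.1, h1.2, h2.1, h2.2]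
    refine happ.closedBall_subset_target (Or.inr hlt) hSo (by positivity) hball ?_
    rw [hΨd, Metric.mem_closedBall, Prod.dist_eq, max_le_iff, dist_self, Real.dist_eq, sub_zero]
    have h1 : (2 : ℝ)⁻¹ ≤ ((‖(charEquiv.symm : ℝ × ℝ →L[ℝ] ℝ × ℝ)‖₊⁻¹ : NNReal) : ℝ) := by
      exact_mod_cast hinv
    have h2 : h / 16 ≤ (((‖(charEquiv.symm : ℝ × ℝ →L[ℝ] ℝ × ℝ)‖₊⁻¹ : NNReal) : ℝ) -
        ((1 / 4 : NNReal) : ℝ)) * (h / 4) := by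
      push_cast at h1 ⊢
      nlinarith
    exact ⟨hz.trans h2, (by positivity : 0 ≤ h / 16).trans h2⟩
  refine ⟨e.symm, p, q, hpc, hqc, hpb, hqb, fun x => ?_, fun z hz => ?_⟩
  · rw [← hΨd, ← hcoe, e.left_inv]
    change (x, x) ∈ S
    simpa [hS] using hh
  · have hzt := htarget z hz
    have hws : e.symm z ∈ S := e.map_target hzt
    set y := e.symm z with hy
    have hp1 := abs_le.1 (hpb y)
    have hq1 := abs_le.1 (hqb y)
    have hp0 : p y ≠ 0 := by intro h0; rw [h0] at hp1; linarith [hp1.1]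
    have hq0 : q y ≠ 0 := by intro h0; rw [h0] at hq1; linarith [hq1.2]
    have hC0 : C y ≠ 0 := (pos_of_near_one hC y).ne'
    let A : (ℝ × ℝ) ≃L[ℝ] (ℝ × ℝ) := ContinuousLinearEquiv.equivOfInverse
      ((form (p y) (q y)).prod (form (C y * p y) (-(C y * q y))))
      ((form (1 / (2 * p y)) (1 / (2 * (C y * p y)))).prod
          (form (1 / (2 * q y)) (-(1 / (2 * (C y * q y))))))
      (fun v => by ext <;> simp <;> field_simp <;> ring)
      (fun v => by ext <;> simp <;> field_simp <;> ring)
    exact e.hasFDerivAt_symm (f' := A) hzt (dΨ y hws)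

/-! ### Local existence -/

/-- Local existence for the diagonal system: the time of existence depends only on bounds of the
speed and of the gradient of the data. -/
theorem exists_local_diagSol {k : ℝ → ℝ} {K : ℝ} (hk : IsSpeed k K) {M : ℝ} (hM0 : 0 ≤ M) :
    ∃ T₀ > 0, ∀ r₀ s₀ : ℝ → ℝ, ContDiff ℝ 1 r₀ → ContDiff ℝ 1 s₀ →
      (∀ x, |deriv r₀ x| ≤ M) → (∀ x, |deriv s₀ x| ≤ M) →
      ∃ r s : ℝ → ℝ → ℝ, DiagSol k T₀ r s ∧ GradientBound T₀ r s (2 * M) ∧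
        (∀ x, r 0 x = r₀ x) ∧ ∀ x, s 0 x = s₀ x := by
  have hK := hk.nonneg
  -- Only K and M enter, which makes the existence time uniform over the data; the summand 1 covers
  -- K M = 0.
  set h : ℝ := 1 / (200 * (K * M + 1)) with hh
  have hKM : 0 ≤ K * M := mul_nonneg hK hM0
  have hhpos : 0 < h := by positivity
  have hB : K * M * h ≤ 1 / 200 := by
    rw [hh, mul_one_div, div_le_div_iff₀ (by positivity) (by norm_num)]
    linarith
  refine ⟨h / 16, by positivity, fun r₀ s₀ hr hs hrM hsM => ?_⟩
  have hrd : ∀ x, HasDerivAt r₀ (deriv r₀ x) x :=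
    fun x => (hr.differentiable one_ne_zero x).hasDerivAt
  have hsd : ∀ x, HasDerivAt s₀ (deriv s₀ x) x :=
    fun x => (hs.differentiable one_ne_zero x).hasDerivAt
  have hrc := hr.continuous_deriv le_rfl
  have hsc := hs.continuous_deriv le_rfl
  have hr1 := hr.continuous
  have hs1 := hs.continuous
  -- Since r depends only on the first label and s only on the second, the speed is known in these
  -- coordinates before the solution is.
  set C : ℝ × ℝ → ℝ := fun z => k ((r₀ z.1 - s₀ z.2) / 2) with hC
  set Cα : ℝ × ℝ → ℝ := fun z => deriv k ((r₀ z.1 - s₀ z.2) / 2) * (deriv r₀ z.1 / 2) with hCα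
  set Cβ : ℝ × ℝ → ℝ := fun z => deriv k ((r₀ z.1 - s₀ z.2) / 2) * (-deriv s₀ z.2 / 2) with hCβ
  have hkc := hk.continuous
  have hkdc := hk.continuous_deriv
  have hCc : Continuous C := by fun_prop
  have hαc : Continuous Cα := by fun_prop
  have hβc : Continuous Cβ := by fun_prop
  have hC1 : ∀ z, |C z - 1| ≤ 1 / 100 := fun z => hk.near_one _
  obtain ⟨w, p, q, hpc, hqc, hpb, hqb, hw0, hw⟩ := exists_char_labels (B := K * M) hCc hαc hβc hC1
    (fun z => by
      rw [hCα, abs_mul]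
      refine mul_le_mul (hk.deriv_le _) ?_ (abs_nonneg _) hK
      rw [abs_div, abs_two]; linarith [hrM z.1])
    (fun z => by
      rw [hCβ, abs_mul]
      refine mul_le_mul (hk.deriv_le _) ?_ (abs_nonneg _) hK
      rw [abs_div, abs_two, abs_neg]; linarith [hsM z.2]) hhpos hB
    (fun z => (hk.hasDerivAt _).comp z.1 (((hrd z.1).sub_const (s₀ z.2)).div_const 2))
    (fun z => ((hk.hasDerivAt _).comp z.2 (((hsd z.2).const_sub (r₀ z.1)).div_const 2)))
  have hC0 : ∀ z, C z ≠ 0 := fun z => (pos_of_near_one hC1 z).ne'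
  have hp0 : ∀ z, 0 < p z := fun z => by linarith [(abs_le.1 (hpb z)).1]
  have hq0 : ∀ z, q z < 0 := fun z => by linarith [(abs_le.1 (hqb z)).2]
  have hmem : ∀ z ∈ slab (h / 16), |z.1| ≤ h / 16 := fun z hz => by
    rw [abs_of_nonneg hz.1.1]; exact hz.1.2.le
  have dr : ∀ z ∈ slab (h / 16), HasFDerivAt (fun z => r₀ (w z).1)
      (form (C (w z) * (deriv r₀ (w z).1 / (2 * (C (w z) * p (w z)))))
        (deriv r₀ (w z).1 / (2 * (C (w z) * p (w z))))) z := by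
    intro z hz
    have h1 := (hrd (w z).1).hasFDerivAt.comp z (hw z (hmem z hz)).fst
    refine h1.congr_fderiv ?_
    have := hC0 (w z); have := (hp0 (w z)).ne'
    ext <;> simp <;> field_simp
  have ds : ∀ z ∈ slab (h / 16), HasFDerivAt (fun z => s₀ (w z).2)
      (form (-(C (w z) * (-(deriv s₀ (w z).2 / (2 * (C (w z) * q (w z)))))))
        (-(deriv s₀ (w z).2 / (2 * (C (w z) * q (w z)))))) z := by
    intro z hz
    have h1 := (hsd (w z).2).hasFDerivAt.comp z (hw z (hmem z hz)).snd
    refine h1.congr_fderiv ?_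
    have := hC0 (w z); have := (hq0 (w z)).ne
    ext <;> simp <;> field_simp
  set r : ℝ → ℝ → ℝ := fun t x => r₀ (w (t, x)).1 with hrdef
  set s : ℝ → ℝ → ℝ := fun t x => s₀ (w (t, x)).2 with hsdef
  have hdr : ∀ z ∈ slab (h / 16), dx r z.1 z.2 =
      deriv r₀ (w z).1 / (2 * (C (w z) * p (w z))) := fun z hz =>
    (hasDerivAt_of_hasFDerivWithinAt_slab (R := r) hz.1 (dr z hz).hasFDerivWithinAt).deriv
  have hds : ∀ z ∈ slab (h / 16), dx s z.1 z.2 =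
      -(deriv s₀ (w z).2 / (2 * (C (w z) * q (w z)))) := fun z hz =>
    (hasDerivAt_of_hasFDerivWithinAt_slab (R := s) hz.1 (ds z hz).hasFDerivWithinAt).deriv
  have hwc : ContinuousOn w (slab (h / 16)) :=
    fun z hz => (hw z (hmem z hz)).continuousAt.continuousWithinAt
  -- The gradients are D / (2cy) with c near 1 and y near 1/2, and 2cy ≥ 1/2 gives the factor 2.
  have hbound : ∀ D y c : ℝ, |D| ≤ M → |c - 1| ≤ 1 / 100 → |y - 1 / 2| ≤ 1 / 50 →
      |D / (2 * (c * y))| ≤ 2 * M := by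
    intro D y c hD hc hy
    have h1 := abs_le.1 hc
    have h2 := abs_le.1 hy
    have h3 : 1 / 2 ≤ 2 * (c * y) := by nlinarith
    rw [abs_div, abs_of_pos (by linarith : 0 < 2 * (c * y)), div_le_iff₀ (by linarith)]
    nlinarith
  refine ⟨r, s, ⟨fun t ht x => ?_, fun t ht x => ?_, ?_, ?_⟩, fun t ht x => ⟨?_, ?_⟩,
    fun x => ?_, fun x => ?_⟩
  · rw [hdr (t, x) (mem_slab.2 ht)]
    exact (dr (t, x) (mem_slab.2 ht)).hasFDerivWithinAt
  · rw [hds (t, x) (mem_slab.2 ht)]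
    exact (ds (t, x) (mem_slab.2 ht)).hasFDerivWithinAt
  · refine ContinuousOn.congr ?_ hdr
    refine ContinuousOn.div (by fun_prop) (by fun_prop) fun z _ => ?_
    exact mul_ne_zero two_ne_zero (mul_ne_zero (hC0 _) (hp0 _).ne')
  · refine ContinuousOn.congr ?_ hds
    refine (ContinuousOn.div (by fun_prop) (by fun_prop) fun z _ => ?_).neg
    exact mul_ne_zero two_ne_zero (mul_ne_zero (hC0 _) (hq0 _).ne)
  · rw [hdr (t, x) (mem_slab.2 ht)]
    exact hbound _ _ _ (hrM _) (hC1 _) (hpb _)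
  · rw [hds (t, x) (mem_slab.2 ht)]
    have := hbound (deriv s₀ (w (t, x)).2) (-q (w (t, x))) _ (hsM _) (hC1 (w (t, x)))
      (by rw [abs_le] ; have := abs_le.1 (hqb (w (t, x))); constructor <;> linarith [this.1, this.2])
    rw [mul_neg, mul_neg, div_neg] at this
    exact this
  · simp [hrdef, hw0]
  · simp [hsdef, hw0]

end QuasilinearWave

namespace QuasilinearWave

/-! ### Gluing and continuation -/

/-- The diagonal system at a point, with differentiability relative to a set. -/
structure DiagAt (k : ℝ → ℝ) (A : Set (ℝ × ℝ)) (r s : ℝ → ℝ → ℝ) (t x : ℝ) : Prop where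
  left : HasFDerivWithinAt (fun z : ℝ × ℝ => r z.1 z.2)
    (form (k ((r t x - s t x) / 2) * dx r t x) (dx r t x)) A (t, x)
  right : HasFDerivWithinAt (fun z : ℝ × ℝ => s z.1 z.2)
    (form (-(k ((r t x - s t x) / 2) * dx s t x)) (dx s t x)) A (t, x)
  continuous_left : ContinuousWithinAt (fun z : ℝ × ℝ => dx r z.1 z.2) A (t, x)
  continuous_right : ContinuousWithinAt (fun z : ℝ × ℝ => dx s z.1 z.2) A (t, x)

theorem dx_congr {f g : ℝ → ℝ → ℝ} {t : ℝ} (h : f t = g t) (x : ℝ) : dx f t x = dx g t x := by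
  simp only [dx, h]

theorem diagSol_iff {k : ℝ → ℝ} {T : ℝ} {r s : ℝ → ℝ → ℝ} :
    DiagSol k T r s ↔ ∀ t ∈ Ico 0 T, ∀ x, DiagAt k (slab T) r s t x := by
  constructor
  · intro h t ht x
    exact ⟨h.left t ht x, h.right t ht x, h.continuous_left _ (mem_slab.2 ht),
      h.continuous_right _ (mem_slab.2 ht)⟩
  · intro h
    exact ⟨fun t ht x => (h t ht x).left, fun t ht x => (h t ht x).right,
      fun z hz => (h z.1 hz.1 z.2).continuous_left, fun z hz => (h z.1 hz.1 z.2).continuous_right⟩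

namespace DiagAt

variable {k : ℝ → ℝ} {A A' : Set (ℝ × ℝ)} {r s r' s' : ℝ → ℝ → ℝ} {t x : ℝ}

/-- The tool for gluing. Agreement is required of entire time slices, so that the space derivatives
agree as well. -/
theorem congr (h : DiagAt k A' r' s' t x) (hA : A' ∈ 𝓝[A] (t, x)) (htA : (t, x) ∈ A)
    (he : ∀ᶠ z : ℝ × ℝ in 𝓝[A] (t, x), r z.1 = r' z.1 ∧ s z.1 = s' z.1) : DiagAt k A r s t x := by
  have h0 := he.self_of_nhdsWithin htA
  simp only at h0
  have er : (fun z : ℝ × ℝ => r z.1 z.2) =ᶠ[𝓝[A] (t, x)] fun z => r' z.1 z.2 :=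
    he.mono fun z hz => by simp only [hz.1]
  have es : (fun z : ℝ × ℝ => s z.1 z.2) =ᶠ[𝓝[A] (t, x)] fun z => s' z.1 z.2 :=
    he.mono fun z hz => by simp only [hz.2]
  have edr : (fun z : ℝ × ℝ => dx r z.1 z.2) =ᶠ[𝓝[A] (t, x)] fun z => dx r' z.1 z.2 :=
    he.mono fun z hz => dx_congr hz.1 z.2
  have eds : (fun z : ℝ × ℝ => dx s z.1 z.2) =ᶠ[𝓝[A] (t, x)] fun z => dx s' z.1 z.2 :=
    he.mono fun z hz => dx_congr hz.2 z.2
  refine ⟨?_, ?_, ?_, ?_⟩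
  · rw [h0.1, h0.2, dx_congr h0.1]
    exact (h.left.mono_of_mem_nhdsWithin hA).congr_of_eventuallyEq er (by simp [h0.1])
  · rw [h0.1, h0.2, dx_congr h0.2]
    exact (h.right.mono_of_mem_nhdsWithin hA).congr_of_eventuallyEq es (by simp [h0.2])
  · exact (h.continuous_left.mono_of_mem_nhdsWithin hA).congr_of_eventuallyEq edr
      (dx_congr h0.1 x)
  · exact (h.continuous_right.mono_of_mem_nhdsWithin hA).congr_of_eventuallyEq eds
      (dx_congr h0.2 x)

theorem shift {a : ℝ} (h : DiagAt k A r s (t - a) x) :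
    DiagAt k ((fun z : ℝ × ℝ => (z.1 - a, z.2)) ⁻¹' A) (fun t => r (t - a)) (fun t => s (t - a))
      t x := by
  have hd : HasFDerivWithinAt (fun z : ℝ × ℝ => (z.1 - a, z.2)) (ContinuousLinearMap.id ℝ (ℝ × ℝ))
      ((fun z : ℝ × ℝ => (z.1 - a, z.2)) ⁻¹' A) (t, x) :=
    (((hasFDerivWithinAt_fst (𝕜 := ℝ) (E := ℝ) (F := ℝ)).sub_const a).prodMk
      hasFDerivWithinAt_snd).congr_fderiv (by ext <;> simp)
  have hm : MapsTo (fun z : ℝ × ℝ => (z.1 - a, z.2))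
      ((fun z : ℝ × ℝ => (z.1 - a, z.2)) ⁻¹' A) A := fun z hz => hz
  refine ⟨?_, ?_, ?_, ?_⟩
  · exact HasFDerivWithinAt.comp (g := fun z : ℝ × ℝ => r z.1 z.2) (t, x) h.left hd hm
  · exact HasFDerivWithinAt.comp (g := fun z : ℝ × ℝ => s z.1 z.2) (t, x) h.right hd hm
  · exact ContinuousWithinAt.comp (g := fun z : ℝ × ℝ => dx r z.1 z.2) (x := (t, x))
      h.continuous_left hd.continuousWithinAt hm
  · exact ContinuousWithinAt.comp (g := fun z : ℝ × ℝ => dx s z.1 z.2) (x := (t, x))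
      h.continuous_right hd.continuousWithinAt hm

end DiagAt

/-- Existence on `[0, T)` of a solution of the diagonal system with bounded gradient. -/
def HasDiagSol (k r₀ s₀ : ℝ → ℝ) (T : ℝ) : Prop :=
  ∃ r s, DiagSol k T r s ∧ (∃ M, GradientBound T r s M) ∧ r 0 = r₀ ∧ s 0 = s₀

variable {k : ℝ → ℝ} {K : ℝ} {r₀ s₀ : ℝ → ℝ} {N : ℝ}

theorem DiagSol.unique' {T : ℝ} {r s r' s' : ℝ → ℝ → ℝ} (h : DiagSol k T r s)
    (h' : DiagSol k T r' s') (hk : IsSpeed k K) (hM : ∃ M, GradientBound T r s M)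
    (hM' : ∃ M, GradientBound T r' s' M) (hr : r 0 = r' 0) (hs : s 0 = s' 0)
    (hrN : ∀ x, |r 0 x| ≤ N) (hsN : ∀ x, |s 0 x| ≤ N) {t : ℝ} (ht : t ∈ Ico 0 T) :
    r t = r' t ∧ s t = s' t := by
  obtain ⟨M, hM⟩ := hM
  obtain ⟨M', hM'⟩ := hM'
  have h1 : GradientBound T r s (max M M') := fun t ht x =>
    ⟨(hM t ht x).1.trans (le_max_left _ _), (hM t ht x).2.trans (le_max_left _ _)⟩
  have h2 : GradientBound T r' s' (max M M') := fun t ht x =>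
    ⟨(hM' t ht x).1.trans (le_max_right _ _), (hM' t ht x).2.trans (le_max_right _ _)⟩
  have key := fun x => h.unique h' hk h1 h2 (congrFun hr) (congrFun hs) hrN hsN ht x
  exact ⟨funext fun x => (key x).1, funext fun x => (key x).2⟩

theorem GradientBound.mono {T T' M : ℝ} {r s : ℝ → ℝ → ℝ} (h : GradientBound T r s M)
    (hT : T' ≤ T) : GradientBound T' r s M := fun t ht x => h t ⟨ht.1, ht.2.trans_le hT⟩ x

/-- Solutions on all shorter intervals glue to a solution on `[0, T)`. -/
theorem exists_diagSol_of_forall_lt (hk : IsSpeed k K) (hrN : ∀ x, |r₀ x| ≤ N)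
    (hsN : ∀ x, |s₀ x| ≤ N) {T : ℝ} (hT : 0 < T)
    (h : ∀ T' < T, 0 < T' → HasDiagSol k r₀ s₀ T') :
    ∃ r s, DiagSol k T r s ∧ (∀ T' < T, ∃ M, GradientBound T' r s M) ∧ r 0 = r₀ ∧ s 0 = s₀ := by
  choose! R S hRS hRM hR0 hS0 using h
  -- At time t the solution living up to the midpoint of t and T is used; by uniqueness every other
  -- one defined at t has the same value.
  set r : ℝ → ℝ → ℝ := fun t => R ((t + T) / 2) t with hr
  set s : ℝ → ℝ → ℝ := fun t => S ((t + T) / 2) t with hs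
  have key : ∀ τ < T, ∀ t ∈ Ico 0 τ, r t = R τ t ∧ s t = S τ t := by
    intro τ hτ t ht
    have hτ0 : 0 < τ := ht.1.trans_lt ht.2
    set σ := (t + T) / 2 with hσ
    have hσT : σ < T := by rw [hσ]; linarith [ht.2]
    have hσt : t < σ := by rw [hσ]; linarith [ht.2]
    have hσ0 : 0 < σ := ht.1.trans_lt hσt
    obtain ⟨M, hM⟩ := hRM σ hσT hσ0
    obtain ⟨M', hM'⟩ := hRM τ hτ hτ0
    exact ((hRS σ hσT hσ0).mono (min_le_left σ τ)).unique' ((hRS τ hτ hτ0).mono (min_le_right σ τ))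
      hk ⟨M, hM.mono (min_le_left _ _)⟩ ⟨M', hM'.mono (min_le_right _ _)⟩
      (by rw [hR0 σ hσT hσ0, hR0 τ hτ hτ0]) (by rw [hS0 σ hσT hσ0, hS0 τ hτ hτ0])
      (by rw [hR0 σ hσT hσ0]; exact hrN) (by rw [hS0 σ hσT hσ0]; exact hsN)
      ⟨ht.1, lt_min hσt ht.2⟩
  refine ⟨r, s, diagSol_iff.2 fun t ht x => ?_, fun T' hT' => ?_, ?_, ?_⟩
  · set σ := (t + T) / 2 with hσ
    have hσT : σ < T := by rw [hσ]; linarith [ht.2]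
    have hσt : t < σ := by rw [hσ]; linarith [ht.2]
    refine (diagSol_iff.1 (hRS σ hσT (ht.1.trans_lt hσt)) t ⟨ht.1, hσt⟩ x).congr
      (slab_mem_nhdsWithin hσt) (mem_slab.2 ht) ?_
    filter_upwards [slab_mem_nhdsWithin hσt] with z hz
    exact key σ hσT z.1 hz.1
  · rcases le_or_gt T' 0 with h0 | h0
    · exact ⟨0, fun t ht => absurd (ht.1.trans_lt ht.2) (not_lt.2 h0)⟩
    · obtain ⟨M, hM⟩ := hRM T' hT' h0
      refine ⟨M, fun t ht x => ?_⟩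
      rw [dx_congr (key T' hT' t ht).1, dx_congr (key T' hT' t ht).2]
      exact hM t ht x
  · rw [(key (T / 2) (by linarith) 0 ⟨le_rfl, by linarith⟩).1]
    exact hR0 _ (by linarith) (by linarith)
  · rw [(key (T / 2) (by linarith) 0 ⟨le_rfl, by linarith⟩).2]
    exact hS0 _ (by linarith) (by linarith)

theorem DiagSol.shift {T a : ℝ} {r s : ℝ → ℝ → ℝ} (h : DiagSol k T r s) (ha : 0 ≤ a) :
    DiagSol k (T - a) (fun t => r (t + a)) (fun t => s (t + a)) := by
  refine diagSol_iff.2 fun t ht x => ?_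
  have h1 : t + a ∈ Ico 0 T := ⟨by linarith [ht.1], by linarith [ht.2]⟩
  have h2 := diagSol_iff.1 h (t + a) h1 x
  rw [← sub_neg_eq_add] at h2
  have h3 := h2.shift
  simp only [sub_neg_eq_add] at h3
  refine h3.congr (mem_of_superset self_mem_nhdsWithin fun z hz => ?_) (mem_slab.2 ht)
    (Eventually.of_forall fun z => ⟨rfl, rfl⟩)
  exact ⟨⟨by linarith [hz.1.1], by linarith [hz.1.2]⟩, mem_univ _⟩

/-- A solution with bounded gradient extends to a larger time interval. -/
theorem exists_gt_hasDiagSol (hk : IsSpeed k K) (hrN : ∀ x, |r₀ x| ≤ N)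
    (hsN : ∀ x, |s₀ x| ≤ N) {T M : ℝ} (hT : 0 < T) {r s : ℝ → ℝ → ℝ} (h : DiagSol k T r s)
    (hM : GradientBound T r s M) (hr : r 0 = r₀) (hs : s 0 = s₀) :
    ∃ T' > T, HasDiagSol k r₀ s₀ T' := by
  have hM0 : 0 ≤ M := (abs_nonneg _).trans (hM 0 ⟨le_rfl, hT⟩ 0).1
  obtain ⟨T₀, hT₀, hloc⟩ := exists_local_diagSol hk hM0
  have hmin : 0 < min T T₀ := lt_min hT hT₀
  -- Restarting at t₀ > 0 leaves only min(T, T₀)/2 until T, less than the guaranteed existence time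
  -- T₀, which depends on M alone.
  set t₀ := T - min T T₀ / 2 with ht₀
  have ht₀T : t₀ < T := by linarith
  have ht₀0 : 0 < t₀ := by linarith [min_le_left T T₀]
  have hT₀' : T < t₀ + T₀ := by linarith [min_le_right T T₀]
  have hmem : t₀ ∈ Ico 0 T := ⟨ht₀0.le, ht₀T⟩
  have hcont : ∀ {R : ℝ → ℝ → ℝ}, ContinuousOn (fun z : ℝ × ℝ => dx R z.1 z.2) (slab T) →
      (∀ x, HasDerivAt (R t₀) (dx R t₀ x) x) → ContDiff ℝ 1 (R t₀) := by
    intro R hc hd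
    refine contDiff_one_iff_deriv.2 ⟨fun x => (hd x).differentiableAt, ?_⟩
    rw [funext fun x => (hd x).deriv, ← continuousOn_univ]
    exact hc.comp (f := fun x => (t₀, x)) (by fun_prop) (fun x _ => mem_slab.2 hmem)
  obtain ⟨r', s', hrs', hM', hr', hs'⟩ := hloc (r t₀) (s t₀)
    (hcont h.continuous_left (h.hasDerivAt_left hmem))
    (hcont h.continuous_right (h.hasDerivAt_right hmem))
    (fun x => (hM t₀ hmem x).1) (fun x => (hM t₀ hmem x).2)
  have hagree : ∀ t ∈ Ico t₀ T, r t = r' (t - t₀) ∧ s t = s' (t - t₀) := by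
    intro t ht
    have := (h.shift ht₀0.le).unique' (hrs'.mono (by linarith : T - t₀ ≤ T₀)) hk (N := N)
      ⟨M, fun t ht x => hM (t + t₀) ⟨by linarith [ht.1], by linarith [ht.2]⟩ x⟩
      ⟨2 * M, hM'.mono (by linarith)⟩
      (by rw [zero_add]; exact (funext hr').symm) (by rw [zero_add]; exact (funext hs').symm)
      (by rw [zero_add]; exact fun x => h.abs_le_left hk hM (by rw [hr]; exact hrN) hmem x)
      (by rw [zero_add]; exact fun x => h.abs_le_right hk hM (by rw [hs]; exact hsN) hmem x)
      (t := t - t₀) ⟨by linarith [ht.1], by linarith [ht.2]⟩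
    simpa using this
  set R : ℝ → ℝ → ℝ := fun t => if t < T then r t else r' (t - t₀) with hR
  set S : ℝ → ℝ → ℝ := fun t => if t < T then s t else s' (t - t₀) with hS
  have hlt : ∀ t < T, R t = r t ∧ S t = s t := fun t ht => by simp [hR, hS, ht]
  -- The pieces agree on the overlap [t₀, T). Around any time t ≥ T the glued function is therefore
  -- the restarted solution on a full relative neighbourhood.
  have hge : ∀ t, t₀ ≤ t → R t = r' (t - t₀) ∧ S t = s' (t - t₀) := by
    intro t ht
    by_cases htT : t < T
    · rw [(hlt t htT).1, (hlt t htT).2]; exact hagree t ⟨ht, htT⟩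
    · simp [hR, hS, htT]
  refine ⟨t₀ + T₀, hT₀', R, S, diagSol_iff.2 fun t ht x => ?_, ⟨2 * M, fun t ht x => ?_⟩, ?_, ?_⟩
  · by_cases htT : t < T
    · refine (diagSol_iff.1 h t ⟨ht.1, htT⟩ x).congr (slab_mem_nhdsWithin htT) (mem_slab.2 ht) ?_
      filter_upwards [slab_mem_nhdsWithin htT] with z hz
      exact hlt z.1 hz.1.2
    · have htt : t₀ < t := ht₀T.trans_le (not_lt.1 htT)
      have h1 := diagSol_iff.1 hrs' (t - t₀) ⟨by linarith, by linarith [ht.2]⟩ x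
      have hnear : ∀ᶠ z : ℝ × ℝ in 𝓝[slab (t₀ + T₀)] (t, x), t₀ < z.1 :=
        mem_nhdsWithin_of_mem_nhds ((isOpen_lt continuous_const continuous_fst).mem_nhds htt)
      refine h1.shift.congr ?_ (mem_slab.2 ht) ?_
      · filter_upwards [hnear, self_mem_nhdsWithin] with z hz hz'
        exact ⟨⟨by simpa using hz.le, by have := hz'.1.2; simp only; linarith⟩, mem_univ _⟩
      · filter_upwards [hnear] with z hz
        exact hge z.1 hz.le
  · by_cases htT : t < T
    · rw [dx_congr (hlt t htT).1, dx_congr (hlt t htT).2]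
      have := hM t ⟨ht.1, htT⟩ x
      exact ⟨by linarith [this.1], by linarith [this.2]⟩
    · have htt : t₀ < t := ht₀T.trans_le (not_lt.1 htT)
      have h1 := hM' (t - t₀) ⟨by linarith, by linarith [ht.2]⟩ x
      rw [dx_congr (g := fun t => r' (t - t₀)) (hge t htt.le).1,
        dx_congr (g := fun t => s' (t - t₀)) (hge t htt.le).2]
      exact h1
  · rw [(hlt 0 hT).1, hr]
  · rw [(hlt 0 hT).2, hs]

end QuasilinearWave

namespace QuasilinearWave

/-! ### Truncation of the wave speed -/

/-- `a` is an extension of the wave speed `c` from `[-δ, δ]` to the real line, `L` its primitive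
vanishing at `0`, and `G` the inverse function of `L`. -/
structure SpeedExtension (U : Set ℝ) (c : ℝ → ℝ) (δ : ℝ) (a L G : ℝ → ℝ) (K : ℝ) : Prop where
  pos : 0 < δ
  subset : ∀ θ, |θ| ≤ δ → θ ∈ U
  eq : ∀ θ, |θ| ≤ δ → a θ = c θ
  deriv_eq : ∀ θ, |θ| ≤ δ → deriv a θ = deriv c θ
  near_one : ∀ θ, |a θ - 1| ≤ 1 / 100
  contDiff : ContDiff ℝ 1 a
  hasDerivAt : ∀ w, HasDerivAt L (a w) w
  map_zero : L 0 = 0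
  left_inv : ∀ w, G (L w) = w
  right_inv : ∀ q, L (G q) = q
  hasDerivAt_inv : ∀ q, HasDerivAt G (a (G q))⁻¹ q
  speed : IsSpeed (a ∘ G) K

/-- The speed is composed with a map χ that is the identity near 0, takes values near 0, and
vanishes far away. Then c ∘ χ is C¹, close to 1, and equal to 1 outside a compact set, so its
derivative is bounded. -/
theorem exists_extension {U : Set ℝ} (hU : IsOpen U) (h0U : (0 : ℝ) ∈ U) {c : ℝ → ℝ}
    (hc0 : c 0 = 1) (hc : ContDiffOn ℝ 1 c U) :
    ∃ (δ : ℝ) (a : ℝ → ℝ), 0 < δ ∧ (∀ θ, |θ| ≤ δ → θ ∈ U) ∧ (∀ θ, |θ| ≤ δ → a θ = c θ) ∧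
      (∀ θ, |θ| ≤ δ → deriv a θ = deriv c θ) ∧ (∀ θ, |a θ - 1| ≤ 1 / 100) ∧ ContDiff ℝ 1 a ∧
      ∃ D, ∀ θ, |deriv a θ| ≤ D := by
  have hcont : ContinuousAt c 0 := (hc.continuousOn).continuousAt (hU.mem_nhds h0U)
  have h1 : ∀ᶠ θ in 𝓝 (0 : ℝ), θ ∈ U ∧ |c θ - 1| ≤ 1 / 100 := by
    refine Filter.Eventually.and (hU.mem_nhds h0U) ?_
    have := Metric.continuousAt_iff.1 hcont (1 / 100) (by norm_num)
    obtain ⟨ε, hε, h⟩ := this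
    filter_upwards [Metric.ball_mem_nhds 0 hε] with θ hθ
    have := h hθ
    rw [Real.dist_eq, hc0] at this
    exact this.le
  obtain ⟨ρ, hρ, hball⟩ := Metric.eventually_nhds_iff.1 h1
  have hδ : 0 < ρ / 4 := by positivity
  set δ := ρ / 4 with hδdef
  -- The inner radius 2δ exceeds δ so that the derivatives also agree at ±δ; the outer radius 3δ < ρ
  -- keeps χ in the good ball.
  let b : ContDiffBump (0 : ℝ) := ⟨2 * δ, 3 * δ, by positivity, by linarith⟩
  set χ : ℝ → ℝ := fun θ => b θ * θ with hχ
  have hχc : ContDiff ℝ 1 χ := b.contDiff.mul contDiff_id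
  have hχball : ∀ θ, |χ θ| < ρ := by
    intro θ
    by_cases h : dist θ 0 < 3 * δ
    · rw [hχ, abs_mul, abs_of_nonneg b.nonneg]
      rw [Real.dist_eq, sub_zero] at h
      have := mul_le_mul_of_nonneg_right (b.le_one (x := θ)) (abs_nonneg θ)
      linarith
    · have : b θ = 0 := b.zero_of_le_dist (not_lt.1 h)
      simp only [hχ, this, zero_mul, abs_zero]; exact hρ
  have hχU : ∀ θ, χ θ ∈ U ∧ |c (χ θ) - 1| ≤ 1 / 100 := fun θ =>
    hball (by rw [Real.dist_eq, sub_zero]; exact hχball θ)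
  have hχid : ∀ θ, |θ| < 2 * δ → χ θ = θ := by
    intro θ hθ
    have : b θ = 1 := b.one_of_mem_closedBall (by
      rw [Metric.mem_closedBall, Real.dist_eq, sub_zero]; exact hθ.le)
    simp [hχ, this]
  have hac : ContDiff ℝ 1 (c ∘ χ) := by
    rw [← contDiffOn_univ]
    exact hc.comp hχc.contDiffOn fun θ _ => (hχU θ).1
  refine ⟨δ, c ∘ χ, hδ, fun θ hθ => ?_, fun θ hθ => ?_, fun θ hθ => ?_, fun θ => (hχU θ).2, hac, ?_⟩
  · have := (hχU θ).1
    rwa [hχid θ (by linarith)] at this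
  · rw [Function.comp, hχid θ (by linarith)]
  · refine Filter.EventuallyEq.deriv_eq ?_
    have : ∀ᶠ y in 𝓝 θ, |y| < 2 * δ :=
      continuous_abs.continuousAt.eventually_lt_const (by linarith)
    filter_upwards [this] with y hy
    rw [Function.comp, hχid y hy]
  · have hsupp : HasCompactSupport (fun θ => (c ∘ χ) θ - 1) := by
      refine HasCompactSupport.intro (isCompact_closedBall (0 : ℝ) (3 * δ)) fun θ hθ => ?_
      have : b θ = 0 := b.zero_of_le_dist (by
        rw [Metric.mem_closedBall, not_le] at hθ; exact hθ.le)
      simp [hχ, this, hc0]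
    obtain ⟨D, hD⟩ := (hsupp.deriv).exists_bound_of_continuous
      ((hac.sub contDiff_const).continuous_deriv le_rfl)
    refine ⟨D, fun θ => ?_⟩
    have := hD θ
    rwa [deriv_sub_const, Real.norm_eq_abs] at this

theorem exists_speedExtension {U : Set ℝ} (hU : IsOpen U) (h0U : (0 : ℝ) ∈ U) {c : ℝ → ℝ}
    (hc0 : c 0 = 1) (hc : ContDiffOn ℝ 1 c U) :
    ∃ δ a L G K, SpeedExtension U c δ a L G K := by
  obtain ⟨δ, a, hδ, hsub, heq, hdeq, hone, hac, D, hD⟩ := exists_extension hU h0U hc0 hc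
  have hlow : ∀ θ, 99 / 100 ≤ a θ := fun θ => by linarith [(abs_le.1 (hone θ)).1]
  set L : ℝ → ℝ := fun w => ∫ θ in (0 : ℝ)..w, a θ with hL
  have hLd : ∀ w, HasDerivAt L (a w) w := fun w =>
    (hac.continuous.integral_hasStrictDerivAt 0 w).hasDerivAt
  have hmono : StrictMono L := strictMono_of_deriv_pos fun w => by
    rw [(hLd w).deriv]; linarith [hlow w]
  have hd : ∀ w, HasDerivAt (fun w => L w - 99 / 100 * w) (a w - 99 / 100 * 1) w :=
    fun w => (hLd w).sub ((hasDerivAt_id w).const_mul (99 / 100))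
  -- Comparison with a line of slope 99/100 gives the limits of L at ±∞, hence surjectivity.
  have hmono' : Monotone fun w => L w - 99 / 100 * w :=
    monotone_of_deriv_nonneg (fun w => (hd w).differentiableAt) fun w => by
      rw [(hd w).deriv]; linarith [hlow w]
  have hL0 : L 0 = 0 := by simp [hL]
  have hsurj : Function.Surjective L := by
    refine Continuous.surjective (continuous_iff_continuousAt.2 fun w => (hLd w).continuousAt) ?_ ?_
    · refine tendsto_atTop_mono' _ ?_
        ((tendsto_id (α := ℝ)).const_mul_atTop (by norm_num : (0 : ℝ) < 99 / 100))
      filter_upwards [eventually_ge_atTop 0] with w hw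
      have := hmono' hw
      simp only [hL0, mul_zero, sub_zero, id] at this ⊢
      linarith
    · refine tendsto_atBot_mono' _ ?_
        ((tendsto_id (α := ℝ)).const_mul_atBot (by norm_num : (0 : ℝ) < 99 / 100))
      filter_upwards [eventually_le_atBot 0] with w hw
      have := hmono' hw
      simp only [hL0, mul_zero, sub_zero, id] at this ⊢
      linarith
  set e := hmono.orderIsoOfSurjective L hsurj with he
  have hleft : ∀ w, e.symm (L w) = w := fun w => e.symm_apply_apply w
  have hright : ∀ q, L (e.symm q) = q := fun q => e.apply_symm_apply q
  have hGd : ∀ q, HasDerivAt e.symm (a (e.symm q))⁻¹ q := fun q =>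
    HasDerivAt.of_local_left_inverse e.symm.continuous.continuousAt (hLd _)
      (by linarith [hlow (e.symm q)]) (Eventually.of_forall hright)
  have hapos : ∀ θ, 0 < a θ := fun θ => by linarith [hlow θ]
  have hkd : ∀ q, HasDerivAt (a ∘ e.symm) (deriv a (e.symm q) * (a (e.symm q))⁻¹) q := fun q =>
    ((hac.differentiable one_ne_zero _).hasDerivAt).comp q (hGd q)
  refine ⟨δ, a, L, e.symm, 2 * D, hδ, hsub, heq, hdeq, hone, hac, hLd, hL0, hleft, hright, hGd,
    ?_, fun q => hone _, fun q => ?_⟩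
  · refine contDiff_one_iff_deriv.2 ⟨fun q => (hkd q).differentiableAt, ?_⟩
    rw [funext fun q => (hkd q).deriv]
    refine ((hac.continuous_deriv le_rfl).comp e.symm.continuous).mul
      ((hac.continuous.comp e.symm.continuous).inv₀ fun q => (hapos _).ne')
  · rw [(hkd q).deriv, abs_mul]
    have h1 : |(a (e.symm q))⁻¹| ≤ 2 := by
      rw [abs_inv, abs_of_pos (hapos _)]
      exact inv_le_of_inv_le₀ (by norm_num) (by linarith [hlow (e.symm q)])
    have h2 := hD (e.symm q)
    have := mul_le_mul h2 h1 (abs_nonneg _) ((abs_nonneg _).trans h2)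
    linarith

namespace SpeedExtension

variable {U : Set ℝ} {c : ℝ → ℝ} {δ : ℝ} {a L G : ℝ → ℝ} {K : ℝ}

theorem lower (h : SpeedExtension U c δ a L G K) (θ : ℝ) : 99 / 100 ≤ a θ := by
  linarith [(abs_le.1 (h.near_one θ)).1]

theorem upper (h : SpeedExtension U c δ a L G K) (θ : ℝ) : a θ ≤ 101 / 100 := by
  linarith [(abs_le.1 (h.near_one θ)).2]

theorem apos (h : SpeedExtension U c δ a L G K) (θ : ℝ) : 0 < a θ := by linarith [h.lower θ]

theorem deriv_speed (h : SpeedExtension U c δ a L G K) (q : ℝ) :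
    deriv (a ∘ G) q = deriv a (G q) / a (G q) :=
  (((h.contDiff.differentiable one_ne_zero _).hasDerivAt).comp q (h.hasDerivAt_inv q)).deriv

theorem abs_sub_le (h : SpeedExtension U c δ a L G K) (w : ℝ) : |L w - w| ≤ 1 / 100 * |w| := by
  have := convex_univ.norm_image_sub_le_of_norm_hasDerivWithin_le (f := fun w => L w - w)
    (f' := fun w => a w - 1) (C := 1 / 100) (x := 0) (y := w)
    (fun x _ => ((h.hasDerivAt x).sub (hasDerivAt_id x)).hasDerivWithinAt)
    (fun x _ => h.near_one x) (mem_univ _) (mem_univ _)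
  simpa [h.map_zero] using this

theorem abs_map_le (h : SpeedExtension U c δ a L G K) (w : ℝ) : |L w| ≤ 101 / 100 * |w| := by
  have h1 := h.abs_sub_le w
  have h2 : |L w| ≤ |L w - w| + |w| := by simpa using abs_add_le (L w - w) w
  linarith

theorem le_abs_map (h : SpeedExtension U c δ a L G K) (w : ℝ) : 99 / 100 * |w| ≤ |L w| := by
  have h1 := h.abs_sub_le w
  have h2 : |w| ≤ |L w - w| + |L w| := by
    have := abs_add_le (-(L w - w)) (L w)
    rw [abs_neg] at this
    simpa using this
  linarith

theorem contDiff_map (h : SpeedExtension U c δ a L G K) : ContDiff ℝ 1 L :=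
  contDiff_one_iff_deriv.2 ⟨fun w => (h.hasDerivAt w).differentiableAt, by
    rw [funext fun w => (h.hasDerivAt w).deriv]; exact h.contDiff.continuous⟩

theorem abs_inv_le (h : SpeedExtension U c δ a L G K) (q : ℝ) : |G q| ≤ 100 / 99 * |q| := by
  have := h.le_abs_map (G q)
  rw [h.right_inv] at this
  linarith

end SpeedExtension

end QuasilinearWave

namespace QuasilinearWave

/-! ### Calculus on slabs -/

theorem uniqueDiffOn_slab (T : ℝ) : UniqueDiffOn ℝ (slab T) :=
  (uniqueDiffOn_Ico 0 T).prod uniqueDiffOn_univ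

theorem eq_form (A : ℝ × ℝ →L[ℝ] ℝ) : A = form (A (1, 0)) (A (0, 1)) := by
  ext <;> simp

section

variable {R : ℝ → ℝ → ℝ} {T t x : ℝ} {A : ℝ × ℝ →L[ℝ] ℝ}

theorem dt_eq_of_hasFDerivWithinAt (ht : t ∈ Ico 0 T)
    (h : HasFDerivWithinAt (fun z : ℝ × ℝ => R z.1 z.2) A (slab T) (t, x)) :
    dt R t x = A (1, 0) := by
  have h1 : HasDerivWithinAt (fun s : ℝ => (s, x)) ((1 : ℝ), (0 : ℝ)) (Ico 0 T) t :=
    (hasDerivWithinAt_id t _).prodMk (hasDerivWithinAt_const t _ x)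
  have h2 := HasFDerivWithinAt.comp_hasDerivWithinAt t h h1 (fun y hy => mem_slab.2 hy)
  have h3 : Ico 0 T ∈ 𝓝[Ici 0] t := by
    rw [← Ici_inter_Iio]
    exact inter_mem self_mem_nhdsWithin (mem_nhdsWithin_of_mem_nhds (Iio_mem_nhds ht.2))
  exact (h2.mono_of_mem_nhdsWithin h3).derivWithin (uniqueDiffOn_Ici 0 t ht.1)

theorem dx_eq_of_hasFDerivWithinAt (ht : t ∈ Ico 0 T)
    (h : HasFDerivWithinAt (fun z : ℝ × ℝ => R z.1 z.2) A (slab T) (t, x)) :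
    dx R t x = A (0, 1) := by
  rw [eq_form A] at h
  exact (hasDerivAt_of_hasFDerivWithinAt_slab ht h).deriv

theorem contDiffOn_slab_succ {n : ℕ} {F : ℝ × ℝ → ℝ} {a b : ℝ × ℝ → ℝ}
    (hF : ∀ z ∈ slab T, HasFDerivWithinAt F (form (a z) (b z)) (slab T) z)
    (ha : ContDiffOn ℝ n a (slab T)) (hb : ContDiffOn ℝ n b (slab T)) :
    ContDiffOn ℝ (n + 1) F (slab T) := by
  rw [contDiffOn_succ_iff_fderivWithin (uniqueDiffOn_slab T)]
  refine ⟨fun z hz => (hF z hz).differentiableWithinAt, fun h => by simp at h, ?_⟩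
  have : ContDiffOn ℝ n (fun z => form (a z) (b z)) (slab T) := by
    unfold form
    exact (ha.smul contDiffOn_const).add (hb.smul contDiffOn_const)
  exact this.congr fun z hz => (hF z hz).fderivWithin (uniqueDiffOn_slab T z hz)

end

/-- First order partial derivatives of a `C^2` function on a slab. -/
theorem contDiffOn_two_slab {u : ℝ → ℝ → ℝ} {T : ℝ}
    (h : ContDiffOn ℝ 2 (fun z : ℝ × ℝ => u z.1 z.2) (slab T)) :
    (∀ t ∈ Ico 0 T, ∀ x, HasFDerivWithinAt (fun z : ℝ × ℝ => dt u z.1 z.2)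
      (form (dt (dt u) t x) (dx (dt u) t x)) (slab T) (t, x)) ∧
    (∀ t ∈ Ico 0 T, ∀ x, HasFDerivWithinAt (fun z : ℝ × ℝ => dx u z.1 z.2)
      (form (dx (dt u) t x) (dx (dx u) t x)) (slab T) (t, x)) ∧
    ContinuousOn (fun z : ℝ × ℝ => dx (dt u) z.1 z.2) (slab T) ∧
    ContinuousOn (fun z : ℝ × ℝ => dx (dx u) z.1 z.2) (slab T) := by
  set F : ℝ × ℝ → ℝ := fun z => u z.1 z.2 with hF
  have h1 : ContDiffOn ℝ 1 (fderivWithin ℝ F (slab T)) (slab T) :=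
    h.fderivWithin (uniqueDiffOn_slab T) (by norm_num [one_add_one_eq_two])
  set F' := fderivWithin ℝ F (slab T) with hF'
  have hdF : ∀ z ∈ slab T, HasFDerivWithinAt F (F' z) (slab T) z := fun z hz =>
    (h.differentiableOn (by norm_num) z hz).hasFDerivWithinAt
  have hdt : ∀ z ∈ slab T, dt u z.1 z.2 = F' z (1, 0) := fun z hz =>
    dt_eq_of_hasFDerivWithinAt hz.1 (hdF z hz)
  have hdx : ∀ z ∈ slab T, dx u z.1 z.2 = F' z (0, 1) := fun z hz =>
    dx_eq_of_hasFDerivWithinAt hz.1 (hdF z hz)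
  set F'' := fderivWithin ℝ F' (slab T) with hF''
  have hd2 : ∀ z ∈ slab T, HasFDerivWithinAt F' (F'' z) (slab T) z := fun z hz =>
    (h1.differentiableOn one_ne_zero z hz).hasFDerivWithinAt
  have hc2 : ContinuousOn F'' (slab T) :=
    h1.continuousOn_fderivWithin (uniqueDiffOn_slab T) le_rfl
  have hv : ∀ z ∈ slab T, HasFDerivWithinAt (fun z : ℝ × ℝ => dt u z.1 z.2)
      ((F'' z).flip (1, 0)) (slab T) z := fun z hz =>
    ((hd2 z hz).clm_apply (hasFDerivWithinAt_const ((1 : ℝ), (0 : ℝ)) z _)).congr_fderiv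
      (by ext <;> simp) |>.congr hdt (hdt z hz)
  have hw : ∀ z ∈ slab T, HasFDerivWithinAt (fun z : ℝ × ℝ => dx u z.1 z.2)
      ((F'' z).flip (0, 1)) (slab T) z := fun z hz =>
    ((hd2 z hz).clm_apply (hasFDerivWithinAt_const ((0 : ℝ), (1 : ℝ)) z _)).congr_fderiv
      (by ext <;> simp) |>.congr hdx (hdx z hz)
  -- Symmetry holds up to t = 0 because the slab lies in the closure of its interior.
  have hsymm : ∀ z ∈ slab T, F'' z (1, 0) (0, 1) = F'' z (0, 1) (1, 0) := by
    intro z hz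
    have hT : (0 : ℝ) < T := hz.1.1.trans_lt hz.1.2
    refine ContDiffWithinAt.isSymmSndFDerivWithinAt (h z hz) (by simp) (uniqueDiffOn_slab T) ?_ hz
      _ _
    rw [slab, interior_prod_eq, interior_univ, interior_Ico, closure_prod_eq, closure_univ,
      closure_Ioo hT.ne]
    exact ⟨Ico_subset_Icc_self hz.1, mem_univ _⟩
  have htt : ∀ z ∈ slab T, dt (dt u) z.1 z.2 = F'' z (1, 0) (1, 0) := fun z hz =>
    dt_eq_of_hasFDerivWithinAt hz.1 (A := (F'' z).flip (1, 0)) (hv z hz)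
  have hxt : ∀ z ∈ slab T, dx (dt u) z.1 z.2 = F'' z (0, 1) (1, 0) := fun z hz =>
    dx_eq_of_hasFDerivWithinAt hz.1 (A := (F'' z).flip (1, 0)) (hv z hz)
  have hxx : ∀ z ∈ slab T, dx (dx u) z.1 z.2 = F'' z (0, 1) (0, 1) := fun z hz =>
    dx_eq_of_hasFDerivWithinAt hz.1 (A := (F'' z).flip (0, 1)) (hw z hz)
  refine ⟨fun t ht x => ?_, fun t ht x => ?_, ?_, ?_⟩
  · have hz : (t, x) ∈ slab T := mem_slab.2 ht
    refine (hv (t, x) hz).congr_fderiv ?_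
    rw [eq_form ((F'' (t, x)).flip (1, 0)), htt _ hz, hxt _ hz]; rfl
  · have hz : (t, x) ∈ slab T := mem_slab.2 ht
    refine (hw (t, x) hz).congr_fderiv ?_
    rw [eq_form ((F'' (t, x)).flip (0, 1)), hxt _ hz, hxx _ hz, ← hsymm _ hz]; rfl
  · exact ((hc2.clm_apply continuousOn_const).clm_apply continuousOn_const).congr hxt
  · exact ((hc2.clm_apply continuousOn_const).clm_apply continuousOn_const).congr hxx

/-- Differentiability of a time integral, up to the boundary `t = 0`. -/
theorem hasFDerivWithinAt_timeIntegral {v vx : ℝ → ℝ → ℝ} {f f' : ℝ → ℝ} {T : ℝ}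
    (hv : ContinuousOn (fun z : ℝ × ℝ => v z.1 z.2) (slab T))
    (hvx : ContinuousOn (fun z : ℝ × ℝ => vx z.1 z.2) (slab T))
    (hd : ∀ t ∈ Ico 0 T, ∀ x, HasDerivAt (v t) (vx t x) x)
    (hf : ∀ x, HasDerivAt f (f' x) x) (hf' : Continuous f') {t : ℝ} (ht : t ∈ Ico 0 T) (x : ℝ) :
    HasFDerivWithinAt (fun z : ℝ × ℝ => f z.2 + ∫ τ in (0 : ℝ)..z.1, v τ z.2)
      (form (v t x) (f' x + ∫ τ in (0 : ℝ)..t, vx τ x)) (slab T) (t, x) := by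
  obtain ⟨t₁, htt₁, ht₁⟩ := exists_between ht.2
  have h01 : 0 ≤ t₁ := ht.1.trans htt₁.le
  -- Clamping time to [0, t₁] gives integrands continuous on the whole plane, and two-sided calculus
  -- applies. Since t < t₁, nothing changes near (t, x) inside the slab.
  set π : ℝ → ℝ := fun τ => max 0 (min τ t₁) with hπ
  have hπc : Continuous π := by fun_prop
  have hπm : ∀ τ, π τ ∈ Ico 0 T := fun τ =>
    ⟨le_max_left _ _, (max_le h01 (min_le_right _ _)).trans_lt ht₁⟩
  have hπid : ∀ τ ∈ Icc 0 t₁, π τ = τ := fun τ hτ => by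
    rw [hπ]; simp only [min_eq_left hτ.2, max_eq_right hτ.1]
  have hV : Continuous fun z : ℝ × ℝ => v (π z.1) z.2 := by
    rw [← continuousOn_univ]
    exact hv.comp (f := fun z : ℝ × ℝ => (π z.1, z.2)) (by fun_prop)
      (fun z _ => mem_slab.2 (hπm z.1))
  have hVx : Continuous fun z : ℝ × ℝ => vx (π z.1) z.2 := by
    rw [← continuousOn_univ]
    exact hvx.comp (f := fun z : ℝ × ℝ => (π z.1, z.2)) (by fun_prop)
      (fun z _ => mem_slab.2 (hπm z.1))
  have hVy : ∀ y, Continuous fun τ => v (π τ) y := fun y =>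
    hV.comp (by fun_prop : Continuous fun τ : ℝ => (τ, y))
  have hVxy : ∀ y, Continuous fun τ => vx (π τ) y := fun y =>
    hVx.comp (by fun_prop : Continuous fun τ : ℝ => (τ, y))
  have d1 : ∀ z : ℝ × ℝ, HasDerivAt (fun s => f z.2 + ∫ τ in (0 : ℝ)..s, v (π τ) z.2)
      (v (π z.1) z.2) z.1 := fun z =>
    ((hVy z.2).integral_hasStrictDerivAt 0 z.1).hasDerivAt.const_add _
  have d2 : ∀ z : ℝ × ℝ, HasDerivAt (fun y => f y + ∫ τ in (0 : ℝ)..z.1, v (π τ) y)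
      (f' z.2 + ∫ τ in (0 : ℝ)..z.1, vx (π τ) z.2) z.2 := by
    intro z
    obtain ⟨D, hD⟩ := ((isCompact_uIcc (a := (0 : ℝ)) (b := z.1)).prod
      (isCompact_closedBall z.2 1)).exists_bound_of_continuousOn hVx.continuousOn
    refine (hf z.2).add (intervalIntegral.hasDerivAt_integral_of_dominated_loc_of_deriv_le
        (F := fun y τ => v (π τ) y) (F' := fun y τ => vx (π τ) y) (bound := fun _ => D)
        (Metric.ball_mem_nhds z.2 one_pos)
        (Eventually.of_forall fun y => (hVy y).aestronglyMeasurable)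
        ((hVy z.2).intervalIntegrable _ _) (hVxy z.2).aestronglyMeasurable
        (Eventually.of_forall fun τ hτ y hy => ?_) intervalIntegrable_const
        (Eventually.of_forall fun τ hτ y hy => hd _ (hπm τ) y)).2
    exact hD (τ, y) ⟨uIoc_subset_uIcc hτ, Metric.ball_subset_closedBall hy⟩
  have hW : Continuous fun z : ℝ × ℝ => f' z.2 + ∫ τ in (0 : ℝ)..z.1, vx (π τ) z.2 := by
    refine (hf'.comp continuous_snd).add ?_
    exact intervalIntegral.continuous_parametric_intervalIntegral_of_continuous
      (f := fun (z : ℝ × ℝ) τ => vx (π τ) z.2)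
      (hVx.comp (by fun_prop : Continuous fun p : (ℝ × ℝ) × ℝ => (p.2, p.1.2))) continuous_fst
  have key := hasStrictFDerivAt_uncurry_coprod (𝕜 := ℝ) (u := (t, x))
    (f := fun s y => f y + ∫ τ in (0 : ℝ)..s, v (π τ) y)
    (f₁ := fun s y => ContinuousLinearMap.toSpanSingleton ℝ (v (π s) y))
    (f₂ := fun s y => ContinuousLinearMap.toSpanSingleton ℝ
      (f' y + ∫ τ in (0 : ℝ)..s, vx (π τ) y))
    (Eventually.of_forall fun w => (d1 w).hasFDerivAt)
    (Eventually.of_forall fun w => (d2 w).hasFDerivAt)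
    (((ContinuousLinearMap.toSpanSingletonCLE (𝕜 := ℝ) (E := ℝ)).continuous).comp hV).continuousAt
    (((ContinuousLinearMap.toSpanSingletonCLE (𝕜 := ℝ) (E := ℝ)).continuous).comp hW).continuousAt
  have hint : ∀ {g : ℝ → ℝ → ℝ} (s : ℝ) (y : ℝ), s ∈ Icc 0 t₁ →
      ∫ τ in (0 : ℝ)..s, g (π τ) y = ∫ τ in (0 : ℝ)..s, g τ y := by
    intro g s y hs
    refine intervalIntegral.integral_congr fun τ hτ => ?_
    rw [uIcc_of_le hs.1] at hτ
    simp only [hπid τ ⟨hτ.1, hτ.2.trans hs.2⟩]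
  have htm : t ∈ Icc 0 t₁ := ⟨ht.1, htt₁.le⟩
  have key2 : HasFDerivAt (fun z : ℝ × ℝ => f z.2 + ∫ τ in (0 : ℝ)..z.1, v (π τ) z.2)
      (form (v t x) (f' x + ∫ τ in (0 : ℝ)..t, vx τ x)) (t, x) := by
    refine key.hasFDerivAt.congr_fderiv ?_
    ext <;> simp [Function.HasUncurry.uncurry, hπid t htm, hint t x htm]
  refine key2.hasFDerivWithinAt.congr_of_eventuallyEq ?_ ?_
  · filter_upwards [slab_mem_nhdsWithin htt₁] with z hz
    rw [hint z.1 z.2 (Ico_subset_Icc_self hz.1)]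
  · simp only [hint t x htm]

end QuasilinearWave

namespace QuasilinearWave

/-! ### Riemann invariants -/

variable {U : Set ℝ} {c : ℝ → ℝ} {δ : ℝ} {a L G : ℝ → ℝ} {K : ℝ}

theorem IsClassicalSolution.mono {f g : ℝ → ℝ} {T T' : ℝ} {u : ℝ → ℝ → ℝ}
    (h : IsClassicalSolution c U f g T u) (hT : T' ≤ T) : IsClassicalSolution c U f g T' u where
  contDiffOn := h.contDiffOn.mono (slab_mono hT)
  dx_mem t ht := h.dx_mem t ⟨ht.1, ht.2.trans_le hT⟩
  equation t ht := h.equation t ⟨ht.1, ht.2.trans_le hT⟩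
  initial := h.initial
  initial_dt := h.initial_dt

/-- The Riemann invariants of a classical solution solve the diagonal system. -/
theorem IsClassicalSolution.diagSol (E : SpeedExtension U c δ a L G K) {f g : ℝ → ℝ} {T : ℝ}
    {u : ℝ → ℝ → ℝ} (h : IsClassicalSolution c U f g T u)
    (hδ : ∀ t ∈ Ico 0 T, ∀ x, |dx u t x| ≤ δ) :
    DiagSol (a ∘ G) T (fun t x => dt u t x + L (dx u t x)) (fun t x => dt u t x - L (dx u t x)) ∧
    ∀ t ∈ Ico 0 T, ∀ x,
      dx (fun t x => dt u t x + L (dx u t x)) t x =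
        dx (dt u) t x + a (dx u t x) * dx (dx u) t x ∧
      dx (fun t x => dt u t x - L (dx u t x)) t x =
        dx (dt u) t x - a (dx u t x) * dx (dx u) t x := by
  obtain ⟨hv, hw, hvx, hwx⟩ := contDiffOn_two_slab h.contDiffOn
  have hLw : ∀ t ∈ Ico 0 T, ∀ x, HasFDerivWithinAt (fun z : ℝ × ℝ => L (dx u z.1 z.2))
      (form (a (dx u t x) * dx (dt u) t x) (a (dx u t x) * dx (dx u) t x)) (slab T) (t, x) := by
    intro t ht x
    have := (E.hasDerivAt (dx u t x)).comp_hasFDerivWithinAt (t, x) (hw t ht x)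
    refine this.congr_fderiv ?_
    ext <;> simp
  have hr : ∀ t ∈ Ico 0 T, ∀ x, HasFDerivWithinAt
      (fun z : ℝ × ℝ => dt u z.1 z.2 + L (dx u z.1 z.2))
      (form (dt (dt u) t x + a (dx u t x) * dx (dt u) t x)
        (dx (dt u) t x + a (dx u t x) * dx (dx u) t x)) (slab T) (t, x) := fun t ht x =>
    ((hv t ht x).add (hLw t ht x)).congr_fderiv (by ext <;> simp)
  have hs : ∀ t ∈ Ico 0 T, ∀ x, HasFDerivWithinAt
      (fun z : ℝ × ℝ => dt u z.1 z.2 - L (dx u z.1 z.2))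
      (form (dt (dt u) t x - a (dx u t x) * dx (dt u) t x)
        (dx (dt u) t x - a (dx u t x) * dx (dx u) t x)) (slab T) (t, x) := fun t ht x =>
    ((hv t ht x).sub (hLw t ht x)).congr_fderiv (by ext <;> simp)
  have hdr : ∀ t ∈ Ico 0 T, ∀ x, dx (fun t x => dt u t x + L (dx u t x)) t x =
      dx (dt u) t x + a (dx u t x) * dx (dx u) t x := fun t ht x =>
    (dx_eq_of_hasFDerivWithinAt (R := fun t x => dt u t x + L (dx u t x)) ht (hr t ht x)).trans
      (by simp)
  have hds : ∀ t ∈ Ico 0 T, ∀ x, dx (fun t x => dt u t x - L (dx u t x)) t x =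
      dx (dt u) t x - a (dx u t x) * dx (dx u) t x := fun t ht x =>
    (dx_eq_of_hasFDerivWithinAt (R := fun t x => dt u t x - L (dx u t x)) ht (hs t ht x)).trans
      (by simp)
  have hk : ∀ t x, (a ∘ G) ((dt u t x + L (dx u t x) - (dt u t x - L (dx u t x))) / 2) =
      a (dx u t x) := fun t x => by
    have : (dt u t x + L (dx u t x) - (dt u t x - L (dx u t x))) / 2 = L (dx u t x) := by ring
    rw [this, Function.comp, E.left_inv]
  have heq : ∀ t ∈ Ico 0 T, ∀ x, dt (dt u) t x = a (dx u t x) ^ 2 * dx (dx u) t x := by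
    intro t ht x
    rw [E.eq _ (hδ t ht x)]
    exact sub_eq_zero.1 (h.equation t ht x)
  have hac : ContinuousOn (fun z : ℝ × ℝ => a (dx u z.1 z.2)) (slab T) :=
    E.contDiff.continuous.comp_continuousOn
      (fun z hz => (hw z.1 hz.1 z.2).continuousWithinAt)
  refine ⟨⟨fun t ht x => ?_, fun t ht x => ?_, ?_, ?_⟩, fun t ht x => ⟨hdr t ht x, hds t ht x⟩⟩
  · rw [hk, hdr t ht x]
    refine (hr t ht x).congr_fderiv ?_
    rw [heq t ht x]; congr 1; ring
  · rw [hk, hds t ht x]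
    refine (hs t ht x).congr_fderiv ?_
    rw [heq t ht x]; congr 1; ring
  · exact (hvx.add (hac.mul hwx)).congr fun z hz => hdr z.1 hz.1 z.2
  · exact (hvx.sub (hac.mul hwx)).congr fun z hz => hds z.1 hz.1 z.2

theorem IsClassicalSolution.gradientBound (E : SpeedExtension U c δ a L G K) {f g : ℝ → ℝ}
    {T B : ℝ} {u : ℝ → ℝ → ℝ} (h : IsClassicalSolution c U f g T u)
    (hδ : ∀ t ∈ Ico 0 T, ∀ x, |dx u t x| ≤ δ)
    (hB : ∀ t ∈ Ico 0 T, ∀ x, |dx (dt u) t x| ≤ B ∧ |dx (dx u) t x| ≤ B) :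
    GradientBound T (fun t x => dt u t x + L (dx u t x)) (fun t x => dt u t x - L (dx u t x))
      (3 * B) := by
  intro t ht x
  obtain ⟨e1, e2⟩ := (h.diagSol E hδ).2 t ht x
  obtain ⟨b1, b2⟩ := hB t ht x
  have h1 : |a (dx u t x) * dx (dx u) t x| ≤ 2 * B := by
    rw [abs_mul, abs_of_pos (E.apos _)]
    exact mul_le_mul (by linarith [E.upper (dx u t x)]) b2 (abs_nonneg _) (by norm_num)
  rw [e1, e2]
  rw [abs_le] at b1 h1
  constructor <;> rw [abs_le] <;> constructor <;> linarith [b1.1, b1.2, h1.1, h1.2]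

/-- Solutions with small data and bounded second derivatives have small `u_x`. -/
theorem IsClassicalSolution.abs_dx_le (E : SpeedExtension U c δ a L G K) {f g : ℝ → ℝ}
    {T B : ℝ} {u : ℝ → ℝ → ℝ} (h : IsClassicalSolution c U f g T u)
    (hB : ∀ t ∈ Ico 0 T, ∀ x, |dx (dt u) t x| ≤ B ∧ |dx (dx u) t x| ≤ B)
    (hr : ∀ x, |g x + L (deriv f x)| ≤ δ / 4) (hs : ∀ x, |g x - L (deriv f x)| ≤ δ / 4) :
    ∀ t ∈ Ico 0 T, ∀ x, |dx u t x| ≤ δ := by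
  intro t ht
  have hB0 : 0 ≤ B := (abs_nonneg _).trans (hB t ht 0).1
  have hδ0 := E.pos
  have hL : ∀ w, |L w| ≤ δ / 4 → |w| ≤ δ / 2 := fun w hw => by linarith [E.le_abs_map w]
  have h0 : ∀ x, |dx u 0 x| ≤ δ / 2 := by
    intro x
    have e : dx u 0 x = deriv f x := by
      simp only [dx, h.initial]
    rw [e]
    refine hL _ ?_
    have h1 := abs_le.1 (hr x)
    have h2 := abs_le.1 (hs x)
    rw [abs_le]; constructor <;> linarith [h1.1, h1.2, h2.1, h2.2]
  have htime : ∀ t ∈ Ico 0 T, ∀ t' ∈ Icc 0 t, ∀ x, |dx u t x - dx u t' x| ≤ B * (t - t') := by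
    intro t ht t' ht' x
    have hd : ∀ τ ∈ Icc 0 t, HasDerivWithinAt (fun τ => dx u τ x) (dx (dt u) τ x) (Icc 0 t) τ := by
      intro τ hτ
      have := hasDerivWithinAt_along (R := dx u) (γ := fun _ => x) (b := 0) ht.2
        ((contDiffOn_two_slab h.contDiffOn).2.1 τ ⟨hτ.1, hτ.2.trans_lt ht.2⟩ x)
        (hasDerivWithinAt_const τ _ x)
      simpa using this
    have := (convex_Icc 0 t).norm_image_sub_le_of_norm_hasDerivWithin_le hd
      (fun τ hτ => (hB τ ⟨hτ.1, hτ.2.trans_lt ht.2⟩ x).1) ht' (right_mem_Icc.2 ht.1)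
    simpa [abs_of_nonneg (sub_nonneg.2 ht'.2)] using this
  -- Time step of a bootstrap. If |u_x| ≤ δ up to nη, the speeds agree there and transport of r and
  -- s improves the bound to δ/2 before nη. During a further time 3η/2, u_x moves by at most 3Bη/2 ≤
  -- δ/2.
  set η := δ / (3 * (B + 1)) with hη
  have hη0 : 0 < η := by positivity
  have hBη : B * (3 / 2 * η) ≤ δ / 2 := by
    have : B * (3 / 2 * η) = δ / 2 * (B / (B + 1)) := by rw [hη]; field_simp
    rw [this]
    have : B / (B + 1) ≤ 1 := by rw [div_le_one (by linarith)]; linarith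
    nlinarith
  have key : ∀ n : ℕ, ∀ t ∈ Ico 0 T, t ≤ n * η → ∀ x, |dx u t x| ≤ δ := by
    intro n
    induction n with
    | zero =>
      intro t ht hn x
      have : t = 0 := le_antisymm (by simpa using hn) ht.1
      rw [this]; linarith [h0 x]
    | succ n ih =>
      intro t ht hn x
      have hhalf : ∀ t' ∈ Icc 0 t, t' < n * η → |dx u t' x| ≤ δ / 2 := by
        intro t' ht' hlt
        set T' := min (n * η) T with hT'
        have hm : T' ≤ T := min_le_right _ _
        have hδ' : ∀ τ ∈ Ico 0 T', ∀ y, |dx u τ y| ≤ δ := fun τ hτ y =>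
          ih τ ⟨hτ.1, hτ.2.trans_le hm⟩ (hτ.2.le.trans (min_le_left _ _)) y
        have hB' : ∀ τ ∈ Ico 0 T', ∀ y, |dx (dt u) τ y| ≤ B ∧ |dx (dx u) τ y| ≤ B :=
          fun τ hτ y => hB τ ⟨hτ.1, hτ.2.trans_le hm⟩ y
        have hsol := ((h.mono hm).diagSol E hδ').1
        have hgb := (h.mono hm).gradientBound E hδ' hB'
        have htm : t' ∈ Ico 0 T' := ⟨ht'.1, lt_min hlt (ht'.2.trans_lt ht.2)⟩
        have e0 : ∀ y, dx u 0 y = deriv f y := fun y => by simp only [dx, h.initial]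
        have h1 := abs_le.1 (hsol.abs_le_left E.speed hgb (N := δ / 4)
          (fun y => by rw [h.initial_dt, e0]; exact hr y) htm x)
        have h2 := abs_le.1 (hsol.abs_le_right E.speed hgb (N := δ / 4)
          (fun y => by rw [h.initial_dt, e0]; exact hs y) htm x)
        refine hL _ ?_
        rw [abs_le]; constructor <;> linarith [h1.1, h1.2, h2.1, h2.2]
      have hn' : t ≤ n * η + η := by push_cast at hn; linarith
      -- Going back by 3η/2 instead of η lands strictly before nη, as required by half-open time
      -- intervals.
      have main : ∃ t' ∈ Icc 0 t, t - t' ≤ 3 / 2 * η ∧ |dx u t' x| ≤ δ / 2 := by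
        rcases le_or_gt t (3 / 2 * η) with h3 | h3
        · exact ⟨0, ⟨le_rfl, ht.1⟩, by linarith, h0 x⟩
        · have hm : t - 3 / 2 * η ∈ Icc 0 t := ⟨by linarith, by linarith⟩
          exact ⟨t - 3 / 2 * η, hm, by linarith, hhalf _ hm (by linarith)⟩
      obtain ⟨t', ht', h3, h4⟩ := main
      have h5 := htime t ht t' ht' x
      have h6 := mul_le_mul_of_nonneg_left h3 hB0
      have h7 := abs_add_le (dx u t x - dx u t' x) (dx u t' x)
      rw [sub_add_cancel] at h7
      linarith
  obtain ⟨n, hn⟩ := exists_nat_ge (t / η)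
  exact key n t ht ((div_le_iff₀ hη0).1 hn)

/-- A solution of the diagonal system yields a classical solution of the wave equation. -/
theorem exists_isClassicalSolution (E : SpeedExtension U c δ a L G K) {f g : ℝ → ℝ}
    (hf : ContDiff ℝ 1 f) {T : ℝ} (hT : 0 < T) {r s : ℝ → ℝ → ℝ} (h : DiagSol (a ∘ G) T r s)
    (hr : r 0 = fun x => g x + L (deriv f x)) (hs : s 0 = fun x => g x - L (deriv f x))
    (hb : ∀ t ∈ Ico 0 T, ∀ x, |r t x| ≤ δ / 4 ∧ |s t x| ≤ δ / 4) :
    ∃ u, IsClassicalSolution c U f g T u ∧ ∀ t ∈ Ico 0 T, ∀ x,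
      u t x = f x + (∫ τ in (0 : ℝ)..t, (r τ x + s τ x) / 2) ∧
      dt u t x = (r t x + s t x) / 2 ∧ dx u t x = G ((r t x - s t x) / 2) ∧
      |dx u t x| ≤ δ ∧
      dt (dt u) t x = a (dx u t x) * ((dx r t x - dx s t x) / 2) ∧
      dx (dt u) t x = (dx r t x + dx s t x) / 2 ∧
      dx (dx u) t x = (a (dx u t x))⁻¹ * ((dx r t x - dx s t x) / 2) := by
  set v : ℝ → ℝ → ℝ := fun t x => (r t x + s t x) / 2 with hv
  set vx : ℝ → ℝ → ℝ := fun t x => (dx r t x + dx s t x) / 2 with hvx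
  set w : ℝ → ℝ → ℝ := fun t x => G ((r t x - s t x) / 2) with hw
  set wx : ℝ → ℝ → ℝ := fun t x => (a (w t x))⁻¹ * ((dx r t x - dx s t x) / 2) with hwx
  set vt : ℝ → ℝ → ℝ := fun t x => a (w t x) * ((dx r t x - dx s t x) / 2) with hvt
  have hGc : Continuous G := continuous_iff_continuousAt.2 fun q => (E.hasDerivAt_inv q).continuousAt
  have hvc : ContinuousOn (fun z : ℝ × ℝ => v z.1 z.2) (slab T) :=
    (h.continuousOn_r.add h.continuousOn_s).div_const 2
  have hvxc : ContinuousOn (fun z : ℝ × ℝ => vx z.1 z.2) (slab T) :=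
    (h.continuous_left.add h.continuous_right).div_const 2
  have hwc : ContinuousOn (fun z : ℝ × ℝ => w z.1 z.2) (slab T) :=
    hGc.comp_continuousOn ((h.continuousOn_r.sub h.continuousOn_s).div_const 2)
  have hac : ContinuousOn (fun z : ℝ × ℝ => a (w z.1 z.2)) (slab T) :=
    E.contDiff.continuous.comp_continuousOn hwc
  have hwxc : ContinuousOn (fun z : ℝ × ℝ => wx z.1 z.2) (slab T) :=
    (hac.inv₀ fun z _ => (E.apos _).ne').mul
      ((h.continuous_left.sub h.continuous_right).div_const 2)
  have hvtc : ContinuousOn (fun z : ℝ × ℝ => vt z.1 z.2) (slab T) :=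
    hac.mul ((h.continuous_left.sub h.continuous_right).div_const 2)
  have hvd : ∀ t ∈ Ico 0 T, ∀ x, HasFDerivWithinAt (fun z : ℝ × ℝ => v z.1 z.2)
      (form (vt t x) (vx t x)) (slab T) (t, x) := by
    intro t ht x
    have := ((h.left t ht x).add (h.right t ht x)).const_smul (2⁻¹ : ℝ)
    refine (this.congr_fderiv ?_).congr (fun z _ => ?_) ?_
    · ext <;> simp [hvt, hvx, hw] <;> ring
    · simp [hv]; ring
    · simp [hv]; ring
  have hwd : ∀ t ∈ Ico 0 T, ∀ x, HasFDerivWithinAt (fun z : ℝ × ℝ => w z.1 z.2)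
      (form (vx t x) (wx t x)) (slab T) (t, x) := by
    intro t ht x
    have e1 := ((h.left t ht x).sub (h.right t ht x)).const_smul (2⁻¹ : ℝ)
    have e2 : HasFDerivWithinAt (fun z : ℝ × ℝ => (r z.1 z.2 - s z.1 z.2) / 2) _ (slab T) (t, x) :=
      e1.congr (fun z _ => by simp; ring) (by simp; ring)
    refine ((E.hasDerivAt_inv _).comp_hasFDerivWithinAt (t, x) e2).congr_fderiv ?_
    have hne := (E.apos (G ((r t x - s t x) / 2))).ne'
    ext
    · simp [hvx]; field_simp
    · simp [hwx, hw]; left; ring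
  have hf1 : ∀ x, HasDerivAt f (deriv f x) x :=
    fun x => (hf.differentiable one_ne_zero x).hasDerivAt
  have hw0 : ∀ x, w 0 x = deriv f x := by
    intro x
    have : (r 0 x - s 0 x) / 2 = L (deriv f x) := by rw [hr, hs]; ring
    simp only [hw, this, E.left_inv]
  -- The compatibility w_t = v_x: integrating v_x in time from w(0) = f' recovers w, so the function
  -- u obtained by integrating v in time has u_x = w.
  have hint : ∀ t ∈ Ico 0 T, ∀ x, deriv f x + ∫ τ in (0 : ℝ)..t, vx τ x = w t x := by
    intro t ht x
    have hd : ∀ τ ∈ Icc 0 t, HasDerivWithinAt (fun τ => w τ x) (vx τ x) (Icc 0 t) τ := by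
      intro τ hτ
      have := hasDerivWithinAt_along (R := w) (γ := fun _ => x) (b := 0) ht.2
        (hwd τ ⟨hτ.1, hτ.2.trans_lt ht.2⟩ x) (hasDerivWithinAt_const τ _ x)
      simpa using this
    have hc : ContinuousOn (fun τ => vx τ x) (Icc 0 t) :=
      hvxc.comp (f := fun τ => (τ, x)) (by fun_prop)
        (fun τ hτ => mem_slab.2 ⟨hτ.1, hτ.2.trans_lt ht.2⟩)
    rw [intervalIntegral.integral_eq_sub_of_hasDerivAt_of_le ht.1
      (fun τ hτ => (hd τ hτ).continuousWithinAt)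
      (fun τ hτ => (hd τ (Ioo_subset_Icc_self hτ)).hasDerivAt (Icc_mem_nhds hτ.1 hτ.2))
      (hc.intervalIntegrable_of_Icc ht.1), hw0]
    ring
  set u : ℝ → ℝ → ℝ := fun t x => f x + ∫ τ in (0 : ℝ)..t, v τ x with hu
  have hud : ∀ t ∈ Ico 0 T, ∀ x, HasFDerivWithinAt (fun z : ℝ × ℝ => u z.1 z.2)
      (form (v t x) (w t x)) (slab T) (t, x) := by
    intro t ht x
    have := hasFDerivWithinAt_timeIntegral hvc hvxc
      (fun t ht x => hasDerivAt_of_hasFDerivWithinAt_slab ht (hvd t ht x)) hf1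
      (hf.continuous_deriv le_rfl) ht x
    rwa [hint t ht x] at this
  have hdt : ∀ t ∈ Ico 0 T, ∀ x, dt u t x = v t x := fun t ht x =>
    (dt_eq_of_hasFDerivWithinAt ht (hud t ht x)).trans (by simp)
  have hdx : ∀ t ∈ Ico 0 T, ∀ x, dx u t x = w t x := fun t ht x =>
    (dx_eq_of_hasFDerivWithinAt ht (hud t ht x)).trans (by simp)
  have hdtd : ∀ t ∈ Ico 0 T, ∀ x, HasFDerivWithinAt (fun z : ℝ × ℝ => dt u z.1 z.2)
      (form (vt t x) (vx t x)) (slab T) (t, x) := fun t ht x =>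
    (hvd t ht x).congr (fun z hz => hdt z.1 hz.1 z.2) (hdt t ht x)
  have hdxd : ∀ t ∈ Ico 0 T, ∀ x, HasFDerivWithinAt (fun z : ℝ × ℝ => dx u z.1 z.2)
      (form (vx t x) (wx t x)) (slab T) (t, x) := fun t ht x =>
    (hwd t ht x).congr (fun z hz => hdx z.1 hz.1 z.2) (hdx t ht x)
  have hdtt : ∀ t ∈ Ico 0 T, ∀ x, dt (dt u) t x = vt t x := fun t ht x =>
    (dt_eq_of_hasFDerivWithinAt ht (hdtd t ht x)).trans (by simp)
  have hdxt : ∀ t ∈ Ico 0 T, ∀ x, dx (dt u) t x = vx t x := fun t ht x =>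
    (dx_eq_of_hasFDerivWithinAt ht (hdtd t ht x)).trans (by simp)
  have hdxx : ∀ t ∈ Ico 0 T, ∀ x, dx (dx u) t x = wx t x := fun t ht x =>
    (dx_eq_of_hasFDerivWithinAt ht (hdxd t ht x)).trans (by simp)
  have hwδ : ∀ t ∈ Ico 0 T, ∀ x, |w t x| ≤ δ := by
    intro t ht x
    have h1 := abs_le.1 (hb t ht x).1
    have h2 := abs_le.1 (hb t ht x).2
    have h3 : |(r t x - s t x) / 2| ≤ δ / 4 := by
      rw [abs_le]; constructor <;> linarith [h1.1, h1.2, h2.1, h2.2]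
    have h4 := E.abs_inv_le ((r t x - s t x) / 2)
    have := E.pos
    simp only [hw]; linarith
  have hv1 : ContDiffOn ℝ 1 (fun z : ℝ × ℝ => v z.1 z.2) (slab T) := by
    have := contDiffOn_slab_succ (n := 0) (F := fun z : ℝ × ℝ => v z.1 z.2)
      (a := fun z => vt z.1 z.2) (b := fun z => vx z.1 z.2)
      (fun z hz => hvd z.1 hz.1 z.2) (contDiffOn_zero.2 hvtc) (contDiffOn_zero.2 hvxc)
    simpa using this
  have hw1 : ContDiffOn ℝ 1 (fun z : ℝ × ℝ => w z.1 z.2) (slab T) := by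
    have := contDiffOn_slab_succ (n := 0) (F := fun z : ℝ × ℝ => w z.1 z.2)
      (a := fun z => vx z.1 z.2) (b := fun z => wx z.1 z.2)
      (fun z hz => hwd z.1 hz.1 z.2) (contDiffOn_zero.2 hvxc) (contDiffOn_zero.2 hwxc)
    simpa using this
  have hu2 : ContDiffOn ℝ 2 (fun z : ℝ × ℝ => u z.1 z.2) (slab T) := by
    have := contDiffOn_slab_succ (n := 1) (F := fun z : ℝ × ℝ => u z.1 z.2)
      (a := fun z => v z.1 z.2) (b := fun z => w z.1 z.2)
      (fun z hz => hud z.1 hz.1 z.2) (by simpa using hv1) (by simpa using hw1)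
    simpa [one_add_one_eq_two] using this
  refine ⟨u, ⟨hu2, fun t ht x => ?_, fun t ht x => ?_, fun x => by simp [hu], fun x => ?_⟩,
    fun t ht x => ⟨rfl, hdt t ht x, hdx t ht x, ?_, ?_, hdxt t ht x, ?_⟩⟩
  · rw [hdx t ht x]; exact E.subset _ (hwδ t ht x)
  · rw [hdtt t ht x, hdxx t ht x, hdx t ht x, ← E.eq _ (hwδ t ht x)]
    have hne := (E.apos (w t x)).ne'
    simp only [hvt, hwx]
    field_simp
    ring
  · rw [hdt 0 ⟨le_rfl, hT⟩ x]
    simp only [hv, hr, hs]; ring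
  · rw [hdx t ht x]; exact hwδ t ht x
  · rw [hdtt t ht x, hdx t ht x]
  · rw [hdxx t ht x, hdx t ht x]

end QuasilinearWave

namespace QuasilinearWave

/-! ### Norms -/

theorem supNorm_le {f : ℝ → ℝ} {B : ℝ} (h : ∀ x, |f x| ≤ B) : supNorm f ≤ ENNReal.ofReal B :=
  iSup_le fun x => by
    rw [Real.enorm_eq_ofReal_abs]; exact ENNReal.ofReal_le_ofReal (h x)

theorem abs_le_of_supNorm_le {f : ℝ → ℝ} {C : ℝ≥0∞} (hC : C ≠ ∞) (h : supNorm f ≤ C) (x : ℝ) :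
    |f x| ≤ C.toReal := by
  have h1 : ‖f x‖ₑ ≤ C := (le_iSup (fun x => ‖f x‖ₑ) x).trans h
  rw [Real.enorm_eq_ofReal_abs] at h1
  exact (ENNReal.ofReal_le_iff_le_toReal hC).1 h1

theorem abs_le_of_second_norms {u : ℝ → ℝ → ℝ} {t : ℝ} {C : ℝ≥0∞} (hC : C ≠ ∞)
    (h : supNorm (dx (dt u) t) + supNorm (dx (dx u) t) ≤ C) (x : ℝ) :
    |dx (dt u) t x| ≤ C.toReal ∧ |dx (dx u) t x| ≤ C.toReal :=
  ⟨abs_le_of_supNorm_le hC (le_self_add.trans h) x,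
    abs_le_of_supNorm_le hC (le_add_self.trans h) x⟩

theorem exists_bound_of_iSup_totalNorm {c : ℝ → ℝ} {u : ℝ → ℝ → ℝ} {T : ℝ}
    (h : ⨆ t ∈ Ico 0 T, totalNorm c u t < ∞) :
    ∃ B, ∀ t ∈ Ico 0 T, ∀ x, |dx (dt u) t x| ≤ B ∧ |dx (dx u) t x| ≤ B := by
  refine ⟨(⨆ t ∈ Ico 0 T, totalNorm c u t).toReal, fun t ht x => ?_⟩
  refine abs_le_of_second_norms h.ne ?_ x
  refine le_trans ?_ (le_iSup₂ (f := fun t (_ : t ∈ Ico 0 T) => totalNorm c u t) t ht)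
  unfold totalNorm
  refine le_trans ?_ le_self_add
  gcongr
  exact le_add_self

theorem totalNorm_le {c : ℝ → ℝ} {u : ℝ → ℝ → ℝ} {t B : ℝ} (h0 : ∀ x, |u t x| ≤ B)
    (h1 : ∀ x, |dt u t x| ≤ B) (h2 : ∀ x, |dx u t x| ≤ B) (h3 : ∀ x, |dt (dt u) t x| ≤ B)
    (h4 : ∀ x, |dx (dt u) t x| ≤ B) (h5 : ∀ x, |dx (dx u) t x| ≤ B)
    (h6 : ∀ x, 1 / 2 ≤ c (dx u t x)) : totalNorm c u t ≤ 6 * ENNReal.ofReal B + 2 := by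
  have h7 : ⨆ x, ‖c (dx u t x)‖ₑ⁻¹ ≤ 2 := iSup_le fun x => by
    rw [Real.enorm_eq_ofReal_abs, ENNReal.inv_le_iff_inv_le]
    have : (2 : ℝ≥0∞)⁻¹ = ENNReal.ofReal (1 / 2) := by
      rw [one_div, ENNReal.ofReal_inv_of_pos two_pos]; simp
    rw [this]
    exact ENNReal.ofReal_le_ofReal ((h6 x).trans (le_abs_self _))
  have e : 6 * ENNReal.ofReal B + 2 = ENNReal.ofReal B + ENNReal.ofReal B + ENNReal.ofReal B +
      ENNReal.ofReal B + ENNReal.ofReal B + ENNReal.ofReal B + 2 := by ring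
  rw [e]
  unfold totalNorm
  gcongr
  exacts [supNorm_le h0, supNorm_le h1, supNorm_le h2, supNorm_le h3, supNorm_le h4, supNorm_le h5]

/-! ### The lifespan -/

/-- Smooth bounded data whose Riemann invariants are small compared to `δ`. -/
structure SmallData (L : ℝ → ℝ) (δ : ℝ) (f g : ℝ → ℝ) : Prop where
  contDiff_f : ContDiff ℝ 2 f
  contDiff_g : ContDiff ℝ 1 g
  bound_f : ∃ B, ∀ x, |f x| ≤ B
  bound_deriv : ∃ B, ∀ x, |deriv (deriv f) x| ≤ B ∧ |deriv g x| ≤ B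
  left : ∀ x, |g x + L (deriv f x)| ≤ δ / 4
  right : ∀ x, |g x - L (deriv f x)| ≤ δ / 4

variable {U : Set ℝ} {c : ℝ → ℝ} {δ : ℝ} {a L G : ℝ → ℝ} {K : ℝ} {f g : ℝ → ℝ}

theorem contDiff_one_deriv (hf : ContDiff ℝ 2 f) : ContDiff ℝ 1 (deriv f) := by
  have : ContDiff ℝ (1 + 1) f := by rwa [one_add_one_eq_two]
  exact (contDiff_succ_iff_deriv.1 this).2.2

namespace SmallData

theorem contDiff_left (E : SpeedExtension U c δ a L G K) (D : SmallData L δ f g) :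
    ContDiff ℝ 1 (fun x => g x + L (deriv f x)) :=
  D.contDiff_g.add (E.contDiff_map.comp (contDiff_one_deriv D.contDiff_f))

theorem contDiff_right (E : SpeedExtension U c δ a L G K) (D : SmallData L δ f g) :
    ContDiff ℝ 1 (fun x => g x - L (deriv f x)) :=
  D.contDiff_g.sub (E.contDiff_map.comp (contDiff_one_deriv D.contDiff_f))

theorem exists_local (E : SpeedExtension U c δ a L G K) (D : SmallData L δ f g) :
    ∃ T > 0, HasDiagSol (a ∘ G) (fun x => g x + L (deriv f x)) (fun x => g x - L (deriv f x)) T := by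
  obtain ⟨B, hB⟩ := D.bound_deriv
  have hB0 : 0 ≤ B := (abs_nonneg _).trans (hB 0).1
  have hg : ∀ x, HasDerivAt g (deriv g x) x :=
    fun x => (D.contDiff_g.differentiable one_ne_zero x).hasDerivAt
  have hL : ∀ x, HasDerivAt (fun x => L (deriv f x)) (a (deriv f x) * deriv (deriv f) x) x :=
    fun x => (E.hasDerivAt _).comp x
      (((contDiff_one_deriv D.contDiff_f).differentiable one_ne_zero x).hasDerivAt)
  have hadd : ∀ x, HasDerivAt (fun x => g x + L (deriv f x))
      (deriv g x + a (deriv f x) * deriv (deriv f) x) x := fun x => (hg x).add (hL x)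
  have hsub : ∀ x, HasDerivAt (fun x => g x - L (deriv f x))
      (deriv g x - a (deriv f x) * deriv (deriv f) x) x := fun x => (hg x).sub (hL x)
  have hb : ∀ x, |a (deriv f x) * deriv (deriv f) x| ≤ 2 * B := fun x => by
    rw [abs_mul, abs_of_pos (E.apos _)]
    exact mul_le_mul (by linarith [E.upper (deriv f x)]) (hB x).1 (abs_nonneg _) (by norm_num)
  obtain ⟨T, hT, h⟩ := exists_local_diagSol E.speed (M := 3 * B) (by positivity)
  obtain ⟨r, s, hrs, hM, hr, hs⟩ := h _ _ (D.contDiff_left E) (D.contDiff_right E)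
    (fun x => by
      rw [(hadd x).deriv]
      have h1 := abs_le.1 (hb x)
      have h2 := abs_le.1 (hB x).2
      rw [abs_le]; constructor <;> linarith [h1.1, h1.2, h2.1, h2.2])
    (fun x => by
      rw [(hsub x).deriv]
      have h1 := abs_le.1 (hb x)
      have h2 := abs_le.1 (hB x).2
      rw [abs_le]; constructor <;> linarith [h1.1, h1.2, h2.1, h2.2])
  exact ⟨T, hT, r, s, hrs, ⟨_, hM⟩, funext hr, funext hs⟩

/-- Bounded second derivatives confine u_x to [-δ, δ], where the original and extended speeds
coincide, so the Riemann invariants solve the extended system. -/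
theorem diag_of_bound (E : SpeedExtension U c δ a L G K) (D : SmallData L δ f g) {T B : ℝ}
    {u : ℝ → ℝ → ℝ} (h : IsClassicalSolution c U f g T u)
    (hB : ∀ t ∈ Ico 0 T, ∀ x, |dx (dt u) t x| ≤ B ∧ |dx (dx u) t x| ≤ B) :
    ∃ r s, DiagSol (a ∘ G) T r s ∧ GradientBound T r s (3 * B) ∧
      (r 0 = fun x => g x + L (deriv f x)) ∧ s 0 = fun x => g x - L (deriv f x) := by
  have hδ := h.abs_dx_le E hB D.left D.right
  have e0 : ∀ y, dx u 0 y = deriv f y := fun y => by simp only [dx, h.initial]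
  exact ⟨_, _, (h.diagSol E hδ).1, h.gradientBound E hδ hB,
    funext fun x => by simp only [h.initial_dt, e0], funext fun x => by simp only [h.initial_dt, e0]⟩

/-- The classical solution constructed from a solution of the diagonal system has bounded norms as
long as the gradient is bounded. -/
theorem exists_solution (E : SpeedExtension U c δ a L G K) (D : SmallData L δ f g) {T : ℝ}
    (hT : 0 < T) {r s : ℝ → ℝ → ℝ} (h : DiagSol (a ∘ G) T r s)
    (hr : r 0 = fun x => g x + L (deriv f x)) (hs : s 0 = fun x => g x - L (deriv f x))
    (hM : ∀ T' < T, ∃ M, GradientBound T' r s M) :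
    ∃ u, IsClassicalSolution c U f g T u ∧ ∀ T' ≤ T, ∀ M, GradientBound T' r s M →
      ⨆ t ∈ Ico 0 T', totalNorm c u t < ∞ := by
  have hb : ∀ t ∈ Ico 0 T, ∀ x, |r t x| ≤ δ / 4 ∧ |s t x| ≤ δ / 4 := by
    intro t ht x
    obtain ⟨T', htT', hT'⟩ := exists_between ht.2
    obtain ⟨M, hM⟩ := hM T' hT'
    have h' := h.mono hT'.le
    exact ⟨h'.abs_le_left E.speed hM (by rw [hr]; exact D.left) ⟨ht.1, htT'⟩ x,
      h'.abs_le_right E.speed hM (by rw [hs]; exact D.right) ⟨ht.1, htT'⟩ x⟩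
  obtain ⟨u, hu, hform⟩ :=
    exists_isClassicalSolution E (D.contDiff_f.of_le one_le_two) hT h hr hs hb
  refine ⟨u, hu, fun T' hT' M hM' => ?_⟩
  obtain ⟨B₀, hB₀⟩ := D.bound_f
  have hδ := E.pos
  -- The term Tδ bounds the time integral of u_t, δ bounds u_t and u_x, and 2|M| bounds the second
  -- derivatives.
  set B := B₀ + T * δ + δ + 2 * |M| with hB
  have hB00 : 0 ≤ B₀ := (abs_nonneg _).trans (hB₀ 0)
  have hTδ : 0 ≤ T * δ := by positivity
  have hM0 : 0 ≤ |M| := abs_nonneg M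
  refine lt_of_le_of_lt (b := 6 * ENNReal.ofReal B + 2) (iSup₂_le fun t ht => ?_) ?_
  · have htT : t ∈ Ico 0 T := ⟨ht.1, ht.2.trans_le hT'⟩
    have hdiff : ∀ x, |(dx r t x - dx s t x) / 2| ≤ |M| ∧ |(dx r t x + dx s t x) / 2| ≤ |M| := by
      intro x
      have h1 := abs_le.1 ((hM' t ht x).1.trans (le_abs_self M))
      have h2 := abs_le.1 ((hM' t ht x).2.trans (le_abs_self M))
      constructor <;> rw [abs_le] <;> constructor <;> linarith [h1.1, h1.2, h2.1, h2.2]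
    have hvb : ∀ τ ∈ Ico 0 T, ∀ x, |(r τ x + s τ x) / 2| ≤ δ := by
      intro τ hτ x
      have h1 := abs_le.1 (hb τ hτ x).1
      have h2 := abs_le.1 (hb τ hτ x).2
      rw [abs_le]; constructor <;> linarith [h1.1, h1.2, h2.1, h2.2]
    refine totalNorm_le (fun x => ?_) (fun x => ?_) (fun x => ?_) (fun x => ?_) (fun x => ?_)
      (fun x => ?_) (fun x => ?_) <;> obtain ⟨e0, e1, e2, e3, e4, e5, e6⟩ := hform t htT x
    · rw [e0]
      have h1 : ‖∫ τ in (0 : ℝ)..t, (r τ x + s τ x) / 2‖ ≤ δ * |t - 0| := by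
        refine intervalIntegral.norm_integral_le_of_norm_le_const fun τ hτ => ?_
        rw [uIoc_of_le ht.1] at hτ
        exact hvb τ ⟨hτ.1.le, hτ.2.trans_lt htT.2⟩ x
      rw [Real.norm_eq_abs, sub_zero, abs_of_nonneg ht.1] at h1
      have h2 := mul_le_mul_of_nonneg_left htT.2.le hδ.le
      have h3 := abs_add_le (f x) (∫ τ in (0 : ℝ)..t, (r τ x + s τ x) / 2)
      linarith [hB₀ x]
    · rw [e1]; linarith [hvb t htT x]
    · linarith
    · rw [e4, abs_mul, abs_of_pos (E.apos _)]
      have := mul_le_mul (by linarith [E.upper (dx u t x)] : a (dx u t x) ≤ 2) (hdiff x).1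
        (abs_nonneg _) (by norm_num)
      linarith
    · rw [e5]; linarith [(hdiff x).2]
    · rw [e6, abs_mul, abs_of_pos (inv_pos.2 (E.apos _))]
      have h1 : (a (dx u t x))⁻¹ ≤ 2 :=
        inv_le_of_inv_le₀ (by norm_num) (by linarith [E.lower (dx u t x)])
      have := mul_le_mul h1 (hdiff x).1 (abs_nonneg _) (by norm_num)
      linarith
    · rw [← E.eq _ e3]; linarith [E.lower (dx u t x)]
  · exact ENNReal.add_lt_top.2 ⟨ENNReal.mul_lt_top (by norm_num) ENNReal.ofReal_lt_top, by norm_num⟩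

/-- For small data the extension of the speed changes nothing, and the lifespan can be studied on
the diagonal system. -/
theorem hasDiagSol_iff (E : SpeedExtension U c δ a L G K) (D : SmallData L δ f g) {T : ℝ}
    (hT : 0 < T) :
    HasDiagSol (a ∘ G) (fun x => g x + L (deriv f x)) (fun x => g x - L (deriv f x)) T ↔
      ∃ u, IsBoundedSolution c U f g T u := by
  constructor
  · rintro ⟨r, s, h, ⟨M, hM⟩, hr, hs⟩
    obtain ⟨u, hu, hb⟩ := D.exists_solution E hT h hr hs (fun T' hT' => ⟨M, hM.mono hT'.le⟩)
    exact ⟨u, hu, hb T le_rfl M hM⟩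
  · rintro ⟨u, hu, hb⟩
    obtain ⟨B, hB⟩ := exists_bound_of_iSup_totalNorm hb
    obtain ⟨r, s, h, hM, hr, hs⟩ := D.diag_of_bound E hu hB
    exact ⟨r, s, h, ⟨_, hM⟩, hr, hs⟩

/-- If the times of existence are bounded, the lifespan is attained by a solution, and second
derivatives blow up. -/
theorem exists_lifespan (E : SpeedExtension U c δ a L G K) (D : SmallData L δ f g) {B : ℝ}
    (hB : ∀ T, 0 < T →
      HasDiagSol (a ∘ G) (fun x => g x + L (deriv f x)) (fun x => g x - L (deriv f x)) T → T ≤ B) :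
    ∃ T, IsLifespan c U f g T ∧ T ≤ B ∧ (∃ u, IsSolutionUpTo c U f g T u) ∧
      ∀ u, IsSolutionUpTo c U f g T u → SecondDerivativesBlowUp T u := by
  set S : Set ℝ := {T' : ℝ | 0 < T' ∧ ∃ u, IsBoundedSolution c U f g T' u} with hS
  have hmem : ∀ T, 0 < T → (T ∈ S ↔ HasDiagSol (a ∘ G) (fun x => g x + L (deriv f x))
      (fun x => g x - L (deriv f x)) T) := fun T hT => by
    rw [D.hasDiagSol_iff E hT]
    exact ⟨fun h => h.2, fun h => ⟨hT, h⟩⟩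
  obtain ⟨T₀, hT₀, hloc⟩ := D.exists_local E
  have hne : S.Nonempty := ⟨T₀, (hmem T₀ hT₀).2 hloc⟩
  have hub : B ∈ upperBounds S := fun T hT => hB T hT.1 ((hmem T hT.1).1 hT)
  have hlub : IsLUB S (sSup S) := isLUB_csSup hne ⟨B, hub⟩
  set T := sSup S with hTdef
  have hT : 0 < T := hT₀.trans_le (hlub.1 ((hmem T₀ hT₀).2 hloc))
  have hlt : ∀ T' < T, 0 < T' → HasDiagSol (a ∘ G) (fun x => g x + L (deriv f x))
      (fun x => g x - L (deriv f x)) T' := by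
    intro T' hT' _
    obtain ⟨T'', hT'', hlt⟩ := exists_lt_of_lt_csSup hne hT'
    obtain ⟨r, s, h, ⟨M, hM⟩, hr, hs⟩ := (hmem T'' hT''.1).1 hT''
    exact ⟨r, s, h.mono hlt.le, ⟨M, hM.mono hlt.le⟩, hr, hs⟩
  refine ⟨T, hlub, hlub.2 hub, ?_, fun u hu => ?_⟩
  · obtain ⟨r, s, h, hM, hr, hs⟩ := exists_diagSol_of_forall_lt E.speed D.left D.right hT hlt
    obtain ⟨u, hu, hb⟩ := D.exists_solution E hT h hr hs hM
    refine ⟨u, hu, fun T' hT' => ?_⟩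
    obtain ⟨M, hM⟩ := hM T' hT'
    exact hb T' hT'.le M hM
  -- A finite limsup bounds the second derivatives near T, and being a solution up to T bounds them
  -- earlier. The gradients are then bounded on [0, T), and continuation contradicts the choice of T
  -- as supremum.
  · by_contra hcon
    obtain ⟨C, hC1, hC2⟩ := exists_between (lt_top_iff_ne_top.2 hcon)
    have hev := eventually_lt_of_limsup_lt hC1
    obtain ⟨t₁, ht₁, hev⟩ := (mem_nhdsLT_iff_exists_Ioo_subset' hT).1 hev
    obtain ⟨t₂, ht₁₂, ht₂⟩ := exists_between (show t₁ < T from ht₁)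
    obtain ⟨B₁, hB₁⟩ := exists_bound_of_iSup_totalNorm (hu.2 t₂ ht₂)
    have hbound : ∀ t ∈ Ico 0 T, ∀ x, |dx (dt u) t x| ≤ max B₁ C.toReal ∧
        |dx (dx u) t x| ≤ max B₁ C.toReal := by
      intro t ht x
      rcases lt_or_ge t t₂ with h | h
      · have := hB₁ t ⟨ht.1, h⟩ x
        exact ⟨this.1.trans (le_max_left _ _), this.2.trans (le_max_left _ _)⟩
      · have := abs_le_of_second_norms hC2.ne (le_of_lt (hev ⟨ht₁₂.trans_le h, ht.2⟩)) x
        exact ⟨this.1.trans (le_max_right _ _), this.2.trans (le_max_right _ _)⟩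
    obtain ⟨r, s, h, hM, hr, hs⟩ := D.diag_of_bound E hu.1 hbound
    obtain ⟨T', hT', hsol⟩ := exists_gt_hasDiagSol E.speed D.left D.right hT h hM hr hs
    exact absurd (hlub.1 ((hmem T' (hT.trans hT')).2 hsol)) (not_le.2 hT')

end SmallData

end QuasilinearWave

namespace QuasilinearWave

/-! ### The rate of blow-up -/

/-- Upper bound for the time of existence for data of size `ε`, when `k'` degenerates at most
like `|q|^(p - 2)`. -/
theorem DiagSol.time_le_rpow {k : ℝ → ℝ} {K T M : ℝ} {r s : ℝ → ℝ → ℝ} (h : DiagSol k T r s)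
    (hk : IsSpeed k K) (hM : GradientBound T r s M) {p κ ρ m X x₁ ε : ℝ} (hp : 2 ≤ p) (hκ : 0 < κ)
    (hkl : ∀ q, |q| ≤ ρ → κ * |q| ^ (p - 2) ≤ deriv k q) (hm : 0 < m) (hε : 0 < ε) (hε1 : ε ≤ 1)
    (hr : ∀ x, |r 0 x| ≤ ρ) (hs : ∀ x, |s 0 x| ≤ ρ) (h1 : m * ε ≤ dx r 0 x₁)
    (h2 : 2 * (m * ε) ≤ |r 0 x₁|) (h3 : ∀ x ≤ -X, |s 0 x| ≤ m * ε) :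
    T ≤ (|x₁ + X| + 4 / (κ * (m / 2) ^ (p - 2) * m)) * ε ^ (-(p - 1)) := by
  have hp2 : 0 ≤ p - 2 := by linarith
  have hq : ∀ t ∈ Ico 0 T, ∀ x, |(r t x - s t x) / 2| ≤ ρ := by
    intro t ht x
    have e1 := abs_le.1 (h.abs_le_left hk hM hr ht x)
    have e2 := abs_le.1 (h.abs_le_right hk hM hs ht x)
    rw [abs_le]; constructor <;> linarith [e1.1, e1.2, e2.1, e2.2]
  have hmε : 0 < m * ε := by positivity
  have hdx : 0 < dx r 0 x₁ := hmε.trans_le h1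
  set a₀ := κ * (m * ε / 2) ^ (p - 2) with ha₀
  have ha₀pos : 0 < a₀ := by positivity
  -- After the waiting time |x₁ + X|, the foot of the crossing right-moving characteristic is at
  -- most x₁ - 2(99/100)t ≤ -X. There |s| ≤ mε while |r| ≥ 2mε, whence |q| ≥ mε/2.
  have key := h.time_le hk hM
    (fun t ht x => (mul_nonneg hκ.le (Real.rpow_nonneg (abs_nonneg _) _)).trans
      (hkl _ (hq t ht x))) hdx ha₀pos (abs_nonneg (x₁ + X)) (fun t ht x hx hrx => by
      have ht' : t ∈ Ico 0 T := ⟨(abs_nonneg _).trans ht.1, ht.2⟩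
      refine le_trans ?_ (hkl _ (hq t ht' x))
      refine mul_le_mul_of_nonneg_left (Real.rpow_le_rpow (by positivity) ?_ hp2) hκ.le
      obtain ⟨y, hy, hsy⟩ := h.exists_foot_right hk hM ht' x
      have hyX : y ≤ -X := by
        have := (le_abs_self (x₁ + X)).trans ht.1
        linarith [ht'.1]
      have h4 := h3 y hyX
      rw [← hsy] at h4
      rw [← hrx] at h2
      rw [abs_div, abs_two]
      have := abs_sub_abs_le_abs_sub (r t x) (s t x)
      linarith)
  have e1 : 4 / (a₀ * dx r 0 x₁) ≤ 4 / (κ * (m / 2) ^ (p - 2) * m) * ε ^ (-(p - 1)) := by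
    have hsplit : (m * ε / 2) ^ (p - 2) = (m / 2) ^ (p - 2) * ε ^ (p - 2) := by
      rw [← Real.mul_rpow (by positivity) hε.le]; ring_nf
    have hpow : ε ^ (p - 1) = ε ^ (p - 2) * ε := by
      rw [← Real.rpow_add_one hε.ne']; ring_nf
    calc 4 / (a₀ * dx r 0 x₁) ≤ 4 / (a₀ * (m * ε)) := by gcongr
      _ = 4 / (κ * (m / 2) ^ (p - 2) * m) * ε ^ (-(p - 1)) := by
        rw [Real.rpow_neg hε.le, hpow, ha₀, hsplit]
        have : 0 < ε ^ (p - 2) := by positivity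
        have : 0 < (m / 2) ^ (p - 2) := by positivity
        field_simp
  -- For ε ≤ 1 the waiting time is absorbed into the rate.
  have e2 : |x₁ + X| ≤ |x₁ + X| * ε ^ (-(p - 1)) :=
    le_mul_of_one_le_right (abs_nonneg _)
      (Real.one_le_rpow_of_pos_of_le_one_of_nonpos hε hε1 (by linarith))
  calc T ≤ |x₁ + X| + 4 / (a₀ * dx r 0 x₁) := key
    _ ≤ _ := by rw [add_mul]; exact add_le_add e2 e1

variable {U : Set ℝ} {c : ℝ → ℝ} {δ : ℝ} {a L G : ℝ → ℝ} {K : ℝ}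

theorem SpeedExtension.one (E : SpeedExtension U c δ a L G K) (hc0 : c 0 = 1) : a 0 = 1 := by
  rw [E.eq 0 (by simpa using E.pos.le), hc0]

/-- By the chain rule k' = a'(G)/a(G). Both a ≤ 2 and |G q| ≥ |q|/2 hold with room to spare, and
they produce the constants. -/
theorem SpeedExtension.le_deriv_speed (E : SpeedExtension U c δ a L G K) {p C : ℝ} (hp : 2 ≤ p)
    (hC : 0 < C) (h : ∀ θ, |θ| ≤ δ → C * |θ| ^ (p - 2) ≤ deriv c θ) (q : ℝ) (hq : |q| ≤ δ / 4) :
    C / 2 * (1 / 2) ^ (p - 2) * |q| ^ (p - 2) ≤ deriv (a ∘ G) q := by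
  have h1 := E.abs_inv_le q
  have hGδ : |G q| ≤ δ := by linarith [E.pos]
  have h2 := E.abs_map_le (G q)
  rw [E.right_inv] at h2
  have h3 : 1 / 2 * |q| ≤ |G q| := by linarith [abs_nonneg (G q)]
  rw [E.deriv_speed, E.deriv_eq _ hGδ, le_div_iff₀ (E.apos _)]
  have h4 : (1 / 2 : ℝ) ^ (p - 2) * |q| ^ (p - 2) ≤ |G q| ^ (p - 2) := by
    rw [← Real.mul_rpow (by norm_num) (abs_nonneg q)]
    exact Real.rpow_le_rpow (by positivity) h3 (by linarith)
  have h5 := mul_le_mul_of_nonneg_left h4 hC.le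
  have h6 : 0 ≤ C * ((1 / 2 : ℝ) ^ (p - 2) * |q| ^ (p - 2)) := by positivity
  have h7 := mul_le_mul_of_nonneg_left (show a (G q) / 2 ≤ 1 by linarith [E.upper (G q)]) h6
  have h8 := h _ hGδ
  linarith

theorem deriv_const_mul_fun (ε : ℝ) (φ : ℝ → ℝ) :
    deriv (fun x => ε * φ x) = fun x => ε * deriv φ x := by
  ext x; exact deriv_const_mul_field ε

/-- For small `ε`, the invariant `ε ψ + σ L(ε φ')` at a point is comparable to its linearization. -/
theorem eventually_invariant (E : SpeedExtension U c δ a L G K) (hc0 : c 0 = 1) {σ m b b' v v' : ℝ}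
    (h1 : m < v' + σ * b') (h2 : 2 * m < |v + σ * b|) :
    ∀ᶠ ε in 𝓝[>] (0 : ℝ), m * ε ≤ ε * v' + σ * (a (ε * b) * (ε * b')) ∧
      2 * (m * ε) ≤ |ε * v + σ * L (ε * b)| := by
  have hlim1 : Tendsto (fun ε => v' + σ * (a (ε * b) * b')) (𝓝 0) (𝓝 (v' + σ * b')) := by
    have hc : Continuous fun ε => v' + σ * (a (ε * b) * b') :=
      continuous_const.add (continuous_const.mul
        ((E.contDiff.continuous.comp (by fun_prop)).mul continuous_const))
    have := hc.tendsto 0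
    rwa [zero_mul, E.one hc0, one_mul] at this
  have hlim2 : Tendsto (fun ε => |v + σ * (ε⁻¹ * L (ε * b))|) (𝓝[>] 0) (𝓝 |v + σ * b|) := by
    have hd : HasDerivAt (fun ε => L (ε * b)) b 0 := by
      have := (E.hasDerivAt (0 * b)).comp (0 : ℝ) ((hasDerivAt_id (0 : ℝ)).mul_const b)
      rw [zero_mul, E.one hc0, one_mul, one_mul] at this
      exact this
    have h3 := (hasDerivAt_iff_tendsto_slope_zero.1 hd).mono_left
      (nhdsWithin_mono 0 (fun ε (hε : 0 < ε) => hε.ne'))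
    -- This is L'(0) = a(0) = 1.
    have h4 : Tendsto (fun ε => ε⁻¹ * L (ε * b)) (𝓝[>] 0) (𝓝 b) := by
      refine h3.congr fun ε => ?_
      simp [E.map_zero]
    exact ((h4.const_mul σ).const_add v).abs
  filter_upwards [(hlim1.mono_left nhdsWithin_le_nhds).eventually_const_lt h1,
    hlim2.eventually_const_lt h2, self_mem_nhdsWithin] with ε e1 e2 hε
  have hε' : 0 < ε := hε
  constructor
  · have := mul_le_mul_of_nonneg_left e1.le hε'.le
    linarith
  · have e3 := mul_le_mul_of_nonneg_left e2.le hε'.le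
    have e4 : |ε * v + σ * L (ε * b)| = ε * |v + σ * (ε⁻¹ * L (ε * b))| := by
      rw [← abs_of_pos hε', ← abs_mul, abs_of_pos hε']
      congr 1
      field_simp
    rw [e4]; linarith

/-- A zero with nonzero derivative is isolated, and positivity of F' is an open condition. A nonzero
value is needed because k' may degenerate at q = 0. -/
theorem exists_deriv_pos_ne_zero {F F' : ℝ → ℝ} (hF : ∀ x, HasDerivAt F (F' x) x)
    (hF' : Continuous F') {x₀ : ℝ} (h0 : 0 < F' x₀) : ∃ x, 0 < F' x ∧ F x ≠ 0 := by
  have h1 : ∀ᶠ x in 𝓝[≠] x₀, F x ≠ 0 := (hF x₀).eventually_ne h0.ne'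
  have h2 : ∀ᶠ x in 𝓝[≠] x₀, 0 < F' x :=
    (hF'.continuousAt.eventually_const_lt h0).filter_mono nhdsWithin_le_nhds
  obtain ⟨x, hx1, hx2⟩ := (h1.and h2).exists
  exact ⟨x, hx2, hx1⟩

theorem eventually_smallData (E : SpeedExtension U c δ a L G K) {φ ψ : ℝ → ℝ}
    (hφ : BoundedContDiff 2 φ) (hψ : BoundedContDiff 1 ψ) :
    ∀ᶠ ε in 𝓝[>] (0 : ℝ), SmallData L δ (fun x => ε * φ x) (fun x => ε * ψ x) := by
  obtain ⟨B₀, h0⟩ := hφ.2 0 (by norm_num)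
  obtain ⟨B₁, h1⟩ := hφ.2 1 (by norm_num)
  obtain ⟨B₂, h2⟩ := hφ.2 2 le_rfl
  obtain ⟨D₀, d0⟩ := hψ.2 0 (by norm_num)
  obtain ⟨D₁, d1⟩ := hψ.2 1 le_rfl
  rw [iteratedDeriv_zero] at h0 d0
  rw [iteratedDeriv_one] at h1 d1
  rw [iteratedDeriv_succ, iteratedDeriv_one] at h2
  have hB₁ : 0 ≤ B₁ := (abs_nonneg _).trans (h1 0)
  have hD₀ : 0 ≤ D₀ := (abs_nonneg _).trans (d0 0)
  have hsmall : ∀ᶠ ε in 𝓝[>] (0 : ℝ), ε * (D₀ + 2 * B₁) < δ / 4 := by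
    have : Tendsto (fun ε : ℝ => ε * (D₀ + 2 * B₁)) (𝓝 0) (𝓝 (0 * (D₀ + 2 * B₁))) :=
      (by fun_prop : Continuous fun ε : ℝ => ε * (D₀ + 2 * B₁)).tendsto 0
    rw [zero_mul] at this
    exact (this.mono_left nhdsWithin_le_nhds).eventually_lt_const (by linarith [E.pos])
  filter_upwards [hsmall, self_mem_nhdsWithin] with ε hs hε
  have hε' : 0 < ε := hε
  have hLb : ∀ x, |L (ε * deriv φ x)| ≤ ε * (2 * B₁) := by
    intro x
    have e1 := E.abs_map_le (ε * deriv φ x)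
    rw [abs_mul, abs_of_pos hε'] at e1
    have e2 := mul_le_mul_of_nonneg_left (h1 x) hε'.le
    have e3 : 0 ≤ ε * B₁ := by positivity
    linarith
  have hψb : ∀ x, |ε * ψ x| ≤ ε * D₀ := by
    intro x
    rw [abs_mul, abs_of_pos hε']
    exact mul_le_mul_of_nonneg_left (d0 x) hε'.le
  refine ⟨contDiff_const.mul hφ.1, contDiff_const.mul hψ.1, ⟨ε * B₀, fun x => ?_⟩,
    ⟨ε * max B₂ D₁, fun x => ⟨?_, ?_⟩⟩, fun x => ?_, fun x => ?_⟩
  · rw [abs_mul, abs_of_pos hε']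
    exact mul_le_mul_of_nonneg_left (h0 x) hε'.le
  · rw [deriv_const_mul_fun, deriv_const_mul_fun, abs_mul, abs_of_pos hε']
    exact mul_le_mul_of_nonneg_left ((h2 x).trans (le_max_left _ _)) hε'.le
  · rw [deriv_const_mul_fun, abs_mul, abs_of_pos hε']
    exact mul_le_mul_of_nonneg_left ((d1 x).trans (le_max_right _ _)) hε'.le
  · rw [deriv_const_mul_fun]
    have e1 := abs_add_le (ε * ψ x) (L (ε * deriv φ x))
    linarith [hLb x, hψb x]
  · rw [deriv_const_mul_fun]
    have e1 := abs_sub (ε * ψ x) (L (ε * deriv φ x))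
    linarith [hLb x, hψb x]

/-- The invariants of the data are small relative to `ε` near infinity. -/
theorem exists_far_field (E : SpeedExtension U c δ a L G K) {φ ψ : ℝ → ℝ}
    (hφ : Tendsto (deriv φ) (cocompact ℝ) (𝓝 0)) (hψ : Tendsto ψ (cocompact ℝ) (𝓝 0)) {m : ℝ}
    (hm : 0 < m) :
    ∃ X, ∀ x, X ≤ |x| → ∀ ε > 0, |ε * ψ x| + |L (ε * deriv φ x)| ≤ m * ε := by
  have h1 : ∀ᶠ x in cocompact ℝ, |ψ x| + 2 * |deriv φ x| < m := by
    have : Tendsto (fun x => |ψ x| + 2 * |deriv φ x|) (cocompact ℝ) (𝓝 (|0| + 2 * |0|)) :=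
      hψ.abs.add (hφ.abs.const_mul 2)
    simp only [abs_zero, mul_zero, add_zero] at this
    exact this.eventually_lt_const hm
  obtain ⟨R, hR⟩ := Metric.closedBall_compl_subset_of_mem_cocompact h1 (0 : ℝ)
  refine ⟨R + 1, fun x hx ε hε => ?_⟩
  have h2 : |ψ x| + 2 * |deriv φ x| < m := hR (by
    rw [mem_compl_iff, Metric.mem_closedBall, Real.dist_eq, sub_zero]; linarith)
  have e1 := E.abs_map_le (ε * deriv φ x)
  rw [abs_mul, abs_of_pos hε] at e1
  rw [abs_mul, abs_of_pos hε]
  have e2 := mul_le_mul_of_nonneg_left h2.le hε.le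
  have e3 : 0 ≤ ε * |deriv φ x| := by positivity
  linarith

/-- Blow-up with rate `p - 1` when `c'` vanishes at most like `|θ|^(p - 2)` at the origin. -/
theorem blowsUpWithRate_of_le_deriv (E : SpeedExtension U c δ a L G K) (hc0 : c 0 = 1) {p C : ℝ}
    (hp : 2 ≤ p) (hC : 0 < C) (hc : ∀ θ, |θ| ≤ δ → C * |θ| ^ (p - 2) ≤ deriv c θ) {φ ψ : ℝ → ℝ}
    (hφ : BoundedContDiff 2 φ) (hψ : BoundedContDiff 1 ψ)
    (hφ_lim : Tendsto (deriv φ) (cocompact ℝ) (𝓝 0)) (hψ_lim : Tendsto ψ (cocompact ℝ) (𝓝 0))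
    (hx₀ : ∃ x₀ : ℝ, 0 < deriv ψ x₀ + deriv (deriv φ) x₀ ∨
      0 < deriv ψ x₀ - deriv (deriv φ) x₀) :
    BlowsUpWithRate c U φ ψ (p - 1) := by
  set κ := C / 2 * (1 / 2) ^ (p - 2) with hκdef
  have hκ : 0 < κ := by positivity
  have hφ1 : ContDiff ℝ 1 (deriv φ) := contDiff_one_deriv hφ.1
  have dφ : ∀ x, HasDerivAt (deriv φ) (deriv (deriv φ) x) x :=
    fun x => (hφ1.differentiable one_ne_zero x).hasDerivAt
  have dψ : ∀ x, HasDerivAt ψ (deriv ψ x) x :=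
    fun x => (hψ.1.differentiable one_ne_zero x).hasDerivAt
  have hφc : Continuous (deriv (deriv φ)) := hφ1.continuous_deriv le_rfl
  have hψc : Continuous (deriv ψ) := hψ.1.continuous_deriv le_rfl
  have dinv : ∀ ε σ x, HasDerivAt (fun x => ε * ψ x + σ * L (ε * deriv φ x))
      (ε * deriv ψ x + σ * (a (ε * deriv φ x) * (ε * deriv (deriv φ) x))) x := fun ε σ x =>
    ((dψ x).const_mul ε).add
      (((E.hasDerivAt _).comp x ((dφ x).const_mul ε)).const_mul σ)
  have main : ∃ C' > 0, ∀ᶠ ε in 𝓝[>] (0 : ℝ), ∀ T, 0 < T →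
      HasDiagSol (a ∘ G) (fun x => ε * ψ x + L (deriv (fun x => ε * φ x) x))
        (fun x => ε * ψ x - L (deriv (fun x => ε * φ x) x)) T → T ≤ C' * ε ^ (-(p - 1)) := by
    have hpoint : ∀ σ : ℝ, ∀ x₀, 0 < deriv ψ x₀ + σ * deriv (deriv φ) x₀ → ∃ x₁ m, 0 < m ∧
        ∀ᶠ ε in 𝓝[>] (0 : ℝ), m * ε ≤ deriv (fun x => ε * ψ x + σ * L (ε * deriv φ x)) x₁ ∧
          2 * (m * ε) ≤ |ε * ψ x₁ + σ * L (ε * deriv φ x₁)| := by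
      intro σ x₀ hx
      obtain ⟨x₁, h1, h2⟩ := exists_deriv_pos_ne_zero (F := fun x => ψ x + σ * deriv φ x)
        (F' := fun x => deriv ψ x + σ * deriv (deriv φ) x)
        (fun x => (dψ x).add ((dφ x).const_mul σ)) (by fun_prop) hx
      have h3 := abs_pos.2 h2
      -- The factors 1/2 and 1/4 leave strict inequalities for the linearized invariant, which
      -- persist for the nonlinear one when ε is small.
      refine ⟨x₁, min ((deriv ψ x₁ + σ * deriv (deriv φ) x₁) / 2)
        (|ψ x₁ + σ * deriv φ x₁| / 4), lt_min (by linarith) (by linarith), ?_⟩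
      refine (eventually_invariant E hc0 (σ := σ) (b := deriv φ x₁) (b' := deriv (deriv φ) x₁)
        (v := ψ x₁) (v' := deriv ψ x₁)
        ((min_le_left _ (|ψ x₁ + σ * deriv φ x₁| / 4)).trans_lt (half_lt_self h1)) ?_).mono
        fun ε hε => ?_
      · have := min_le_right ((deriv ψ x₁ + σ * deriv (deriv φ) x₁) / 2)
          (|ψ x₁ + σ * deriv φ x₁| / 4)
        linarith
      · rw [(dinv ε σ x₁).deriv]; exact hε
    have hone : ∀ᶠ ε in 𝓝[>] (0 : ℝ), ε ≤ 1 :=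
      (eventually_le_nhds one_pos).filter_mono nhdsWithin_le_nhds
    obtain ⟨x₀, h0 | h0⟩ := hx₀
    · obtain ⟨x₁, m, hm, hev⟩ := hpoint 1 x₀ (by linarith)
      obtain ⟨X, hX⟩ := exists_far_field E hφ_lim hψ_lim hm
      refine ⟨|x₁ + X| + 4 / (κ * (m / 2) ^ (p - 2) * m), by positivity, ?_⟩
      filter_upwards [hev, hone, eventually_smallData E hφ hψ, self_mem_nhdsWithin]
        with ε hε hε1 D hε0 T hT hsol
      obtain ⟨r, s, h, ⟨M, hM⟩, hr, hs⟩ := hsol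
      have hleft := D.left
      have hright := D.right
      simp only [deriv_const_mul_fun] at hr hs hleft hright
      simp only [one_mul] at hε
      refine h.time_le_rpow E.speed hM hp hκ (E.le_deriv_speed hp hC hc) hm hε0 hε1
        (by rw [hr]; exact hleft) (by rw [hs]; exact hright) ?_ ?_ fun x hx => ?_
      · simp only [dx, hr]; exact hε.1
      · simp only [hr]; exact hε.2
      · have e1 := hX x (by linarith [neg_abs_le x]) ε hε0
        have e2 := abs_sub (ε * ψ x) (L (ε * deriv φ x))
        simp only [hs]; linarith
    -- Now s steepens. In the reflected system its role is played by the first component -s(t, -x),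
    -- started at -x₁.
    · obtain ⟨x₁, m, hm, hev⟩ := hpoint (-1) x₀ (by linarith)
      obtain ⟨X, hX⟩ := exists_far_field E hφ_lim hψ_lim hm
      refine ⟨|-x₁ + X| + 4 / (κ * (m / 2) ^ (p - 2) * m), by positivity, ?_⟩
      filter_upwards [hev, hone, eventually_smallData E hφ hψ, self_mem_nhdsWithin]
        with ε hε hε1 D hε0 T hT hsol
      obtain ⟨r, s, h, ⟨M, hM⟩, hr, hs⟩ := hsol
      have hleft := D.left
      have hright := D.right
      simp only [deriv_const_mul_fun] at hr hs hleft hright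
      simp only [neg_one_mul, ← sub_eq_add_neg] at hε
      refine h.reflect.time_le_rpow E.speed (DiagSol.reflect_gradientBound hM) hp hκ
        (E.le_deriv_speed hp hC hc) hm hε0 hε1 (fun x => ?_) (fun x => ?_) ?_ ?_ fun x hx => ?_
      · rw [abs_neg, hs]; exact hright _
      · rw [abs_neg, hr]; exact hleft _
      · rw [DiagSol.dx_reflect, neg_neg]
        simp only [dx, hs]; exact hε.1
      · rw [abs_neg, neg_neg, hs]; exact hε.2
      · have e1 := hX (-x) (by rw [abs_neg]; linarith [neg_abs_le x]) ε hε0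
        have e2 := abs_add_le (ε * ψ (-x)) (L (ε * deriv φ (-x)))
        rw [abs_neg, hr]; linarith
  obtain ⟨C', hC', hev⟩ := main
  obtain ⟨ε₀, hε₀, hsub⟩ := mem_nhdsGT_iff_exists_Ioc_subset.1
    (hev.and (eventually_smallData E hφ hψ))
  refine ⟨ε₀, hε₀, C', hC', fun ε hε hεε₀ => ?_⟩
  obtain ⟨h1, D⟩ := hsub ⟨hε, hεε₀⟩
  exact D.exists_lifespan E h1

/-- Allows the extension to be built on a smaller neighbourhood while solutions still take u_x in
the original one. -/
theorem SpeedExtension.mono {V : Set ℝ} (E : SpeedExtension U c δ a L G K) (hUV : U ⊆ V) :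
    SpeedExtension V c δ a L G K :=
  { E with subset := fun θ hθ => hUV (E.subset θ hθ) }

end QuasilinearWave

/-! ### The two cases of the theorem -/

theorem theorem2 (U : Set ℝ) (hU : IsOpen U) (h0U : (0 : ℝ) ∈ U)
    (c : ℝ → ℝ) (hc0 : c 0 = 1)
    (φ ψ : ℝ → ℝ)
    (hφ : QuasilinearWave.BoundedContDiff 2 φ) (hψ : QuasilinearWave.BoundedContDiff 1 ψ)
    (hφ_lim : Tendsto (deriv φ) (cocompact ℝ) (𝓝 0))
    (hψ_lim : Tendsto ψ (cocompact ℝ) (𝓝 0))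
    (hx₀ : ∃ x₀ : ℝ, 0 < deriv ψ x₀ + deriv (deriv φ) x₀ ∨ 0 < deriv ψ x₀ - deriv (deriv φ) x₀) :
    (∀ p : ℝ, 2 < p → QuasilinearWave.DegenerateSpeed p U c →
      (∃ C > 0, ∀ θ ∈ U, C * |θ| ^ (p - 2) ≤ deriv c θ) →
      QuasilinearWave.BlowsUpWithRate c U φ ψ (p - 1)) ∧
    (ContDiffOn ℝ 1 c U → 0 < deriv c 0 → QuasilinearWave.BlowsUpWithRate c U φ ψ 1) := by
  constructor
  · rintro p hp ⟨⟨hc, -⟩, -, -⟩ ⟨C, hC, hder⟩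
    have hm : 1 ≤ ⌈p - 2⌉₊ := Nat.one_le_ceil_iff.2 (by linarith)
    have hc1 : ContDiffOn ℝ 1 c U := hc.of_le (by exact_mod_cast hm)
    obtain ⟨δ, a, L, G, K, E⟩ := QuasilinearWave.exists_speedExtension hU h0U hc0 hc1
    exact QuasilinearWave.blowsUpWithRate_of_le_deriv E hc0 hp.le hC
      (fun θ hθ => hder θ (E.subset θ hθ)) hφ hψ hφ_lim hψ_lim hx₀
  · intro hc1 hder
    have hcont : ContinuousOn (deriv c) U := hc1.continuousOn_deriv_of_isOpen hU le_rfl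
    -- On V one has c' > c'(0)/2, the lower bound for p = 2, where the power |θ|^0 is 1 even at θ =
    -- 0.
    obtain ⟨V, hVU, hV, h0V⟩ := mem_nhds_iff.1 (Filter.inter_mem (hU.mem_nhds h0U)
      ((hcont.continuousAt (hU.mem_nhds h0U)).eventually_const_lt (half_lt_self hder)))
    obtain ⟨δ, a, L, G, K, E⟩ := QuasilinearWave.exists_speedExtension hV h0V hc0
      (hc1.mono fun θ hθ => (hVU hθ).1)
    have := QuasilinearWave.blowsUpWithRate_of_le_deriv (E.mono fun θ hθ => (hVU hθ).1) hc0
      le_rfl (half_pos hder) (fun θ hθ => by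
        rw [sub_self, Real.rpow_zero, mul_one]
        exact (hVU (E.subset θ hθ)).2.le) hφ hψ hφ_lim hψ_lim hx₀
    norm_num at this
    exact this
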